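/- Let $q\in\mathbb C$ with $|q|>1$, let $A=\mathcal O(\mathbb C)$ be the algebra of entire functions with the compact-open topology, and let $\alpha=\beta_q$ be the automorphism $\beta_q(f)(z)=f(qz)$. For $f=\sum_m f^{(m)}z^m\in A$ and $\lambda>0$ put $\|f\|_\lambda=\sum_m|f^{(m)}|\lambda^m$. An Arens--Michael algebra is a complete Hausdorff unital $\mathbb C$-algebra whose topology is defined by submultiplicative seminorms. $A_{\alpha^{\pm1}}$ is $A$ as a left module with right action $x\circ a=x\,\alpha^{\pm1}(a)$. A compatible triple $(\theta,\mu,\nu)$ in an Arens--Michael algebra $B$ consists of a continuous homomorphism $\theta:A\to B$ and continuous $A$-bimodule maps $\mu:A_\alpha\to B$, $\nu:A_{\alpha^{-1}}\to B$ with $\mu(x)\nu(y)=\theta(x\alpha(y))$ and $\nu(y)\mu(x)=\theta(y\alpha^{-1}(x))$ for all $x,y\in A$. The topological Laurent tensor algebra $\widehat L_A(A_\alpha)$ is an Arens--Michael algebra with a compatible triple through which every compatible triple factors by a unique continuous algebra homomorphism. For a word $w=w_1\cdots w_k$ in the letters $1,2$ let $|w|=k$, let $c(w)$ be the number of letters $1$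 minus the number of letters $2$, and put $p_i=c(w_1\cdots w_i)$. For $a\in A$ and $k\ge1$ put $$\|a\|_\lambda^{(w)}=\inf\Big\{\sum_j\|a_{1,j}\|_\lambda\cdots\|a_{k,j}\|_\lambda:\ a=\sum_j a_{1,j}\,\alpha^{p_1}(a_{2,j})\cdots\alpha^{p_{k-1}}(a_{k,j})\Big\}$$ (finite sums), and $\|a\|^{(\emptyset)}_\lambda=\|a\|_\lambda$. Let $A\{x_1,x_2;\alpha\}$ be the algebra of formal series $f=\sum_w f_wx^w$, $f_w\in A$, with $\|f\|_{\lambda,\rho}=\sum_w\|f_w\|^{(w)}_\lambda\rho^{|w|}<\infty$ for all $\lambda,\rho>0$, with the topology of these seminorms and the product $(ax^v)(bx^w)=a\,\alpha^{c(v)}(b)\,x^{vw}$. Let $I$ be the closure of the two-sided ideal generated by $x_1x_2-1$ and $x_2x_1-1$. For a family of complex numbers $a=(a^{(m)}_n)_{m\ge0,\,n\in\mathbb Z}$, written as the series $\sum a_n^{(m)}z^mx^n$, put $$\|a\|'_{\lambda,\rho}=\sum_{\substack{n\in\mathbb Z\\|q|^m\le\rho}}|a^{(m)}_n|\lambda^m|q|^{-m\max\{n-1,0\}}\rho^{|n|}+\sum_{\substack{n>0\\\rho<|q|^m\le\rho^2}}|a^{(m)}_n|\lambda^m|q|^{-m(n+1)}\rho^{n+2}+\sum_{\substack{n\le0\\\rho<|q|^m\le\rho^2}}|a^{(m)}_n|\lambda^m\rho^{|n|},$$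 and let $E$ be the space of all such series with $\|a\|'_{\lambda,\rho}<\infty$ for all $\lambda,\rho>0$, with the topology of these seminorms. Then: 1. For $f\in A\{x_1,x_2;\alpha\}$, $m\ge0$, $n\in\mathbb Z$ the sum $\varphi_{m,n}(f)=\sum_{c(w)=n}f_w^{(m)}$ converges absolutely, and $\varphi_{m,n}$ is a continuous linear functional. 2. $I=\bigcap_{m,n}\operatorname{Ker}\varphi_{m,n}$. 3. For all $f\in A\{x_1,x_2;\alpha\}$ and $\lambda,\rho>0$ the quotient seminorm is $\inf_{g\in I}\|f+g\|_{\lambda,\rho}=\big\|(\varphi_{m,n}(f))_{m,n}\big\|'_{\lambda,\rho}$; and $f\mapsto(\varphi_{m,n}(f))_{m,n}$ maps $A\{x_1,x_2;\alpha\}$ onto $E$. 4. $\widehat L_A(A_\alpha)$ exists, and there is an isomorphism of topological vector spaces $\Phi:\widehat L_A(A_\alpha)\to E$ such that, for $f\in A$ and $k\ge0$, $\Phi(\theta(f)\mu(1)^k)=\sum_m f^{(m)}z^mx^k$ and $\Phi(\theta(f)\nu(1)^k)=\sum_m f^{(m)}z^mx^{-k}$. It carries the product to $(ab)^{(m)}_n=\sum_{k\in\mathbb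 Z}\sum_{i+j=m}q^{kj}a^{(i)}_k\,b^{(j)}_{n-k}$ (convergent sums). -/

import Mathlib

open scoped NNReal ENNReal Topology

/-! ### Arens-Michael algebras and topological Laurent tensor algebras -/

/-- An Arens-Michael algebra: a complete Hausdorff unital `ℂ`-algebra whose topology is defined by
a family of submultiplicative seminorms. -/
class ArensMichaelAlgebra (B : Type*) [Ring B] [Algebra ℂ B] [UniformSpace B] : Prop where
  isUniformAddGroup : IsUniformAddGroup B
  completeSpace : CompleteSpace B
  t2Space : T2Space B
  exists_seminorms : ∃ P : Set (Seminorm ℂ B),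
    (∀ p ∈ P, ∀ a b : B, p (a * b) ≤ p a * p b) ∧
      WithSeminorms (fun p : P => (p : Seminorm ℂ B))

/-- A topologically compatible triple `(θ, μ, ν, B)` for the pair of mutually inverse bimodules
`A_α` and `A_{α⁻¹}`. As a left module `A_α` is `A`, with right action `x ∘ a = x * α a`; the
pairings are `i₁ (x ⊗ y) = x * α y` and `i₂ (y ⊗ x) = y * α⁻¹ x`. A continuous map on a completed
projective tensor product over `A` is given by its values on elementary tensors, so the two
compatibility diagrams say exactly `compat₁` and `compat₂`. -/
structure LaurentTriple {A : Type*} [Ring A] [Algebra ℂ A] [TopologicalSpace A] (α : A ≃ₐ[ℂ] A)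
    (B : Type*) [Ring B] [Algebra ℂ B] [TopologicalSpace B] where
  θ : A →A[ℂ] B
  μ : A →L[ℂ] B
  ν : A →L[ℂ] B
  μ_left : ∀ a x, μ (a * x) = θ a * μ x
  μ_right : ∀ x a, μ (x * α a) = μ x * θ a
  ν_left : ∀ a y, ν (a * y) = θ a * ν y
  ν_right : ∀ y a, ν (y * α.symm a) = ν y * θ a
  compat₁ : ∀ x y, μ x * ν y = θ (x * α y)
  compat₂ : ∀ y x, ν y * μ x = θ (y * α.symm x)

/-- `L`, with the triple `t`, is the topological Laurent tensor algebra of `A_α`: every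
topologically compatible triple with values in an Arens-Michael algebra factors through `t` by
exactly one continuous algebra homomorphism. -/
def IsTopLaurentAlgebra.{u} {A : Type*} [Ring A] [Algebra ℂ A] [TopologicalSpace A]
    (α : A ≃ₐ[ℂ] A) (L : Type u) [Ring L] [Algebra ℂ L] [UniformSpace L] [ArensMichaelAlgebra L]
    (t : LaurentTriple α L) : Prop :=
  ∀ (B : Type u) [Ring B] [Algebra ℂ B] [UniformSpace B] [ArensMichaelAlgebra B]
    (s : LaurentTriple α B),
    ∃! f : L →A[ℂ] B, (∀ a, f (t.θ a) = s.θ a) ∧ (∀ x, f (t.μ x) = s.μ x) ∧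
      (∀ y, f (t.ν y) = s.ν y)

/-! ### Words in two letters and twisted noncommutative power series -/

/-- Words in the letters `1`, `2`, represented by `0` and `1` of `Fin 2`. -/
abbrev Word := List (Fin 2)

/-- The letter `1` counts `+1`, the letter `2` counts `-1`. -/
def letterSign (s : Fin 2) : ℤ := if s = 0 then 1 else -1

/-- `c(w)`: the number of letters `1` minus the number of letters `2`. -/
def Word.c (w : Word) : ℤ := (w.map letterSign).sum

/-- `p(w, k)`: the value of `c` on the prefix of length `k`. -/
def Word.p (w : Word) (k : ℕ) : ℤ := Word.c (w.take k)

lemma Word.c_append (v w : Word) : Word.c (v ++ w) = Word.c v + Word.c w := by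
  simp [Word.c]

section Twisted

variable {A : Type*} [Ring A] [Algebra ℂ A]

/-- `x₁ * α^{p(w,1)} x₂ * ⋯ * α^{p(w,k-1)} x_k`, where `k` is the length of `w`. -/
def wordProd (α : A ≃ₐ[ℂ] A) (w : Word) (x : List A) : A :=
  (x.mapIdx fun i a => (α ^ Word.p w i) a).prod

/-- The seminorm `‖a‖^{(w)}` attached to a seminorm `N`: the infimum of `∑ⱼ N(x_{1,j}) ⋯ N(x_{k,j})`
over all finite families with `a = ∑ⱼ wordProd w (x_{1,j}, …, x_{k,j})`, where `k` is the length of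
`w`; for the empty word it is `N`. -/
noncomputable def wordNorm (N : A → ℝ≥0∞) (α : A ≃ₐ[ℂ] A) (w : Word) (a : A) : ℝ≥0∞ :=
  if w = [] then N a else
    ⨅ r : {r : List (List A) // (∀ x ∈ r, x.length = w.length) ∧ (r.map (wordProd α w)).sum = a},
      (r.1.map fun x => (x.map N).prod).sum

/-- Formal series `∑_w a_w x^w` in noncommuting variables `x₁`, `x₂` with coefficients in `A`. -/
@[ext] structure TwistedSeries (α : A ≃ₐ[ℂ] A) where
  coeff : Word → A

namespace TwistedSeries

variable {α : A ≃ₐ[ℂ] A}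

instance : Zero (TwistedSeries α) := ⟨⟨fun _ => 0⟩⟩
instance : One (TwistedSeries α) := ⟨⟨fun w => if w = [] then 1 else 0⟩⟩
instance : Add (TwistedSeries α) := ⟨fun f g => ⟨fun w => f.coeff w + g.coeff w⟩⟩
instance : Neg (TwistedSeries α) := ⟨fun f => ⟨fun w => -f.coeff w⟩⟩
instance : Sub (TwistedSeries α) := ⟨fun f g => ⟨fun w => f.coeff w - g.coeff w⟩⟩
instance (S : Type*) [SMul S A] : SMul S (TwistedSeries α) := ⟨fun s f => ⟨fun w => s • f.coeff w⟩⟩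
/-- The product determined by `(a x^v) (b x^w) = a α^{c(v)}(b) x^{vw}`. -/
instance : Mul (TwistedSeries α) := ⟨fun f g => ⟨fun w =>
  ∑ ij ∈ Finset.HasAntidiagonal.antidiagonal w.length,
    f.coeff (w.take ij.1) * (α ^ Word.c (w.take ij.1)) (g.coeff (w.drop ij.1))⟩⟩

@[simp] lemma coeff_zero (w : Word) : (0 : TwistedSeries α).coeff w = 0 := rfl
lemma coeff_one (w : Word) : (1 : TwistedSeries α).coeff w = if w = [] then 1 else 0 := rfl
@[simp] lemma coeff_add (f g : TwistedSeries α) (w : Word) :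
    (f + g).coeff w = f.coeff w + g.coeff w := rfl
@[simp] lemma coeff_neg (f : TwistedSeries α) (w : Word) : (-f).coeff w = -f.coeff w := rfl
@[simp] lemma coeff_sub (f g : TwistedSeries α) (w : Word) :
    (f - g).coeff w = f.coeff w - g.coeff w := rfl
@[simp] lemma coeff_smul {S : Type*} [SMul S A] (s : S) (f : TwistedSeries α) (w : Word) :
    (s • f).coeff w = s • f.coeff w := rfl
lemma coeff_mul (f g : TwistedSeries α) (w : Word) :
    (f * g).coeff w = ∑ ij ∈ Finset.HasAntidiagonal.antidiagonal w.length,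
      f.coeff (w.take ij.1) * (α ^ Word.c (w.take ij.1)) (g.coeff (w.drop ij.1)) := rfl

instance : AddCommGroup (TwistedSeries α) :=
  Function.Injective.addCommGroup coeff (fun _ _ h => TwistedSeries.ext h) rfl (fun _ _ => rfl)
    (fun _ => rfl) (fun _ _ => rfl) (fun _ _ => rfl) (fun _ _ => rfl)

lemma mul_assoc' (f g h : TwistedSeries α) : f * g * h = f * (g * h) := by
  ext w
  simp only [coeff_mul, Finset.sum_mul, map_sum, Finset.mul_sum, Finset.sum_sigma']
  apply Finset.sum_nbij' (fun ⟨⟨_i, j⟩, ⟨k, l⟩⟩ ↦ ⟨(k, l + j), (l, j)⟩)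
    (fun ⟨⟨i, _j⟩, ⟨k, l⟩⟩ ↦ ⟨(i + k, l), (i, k)⟩)
  · rintro ⟨⟨i, j⟩, ⟨k, l⟩⟩ hh
    simp only [Finset.mem_sigma, Finset.HasAntidiagonal.mem_antidiagonal, List.length_take,
      List.length_drop] at hh ⊢
    omega
  · rintro ⟨⟨i, j⟩, ⟨k, l⟩⟩ hh
    simp only [Finset.mem_sigma, Finset.HasAntidiagonal.mem_antidiagonal, List.length_take,
      List.length_drop] at hh ⊢
    omega
  · rintro ⟨⟨i, j⟩, ⟨k, l⟩⟩ hh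
    simp only [Finset.mem_sigma, Finset.HasAntidiagonal.mem_antidiagonal, List.length_take] at hh
    obtain ⟨h1, h2⟩ := hh
    have : i = k + l := by omega
    subst this; rfl
  · rintro ⟨⟨i, j⟩, ⟨k, l⟩⟩ hh
    simp only [Finset.mem_sigma, Finset.HasAntidiagonal.mem_antidiagonal, List.length_drop] at hh
    obtain ⟨h1, h2⟩ := hh
    have : j = k + l := by omega
    subst this; rfl
  · rintro ⟨⟨i, j⟩, ⟨k, l⟩⟩ hh
    simp only [Finset.mem_sigma, Finset.HasAntidiagonal.mem_antidiagonal, List.length_take] at hh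
    obtain ⟨h1, h2⟩ := hh
    have hi : i = k + l := by omega
    subst hi
    have e1 : List.take k (List.take (k + l) w) = List.take k w := by
      rw [List.take_take]; congr 1; omega
    have e2 : List.drop k (List.take (k + l) w) = List.take l (List.drop k w) := by
      rw [List.drop_take]; congr 1; omega
    have e3 : List.drop l (List.drop k w) = List.drop (k + l) w := by
      rw [List.drop_drop]
    have e4 : Word.c (List.take (k + l) w) =
        Word.c (List.take k w) + Word.c (List.take l (List.drop k w)) := by
      rw [← Word.c_append, ← List.take_add]
    simp only [e1, e2, e3, e4, map_mul, mul_assoc, zpow_add, AlgEquiv.mul_apply]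

lemma one_mul' (f : TwistedSeries α) : 1 * f = f := by
  ext w
  rw [coeff_mul, Finset.sum_eq_single (0, w.length)]
  · simp [coeff_one, Word.c]
  · rintro ⟨i, j⟩ hij hne
    rw [Finset.HasAntidiagonal.mem_antidiagonal] at hij
    have : List.take i w ≠ [] := by
      intro h
      have := congrArg List.length h
      simp only [List.length_take, List.length_nil] at this
      apply hne
      ext <;> simp <;> simp at hij <;> omega
    simp [coeff_one, this]
  · intro h; simp at h

lemma mul_one' (f : TwistedSeries α) : f * 1 = f := by
  ext w
  rw [coeff_mul, Finset.sum_eq_single (w.length, 0)]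
  · simp [coeff_one]
  · rintro ⟨i, j⟩ hij hne
    rw [Finset.HasAntidiagonal.mem_antidiagonal] at hij
    have : List.drop i w ≠ [] := by
      intro h
      have := congrArg List.length h
      simp only [List.length_drop, List.length_nil] at this
      apply hne
      ext <;> simp <;> simp at hij <;> omega
    simp [coeff_one, this]
  · intro h; simp at h

instance : Ring (TwistedSeries α) :=
  { (inferInstance : AddCommGroup (TwistedSeries α)) with
    mul_assoc := mul_assoc'
    one_mul := one_mul'
    mul_one := mul_one'
    left_distrib := fun f g h => by
      ext w; simp [coeff_mul, mul_add, Finset.sum_add_distrib]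
    right_distrib := fun f g h => by
      ext w; simp [coeff_mul, add_mul, Finset.sum_add_distrib]
    zero_mul := fun f => by ext w; simp [coeff_mul]
    mul_zero := fun f => by ext w; simp [coeff_mul] }

instance : Module ℂ (TwistedSeries α) where
  one_smul f := by ext w; simp
  mul_smul a b f := by ext w; simp [mul_smul]
  smul_zero a := by ext w; simp
  smul_add a f g := by ext w; simp
  add_smul a b f := by ext w; simp [add_smul]
  zero_smul f := by ext w; simp

instance : Algebra ℂ (TwistedSeries α) :=
  Algebra.ofModule
    (fun a f g => by ext w; simp [coeff_mul, Finset.smul_sum])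
    (fun a f g => by ext w; simp [coeff_mul, Finset.smul_sum])

/-- The monomial `x^v`. -/
def mono (α : A ≃ₐ[ℂ] A) (v : Word) : TwistedSeries α := ⟨fun w => if w = v then 1 else 0⟩

end TwistedSeries

/-! #### Properties of `wordNorm` -/

lemma wordNorm_nil (N : A → ℝ≥0∞) (α : A ≃ₐ[ℂ] A) (a : A) : wordNorm N α [] a = N a := by
  simp [wordNorm]

lemma wordNorm_le (N : A → ℝ≥0∞) (α : A ≃ₐ[ℂ] A) {w : Word} (hw : w ≠ []) (r : List (List A))
    (hr : ∀ x ∈ r, x.length = w.length) :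
    wordNorm N α w (r.map (wordProd α w)).sum ≤ (r.map fun x => (x.map N).prod).sum := by
  rw [wordNorm, if_neg hw]
  exact iInf_le_of_le ⟨r, hr, rfl⟩ le_rfl

lemma exists_of_wordNorm_lt {N : A → ℝ≥0∞} {α : A ≃ₐ[ℂ] A} {w : Word} (hw : w ≠ []) {a : A}
    {t : ℝ≥0∞} (h : wordNorm N α w a < t) :
    ∃ r : List (List A), (∀ x ∈ r, x.length = w.length) ∧ (r.map (wordProd α w)).sum = a ∧
      (r.map fun x => (x.map N).prod).sum < t := by
  rw [wordNorm, if_neg hw, iInf_lt_iff] at h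
  obtain ⟨⟨r, h1, h2⟩, h3⟩ := h
  exact ⟨r, h1, h2, h3⟩

lemma wordNorm_add_le {N : A → ℝ≥0∞} (hN : ∀ a b, N (a + b) ≤ N a + N b) (α : A ≃ₐ[ℂ] A) (w : Word)
    (a b : A) : wordNorm N α w (a + b) ≤ wordNorm N α w a + wordNorm N α w b := by
  by_cases hw : w = []
  · subst hw; simpa only [wordNorm_nil] using hN a b
  · refine ENNReal.le_of_forall_pos_le_add fun ε hε htop => ?_
    have hne := (ENNReal.add_lt_top.1 htop)
    have hε' : (ε / 2 : ℝ≥0∞) ≠ 0 := by simp [hε.ne']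
    obtain ⟨r, r1, r2, r3⟩ := exists_of_wordNorm_lt hw (ENNReal.lt_add_right hne.1.ne hε')
    obtain ⟨s, s1, s2, s3⟩ := exists_of_wordNorm_lt hw (ENNReal.lt_add_right hne.2.ne hε')
    have := wordNorm_le N α hw (r ++ s) (by
      intro x hx
      rcases List.mem_append.1 hx with hx | hx
      · exact r1 x hx
      · exact s1 x hx)
    simp only [List.map_append, List.sum_append, r2, s2] at this
    refine this.trans ((add_le_add r3.le s3.le).trans ?_)
    rw [add_add_add_comm, ENNReal.add_halves]

lemma wordProd_append (α : A ≃ₐ[ℂ] A) (v w : Word) (x y : List A) (hx : x.length = v.length) :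
    wordProd α (v ++ w) (x ++ y) = wordProd α v x * (α ^ Word.c v) (wordProd α w y) := by
  unfold wordProd
  rw [List.mapIdx_append, List.prod_append, map_list_prod]
  congr 2
  · apply List.ext_getElem (by simp)
    intro i h1 h2
    have hi : i < v.length := by simpa [hx] using h1
    simp only [List.getElem_mapIdx, Word.p]
    rw [List.take_append_of_le_length hi.le]
  · apply List.ext_getElem (by simp)
    intro i h1 h2
    have e : (v ++ w).p (i + x.length) = Word.c v + w.p i := by
      unfold Word.p
      rw [hx, add_comm i, List.take_length_add_append, Word.c_append]
    simp only [List.getElem_map, List.getElem_mapIdx, e, zpow_add, AlgEquiv.mul_apply]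

lemma wordProd_mul_left (α : A ≃ₐ[ℂ] A) (w : Word) (b x : A) (xs : List A) :
    wordProd α w ((b * x) :: xs) = b * wordProd α w (x :: xs) := by
  simp [wordProd, Word.p, Word.c, mul_assoc]

lemma wordProd_mul_right (α : A ≃ₐ[ℂ] A) (w : Word) (s : Fin 2) (b x : A) (xs : List A)
    (h : xs.length = w.length) :
    wordProd α (w ++ [s]) (xs ++ [x * (α ^ letterSign s) b]) =
      wordProd α (w ++ [s]) (xs ++ [x]) * (α ^ Word.c (w ++ [s])) b := by
  rw [wordProd_append _ _ _ _ _ h, wordProd_append _ _ _ _ _ h, Word.c_append, zpow_add]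
  simp [wordProd, Word.p, Word.c, mul_assoc]

lemma wordNorm_zero {N : A → ℝ≥0∞} (h0 : N 0 = 0) (α : A ≃ₐ[ℂ] A) (w : Word) :
    wordNorm N α w 0 = 0 := by
  by_cases hw : w = []
  · subst hw; rw [wordNorm_nil, h0]
  · simpa using wordNorm_le N α hw [] (by simp)

lemma wordNorm_one_le {N : A → ℝ≥0∞} (h1 : N 1 ≤ 1) (α : A ≃ₐ[ℂ] A) (w : Word) :
    wordNorm N α w 1 ≤ 1 := by
  by_cases hw : w = []
  · subst hw; rwa [wordNorm_nil]
  · have h := wordNorm_le N α hw [List.replicate w.length 1] (by simp)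
    have e : wordProd α w (List.replicate w.length 1) = 1 := by
      unfold wordProd
      apply List.prod_eq_one
      intro x hx
      rw [List.mem_mapIdx] at hx
      obtain ⟨i, hi, rfl⟩ := hx
      simp
    simp only [List.map_cons, List.map_nil, List.sum_cons, List.sum_nil, add_zero, e,
      List.map_replicate, List.prod_replicate] at h
    exact h.trans (pow_le_one' h1 _)

lemma wordNorm_mono {N N' : A → ℝ≥0∞} (h : ∀ a, N a ≤ N' a) (α : A ≃ₐ[ℂ] A) (w : Word) (a : A) :
    wordNorm N α w a ≤ wordNorm N' α w a := by
  unfold wordNorm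
  split_ifs
  · exact h a
  · refine iInf_mono fun r => ?_
    refine List.sum_le_sum fun x _ => ?_
    generalize x = y
    induction y with
    | nil => simp
    | cons a t ih => simpa using mul_le_mul' (h a) ih

lemma wordNorm_map_le {N : A → ℝ≥0∞} (α : A ≃ₐ[ℂ] A) {w : Word} (hw : w ≠ []) (T : A →+ A)
    {K : ℝ≥0∞} (hK : K ≠ ∞)
    (hT : ∀ x : List A, x.length = w.length → ∃ y : List A, y.length = w.length ∧
      wordProd α w y = T (wordProd α w x) ∧ (y.map N).prod ≤ K * (x.map N).prod) (a : A) :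
    wordNorm N α w (T a) ≤ K * wordNorm N α w a := by
  conv_rhs => rw [wordNorm, if_neg hw]
  rw [ENNReal.mul_iInf' (fun h => (hK h).elim) (fun _ => ⟨⟨[a :: List.replicate (w.length - 1) 1],
    by
      have := List.length_pos_iff.2 hw
      simp; omega,
    by
      have e : (List.replicate (w.length - 1) (1 : A)).mapIdx
          (fun i x => (α ^ Word.p w (i + 1)) x) = List.replicate (w.length - 1) 1 := by
        apply List.ext_getElem <;> simp
      simp [wordProd, Word.p, Word.c] at e ⊢
      simp [e]⟩⟩)]
  refine le_iInf fun ⟨r, h1, h2⟩ => ?_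
  have key : ∃ r' : List (List A), (∀ x ∈ r', x.length = w.length) ∧
      (r'.map (wordProd α w)).sum = T ((r.map (wordProd α w)).sum) ∧
      (r'.map fun x => (x.map N).prod).sum ≤ K * (r.map fun x => (x.map N).prod).sum := by
    clear h2
    induction r with
    | nil => exact ⟨[], by simp, by simp, by simp⟩
    | cons x r ih =>
      obtain ⟨r', a1, a2, a3⟩ := ih (fun y hy => h1 y (by simp [hy]))
      obtain ⟨y, b1, b2, b3⟩ := hT x (h1 x (by simp))
      refine ⟨y :: r', ?_, ?_, ?_⟩
      · intro z hz
        rcases List.mem_cons.1 hz with rfl | hz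
        · exact b1
        · exact a1 z hz
      · simp [a2, b2]
      · simpa [mul_add] using add_le_add b3 a3
  obtain ⟨r', a1, a2, a3⟩ := key
  refine le_trans ?_ a3
  have := wordNorm_le N α hw r' a1
  rwa [a2, h2] at this

lemma wordNorm_mul_left_le {N : A → ℝ≥0∞} (α : A ≃ₐ[ℂ] A) {w : Word} (hw : w ≠ []) (b : A)
    {K : ℝ≥0∞} (hK : K ≠ ∞) (hb : ∀ x, N (b * x) ≤ K * N x) (a : A) :
    wordNorm N α w (b * a) ≤ K * wordNorm N α w a := by
  refine wordNorm_map_le α hw (AddMonoidHom.mulLeft b) hK (fun x hx => ?_) a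
  match x, hx with
  | [], hx => exact (hw (List.length_eq_zero_iff.1 hx.symm)).elim
  | y :: ys, hx =>
    refine ⟨(b * y) :: ys, by simpa using hx, by simp [wordProd_mul_left], ?_⟩
    simpa [mul_assoc] using mul_le_mul_left (hb y) _

lemma wordNorm_mul_right_le {N : A → ℝ≥0∞} (α : A ≃ₐ[ℂ] A) {w : Word} (hw : w ≠ []) (b : A)
    {K : ℝ≥0∞} (hK : K ≠ ∞) (hb : ∀ s x, N (x * (α ^ letterSign s) b) ≤ K * N x) (a : A) :
    wordNorm N α w (a * (α ^ Word.c w) b) ≤ K * wordNorm N α w a := by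
  refine wordNorm_map_le α hw (AddMonoidHom.mulRight ((α ^ Word.c w) b)) hK (fun x hx => ?_) a
  obtain ⟨v, s, rfl⟩ : ∃ v s, w = v ++ [s] := ⟨_, _, (List.dropLast_append_getLast hw).symm⟩
  have hx0 : x ≠ [] := by rintro rfl; simp at hx
  obtain ⟨ys, y, rfl⟩ : ∃ ys y, x = ys ++ [y] := ⟨_, _, (List.dropLast_append_getLast hx0).symm⟩
  have hl : ys.length = v.length := by simpa using hx
  refine ⟨ys ++ [y * (α ^ letterSign s) b], by simpa using hx, ?_, ?_⟩
  · rw [wordProd_mul_right _ _ _ _ _ _ hl]; rfl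
  · simp only [List.map_append, List.map_cons, List.map_nil, List.prod_append, List.prod_cons,
      List.prod_nil, mul_one]
    rw [mul_left_comm]
    exact mul_le_mul_right (hb s y) _

lemma wordNorm_append_le {N : A → ℝ≥0∞} (α : A ≃ₐ[ℂ] A) {v w : Word} (hv : v ≠ [])
    (hw : w ≠ []) {a b : A} (ha : wordNorm N α v a ≠ ∞) (hb : wordNorm N α w b ≠ ∞) :
    wordNorm N α (v ++ w) (a * (α ^ Word.c v) b) ≤ wordNorm N α v a * wordNorm N α w b := by
  have ha' := ha
  have hb' := hb
  conv_rhs => rw [wordNorm, if_neg hv, wordNorm, if_neg hw]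
  rw [wordNorm, if_neg hv] at ha'
  rw [wordNorm, if_neg hw] at hb'
  refine ENNReal.le_iInf_mul_iInf ?_ ?_ ?_
  · by_contra! h; exact ha' (by simp only [h, iInf_top])
  · by_contra! h; exact hb' (by simp only [h, iInf_top])
  rintro ⟨r, r1, r2⟩ ⟨s, s1, s2⟩
  have hvw : v ++ w ≠ [] := by simp [hv]
  have h := wordNorm_le N α hvw (r.flatMap fun x => s.map fun y => x ++ y) (by
    intro z hz
    simp only [List.mem_flatMap, List.mem_map] at hz
    obtain ⟨x, hx, y, hy, rfl⟩ := hz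
    simp [r1 x hx, s1 y hy])
  have e1 : ((r.flatMap fun x => s.map fun y => x ++ y).map (wordProd α (v ++ w))).sum =
      a * (α ^ Word.c v) b := by
    rw [← r2, ← s2]
    clear h r2
    induction r with
    | nil => simp
    | cons x r ih =>
      rw [List.flatMap_cons, List.map_append, List.sum_append, ih fun y hy => r1 y (by simp [hy]),
        List.map_cons, List.sum_cons, add_mul]
      congr 1
      rw [map_list_sum, ← List.sum_map_mul_left, List.map_map, List.map_map]
      congr 1
      refine List.map_congr_left fun y _ => ?_
      simp only [Function.comp_apply]
      exact wordProd_append α v w x y (r1 x (by simp))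
  have e2 : ((r.flatMap fun x => s.map fun y => x ++ y).map fun x => (x.map N).prod).sum =
      (r.map fun x => (x.map N).prod).sum * (s.map fun x => (x.map N).prod).sum := by
    clear h e1 r2 r1
    induction r with
    | nil => simp
    | cons x r ih =>
      rw [List.flatMap_cons, List.map_append, List.sum_append, ih, List.map_cons, List.sum_cons,
        add_mul]
      congr 1
      rw [← List.sum_map_mul_left, List.map_map]
      congr 1
      refine List.map_congr_left fun y _ => ?_
      simp
  rwa [e1, e2] at h

end Twisted

/-! ### Entire functions -/

/-- The algebra `𝓞(ℂ)` of entire functions, with the compact-open topology induced from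
`C(ℂ, ℂ)`. -/
def entireSubalgebra : Subalgebra ℂ C(ℂ, ℂ) where
  carrier := {f | Differentiable ℂ f}
  mul_mem' := fun hf hg => hf.mul hg
  add_mem' := fun hf hg => hf.add hg
  algebraMap_mem' := fun c => differentiable_const c

/-- The algebra of entire functions as a type of its own. -/
def Entire : Type := entireSubalgebra

noncomputable instance : CommRing Entire := inferInstanceAs (CommRing entireSubalgebra)
noncomputable instance : Algebra ℂ Entire := inferInstanceAs (Algebra ℂ entireSubalgebra)
instance : TopologicalSpace Entire := inferInstanceAs (TopologicalSpace entireSubalgebra)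

/-- `f(z) ↦ f(q z)`. -/
noncomputable def dilate (q : ℂ) (f : Entire) : Entire :=
  ⟨⟨fun z => f.1 (q * z), by fun_prop⟩,
    (show Differentiable ℂ f.1 from f.2).comp (differentiable_id.const_mul q)⟩

/-- The automorphism `β_q f (z) = f (q z)`. -/
noncomputable def dilation (q : ℂˣ) : Entire ≃ₐ[ℂ] Entire where
  toFun := dilate q
  invFun := dilate (q⁻¹ : ℂˣ)
  left_inv f := Subtype.ext (ContinuousMap.ext fun z => by simp [dilate])
  right_inv f := Subtype.ext (ContinuousMap.ext fun z => by simp [dilate])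
  map_mul' _ _ := rfl
  map_add' _ _ := rfl
  commutes' _ := rfl

/-- The Taylor coefficient `f^{(m)}` of `z^m` at the origin. -/
noncomputable def taylorCoeff (f : Entire) (m : ℕ) : ℂ :=
  iteratedDeriv m (fun z => f.1 z) 0 / (m.factorial : ℂ)

/-- `‖f‖_l = ∑_m |f^{(m)}| l^m`. -/
noncomputable def entireNorm (l : ℝ≥0) (f : Entire) : ℝ≥0∞ :=
  ∑' m : ℕ, ‖taylorCoeff f m‖ₑ * (l : ℝ≥0∞) ^ m

lemma Entire.contDiff (f : Entire) (n : ℕ∞) : ContDiff ℂ n (fun z => f.1 z) :=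
  Differentiable.contDiff f.2

lemma taylorCoeff_add (f g : Entire) (m : ℕ) :
    taylorCoeff (f + g) m = taylorCoeff f m + taylorCoeff g m := by
  unfold taylorCoeff
  rw [← add_div]
  congr 1
  exact iteratedDeriv_add (f.contDiff m).contDiffAt (g.contDiff m).contDiffAt

lemma taylorCoeff_smul (c : ℂ) (f : Entire) (m : ℕ) :
    taylorCoeff (c • f) m = c * taylorCoeff f m := by
  unfold taylorCoeff
  rw [← mul_div_assoc]
  congr 1
  exact iteratedDeriv_const_mul_field c _

lemma taylorCoeff_mul (f g : Entire) (m : ℕ) :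
    taylorCoeff (f * g) m =
      ∑ ij ∈ Finset.HasAntidiagonal.antidiagonal m, taylorCoeff f ij.1 * taylorCoeff g ij.2 := by
  have h : iteratedDeriv m (fun z => (f * g).1 z) 0 = _ :=
    iteratedDeriv_mul (f.contDiff m).contDiffAt (g.contDiff m).contDiffAt
  unfold taylorCoeff
  rw [h, Finset.Nat.sum_antidiagonal_eq_sum_range_succ_mk, Finset.sum_div]
  refine Finset.sum_congr rfl fun i hi => ?_
  have hi : i ≤ m := Nat.lt_succ_iff.1 (Finset.mem_range.1 hi)
  have := Nat.choose_mul_factorial_mul_factorial hi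
  have h1 : (m.factorial : ℂ) ≠ 0 := by exact_mod_cast m.factorial_ne_zero
  have h2 : (i.factorial : ℂ) ≠ 0 := by exact_mod_cast i.factorial_ne_zero
  have h3 : ((m - i).factorial : ℂ) ≠ 0 := by exact_mod_cast (m - i).factorial_ne_zero
  have h4 : (m.choose i : ℂ) * i.factorial * (m - i).factorial = m.factorial := by exact_mod_cast this
  simp only
  have h5 : (m.choose i : ℂ) ≠ 0 := by
    intro h; rw [h] at h4; simp at h4; exact h1 h4.symm
  rw [← h4]
  field_simp

lemma taylorCoeff_one (m : ℕ) : taylorCoeff 1 m = if m = 0 then 1 else 0 := by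
  have : (fun z : ℂ => (1 : Entire).1 z) = fun _ => 1 := rfl
  unfold taylorCoeff
  rw [this, iteratedDeriv_const]
  split_ifs with h
  · subst h; simp
  · simp

lemma taylorCoeff_dilation (q : ℂˣ) (f : Entire) (m : ℕ) :
    taylorCoeff (dilation q f) m = (q : ℂ) ^ m * taylorCoeff f m := by
  have h : iteratedDeriv m (fun z => (dilation q f).1 z) 0 =
      (q : ℂ) ^ m * iteratedDeriv m (fun z => f.1 z) ((q : ℂ) * 0) :=
    congrFun (iteratedDeriv_comp_const_mul (f.contDiff m) (q : ℂ)) 0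
  unfold taylorCoeff
  rw [h]
  simp [mul_div_assoc]

lemma entireNorm_add_le (l : ℝ≥0) (f g : Entire) :
    entireNorm l (f + g) ≤ entireNorm l f + entireNorm l g := by
  unfold entireNorm
  rw [← ENNReal.tsum_add]
  refine ENNReal.tsum_le_tsum fun m => ?_
  rw [taylorCoeff_add, ← add_mul]
  gcongr
  exact enorm_add_le _ _

lemma entireNorm_smul (l : ℝ≥0) (c : ℂ) (f : Entire) :
    entireNorm l (c • f) = ‖c‖ₑ * entireNorm l f := by
  unfold entireNorm
  rw [← ENNReal.tsum_mul_left]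
  simp only [taylorCoeff_smul, enorm_mul, mul_assoc]

lemma entireNorm_zero (l : ℝ≥0) : entireNorm l 0 = 0 := by
  simpa using entireNorm_smul l 0 0

lemma entireNorm_one (l : ℝ≥0) : entireNorm l 1 = 1 := by
  unfold entireNorm
  rw [tsum_eq_single 0]
  · simp [taylorCoeff_one]
  · intro m hm; simp [taylorCoeff_one, hm]

lemma entireNorm_mul_le (l : ℝ≥0) (f g : Entire) :
    entireNorm l (f * g) ≤ entireNorm l f * entireNorm l g := by
  have e : entireNorm l f * entireNorm l g = ∑' p : ℕ × ℕ,
      (‖taylorCoeff f p.1‖ₑ * (l : ℝ≥0∞) ^ p.1) * (‖taylorCoeff g p.2‖ₑ * (l : ℝ≥0∞) ^ p.2) := by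
    rw [ENNReal.tsum_prod']
    simp only [ENNReal.tsum_mul_left, ENNReal.tsum_mul_right]
    rfl
  rw [e, ← Finset.HasAntidiagonal.sigmaAntidiagonalEquivProd.tsum_eq, ENNReal.tsum_sigma']
  unfold entireNorm
  refine ENNReal.tsum_le_tsum fun m => ?_
  rw [taylorCoeff_mul, tsum_fintype, Finset.univ_eq_attach]
  simp only [Finset.HasAntidiagonal.sigmaAntidiagonalEquivProd_apply]
  rw [Finset.sum_attach (Finset.HasAntidiagonal.antidiagonal m) fun p : ℕ × ℕ =>
    (‖taylorCoeff f p.1‖ₑ * (l : ℝ≥0∞) ^ p.1) * (‖taylorCoeff g p.2‖ₑ * (l : ℝ≥0∞) ^ p.2)]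
  refine (mul_le_mul_left (enorm_sum_le _ _) _).trans ?_
  rw [Finset.sum_mul]
  refine Finset.sum_le_sum fun p hp => ?_
  rw [← Finset.HasAntidiagonal.mem_antidiagonal.1 hp, enorm_mul, pow_add]
  exact le_of_eq (by ring)

lemma entireNorm_mono {l l' : ℝ≥0} (h : l ≤ l') (f : Entire) :
    entireNorm l f ≤ entireNorm l' f := by
  unfold entireNorm
  gcongr

lemma entireNorm_dilation_le (q : ℂˣ) {l l' : ℝ≥0} (h : l * ‖(q : ℂ)‖₊ ≤ l') (f : Entire) :
    entireNorm l (dilation q f) ≤ entireNorm l' f := by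
  refine le_trans (le_of_eq ?_) (entireNorm_mono h f)
  unfold entireNorm
  refine tsum_congr fun m => ?_
  rw [taylorCoeff_dilation, enorm_mul, enorm_pow, ENNReal.coe_mul, mul_pow]
  simp only [enorm]
  ring

/-! ### The algebra of convergent twisted series -/

/-- `‖f‖_{l,r} = ∑_w ‖f_w‖_l^{(w)} r^{|w|}`. -/
noncomputable def convNorm (q : ℂˣ) (l r : ℝ≥0) (f : TwistedSeries (dilation q)) : ℝ≥0∞ :=
  ∑' w : Word, wordNorm (entireNorm l) (dilation q) w (f.coeff w) * (r : ℝ≥0∞) ^ w.length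

lemma convNorm_add_le (q : ℂˣ) (l r : ℝ≥0) (f g : TwistedSeries (dilation q)) :
    convNorm q l r (f + g) ≤ convNorm q l r f + convNorm q l r g := by
  unfold convNorm
  rw [← ENNReal.tsum_add]
  refine ENNReal.tsum_le_tsum fun w => ?_
  rw [← add_mul]
  gcongr
  exact wordNorm_add_le (entireNorm_add_le l) _ _ _ _

lemma convNorm_zero (q : ℂˣ) (l r : ℝ≥0) : convNorm q l r 0 = 0 := by
  simp [convNorm, wordNorm_zero (entireNorm_zero l)]

lemma wordNorm_smul_le (q : ℂˣ) (l : ℝ≥0) (c : ℂ) (w : Word) (a : Entire) :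
    wordNorm (entireNorm l) (dilation q) w (c • a) ≤
      ‖c‖ₑ * wordNorm (entireNorm l) (dilation q) w a := by
  by_cases hw : w = []
  · subst hw; rw [wordNorm_nil, wordNorm_nil, entireNorm_smul]
  · have := wordNorm_mul_left_le (N := entireNorm l) (dilation q) hw (algebraMap ℂ Entire c)
      (K := ‖c‖ₑ) enorm_ne_top (fun x => by rw [← Algebra.smul_def, entireNorm_smul]) a
    rwa [← Algebra.smul_def] at this

lemma convNorm_smul_le (q : ℂˣ) (l r : ℝ≥0) (c : ℂ) (f : TwistedSeries (dilation q)) :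
    convNorm q l r (c • f) ≤ ‖c‖ₑ * convNorm q l r f := by
  unfold convNorm
  rw [← ENNReal.tsum_mul_left]
  refine ENNReal.tsum_le_tsum fun w => ?_
  rw [← mul_assoc]
  gcongr
  exact wordNorm_smul_le q l c w _

lemma convNorm_mono_le (q : ℂˣ) (l r : ℝ≥0) (v : Word) :
    convNorm q l r (TwistedSeries.mono (dilation q) v) ≤ (r : ℝ≥0∞) ^ v.length := by
  unfold convNorm
  rw [tsum_eq_single v]
  · simp only [TwistedSeries.mono, if_true]
    exact mul_le_of_le_one_left' (wordNorm_one_le (entireNorm_one l).le _ _)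
  · intro w hw
    simp [TwistedSeries.mono, hw, wordNorm_zero (entireNorm_zero l)]

lemma wordNorm_mul_le (q : ℂˣ) {l l' : ℝ≥0} (h1 : l ≤ l') (h2 : l * ‖(q : ℂ)‖₊ ≤ l')
    (h3 : l * ‖((q⁻¹ : ℂˣ) : ℂ)‖₊ ≤ l') (v w : Word) (a b : Entire)
    (ha : wordNorm (entireNorm l') (dilation q) v a ≠ ∞)
    (hb : wordNorm (entireNorm l') (dilation q) w b ≠ ∞) :
    wordNorm (entireNorm l) (dilation q) (v ++ w) (a * (dilation q ^ Word.c v) b) ≤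
      wordNorm (entireNorm l') (dilation q) v a * wordNorm (entireNorm l') (dilation q) w b := by
  have hm : ∀ u x, wordNorm (entireNorm l) (dilation q) u x ≤
      wordNorm (entireNorm l') (dilation q) u x := wordNorm_mono (entireNorm_mono h1) _
  by_cases hv : v = []
  · subst hv
    rw [wordNorm_nil] at ha ⊢
    have e : (dilation q ^ Word.c []) b = b := by simp [Word.c]
    rw [e, List.nil_append]
    by_cases hw : w = []
    · subst hw
      rw [wordNorm_nil, wordNorm_nil]
      exact (entireNorm_mono h1 _).trans (entireNorm_mul_le l' a b)
    · exact (hm _ _).trans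
        (wordNorm_mul_left_le _ hw a ha (fun x => entireNorm_mul_le l' a x) b)
  · by_cases hw : w = []
    · subst hw
      rw [wordNorm_nil] at hb ⊢
      rw [List.append_nil, mul_comm (wordNorm _ _ _ _)]
      refine (wordNorm_mul_right_le _ hv b hb (fun s x => ?_) a).trans ?_
      · rw [mul_comm (entireNorm l' b)]
        refine (entireNorm_mul_le l _ _).trans ?_
        gcongr
        unfold letterSign
        split_ifs
        · rw [zpow_one]; exact entireNorm_dilation_le q h2 b
        · have : dilation q ^ (-1 : ℤ) = dilation q⁻¹ := by
            rw [zpow_neg_one]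
            ext f : 1
            change (dilation q).symm f = _
            rfl
          rw [this]; exact entireNorm_dilation_le q⁻¹ h3 b
      · gcongr
        exact hm _ _
    · have ha' := ne_top_of_le_ne_top ha (hm v a)
      have hb' := ne_top_of_le_ne_top hb (hm w b)
      exact (wordNorm_append_le _ hv hw ha' hb').trans (mul_le_mul' (hm _ _) (hm _ _))

lemma wordNorm_ne_top_of_convNorm {q : ℂˣ} {l r : ℝ≥0} (hr : 0 < r)
    {f : TwistedSeries (dilation q)} (hf : convNorm q l r f < ∞) (w : Word) :
    wordNorm (entireNorm l) (dilation q) w (f.coeff w) ≠ ∞ := by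
  intro h
  have h1 := (ENNReal.le_tsum w).trans_lt hf
  rw [h, ENNReal.top_mul (by positivity)] at h1
  exact lt_irrefl _ h1

lemma convNorm_mul_le (q : ℂˣ) {l l' r : ℝ≥0} (hr : 0 < r) (h1 : l ≤ l')
    (h2 : l * ‖(q : ℂ)‖₊ ≤ l') (h3 : l * ‖((q⁻¹ : ℂˣ) : ℂ)‖₊ ≤ l')
    {f g : TwistedSeries (dilation q)} (hf : convNorm q l' r f < ∞) (hg : convNorm q l' r g < ∞) :
    convNorm q l r (f * g) ≤ convNorm q l' r f * convNorm q l' r g := by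
  set F : Word → ℝ≥0∞ := fun w => wordNorm (entireNorm l') (dilation q) w (f.coeff w) *
    (r : ℝ≥0∞) ^ w.length with hF
  set G : Word → ℝ≥0∞ := fun w => wordNorm (entireNorm l') (dilation q) w (g.coeff w) *
    (r : ℝ≥0∞) ^ w.length with hG
  have e : convNorm q l' r f * convNorm q l' r g = ∑' p : Word × Word, F p.1 * G p.2 := by
    rw [ENNReal.tsum_prod']
    simp only [ENNReal.tsum_mul_left, ENNReal.tsum_mul_right]
    rfl
  have hinj : Function.Injective (fun x : Σ w : Word, Finset.HasAntidiagonal.antidiagonal w.length =>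
      ((x.1.take x.2.1.1, x.1.drop x.2.1.1) : Word × Word)) := by
    rintro ⟨w, ⟨⟨i, j⟩, h⟩⟩ ⟨w', ⟨⟨i', j'⟩, h'⟩⟩ hh
    rw [Finset.HasAntidiagonal.mem_antidiagonal] at h h'
    simp only [Prod.mk.injEq] at hh
    obtain ⟨a1, a2⟩ := hh
    have hw : w = w' := by
      rw [← List.take_append_drop i w, a1, a2, List.take_append_drop]
    subst hw
    have hl := congrArg List.length a1
    simp only [List.length_take] at hl
    simp only at h h'
    have : i = i' := by omega
    subst this
    have : j = j' := by omega
    subst this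
    rfl
  rw [e]
  refine le_trans ?_ (ENNReal.tsum_comp_le_tsum_of_injective hinj (fun p => F p.1 * G p.2))
  rw [ENNReal.tsum_sigma']
  unfold convNorm
  refine ENNReal.tsum_le_tsum fun w => ?_
  rw [tsum_fintype, Finset.univ_eq_attach, Finset.sum_attach
    (Finset.HasAntidiagonal.antidiagonal w.length)
    fun p : ℕ × ℕ => F (w.take p.1) * G (w.drop p.1), TwistedSeries.coeff_mul]
  have hsum : ∀ (s : Finset (ℕ × ℕ)) (T : ℕ × ℕ → Entire),
      wordNorm (entireNorm l) (dilation q) w (∑ p ∈ s, T p) ≤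
        ∑ p ∈ s, wordNorm (entireNorm l) (dilation q) w (T p) := by
    intro s T
    exact Finset.le_sum_of_subadditive _ (wordNorm_zero (entireNorm_zero l) _ _).le
      (wordNorm_add_le (entireNorm_add_le l) _ _) _ _
  refine (mul_le_mul_left (hsum _ _) _).trans ?_
  rw [Finset.sum_mul]
  refine Finset.sum_le_sum fun p hp => ?_
  have hp' : p.1 + p.2 = w.length := Finset.HasAntidiagonal.mem_antidiagonal.1 hp
  have key := wordNorm_mul_le q h1 h2 h3 (w.take p.1) (w.drop p.1) (f.coeff (w.take p.1))
    (g.coeff (w.drop p.1)) (wordNorm_ne_top_of_convNorm hr hf _)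
    (wordNorm_ne_top_of_convNorm hr hg _)
  rw [List.take_append_drop] at key
  have e2 : (r : ℝ≥0∞) ^ w.length = (r : ℝ≥0∞) ^ (w.take p.1).length *
      (r : ℝ≥0∞) ^ (w.drop p.1).length := by
    rw [← pow_add, ← List.length_append, List.take_append_drop]
  rw [e2]
  refine (mul_le_mul_left key _).trans (le_of_eq ?_)
  simp only [hF, hG]
  ring

/-- The algebra `A{x₁, x₂; β_q}` for `A = 𝓞(ℂ)`: all series `f = ∑_w f_w x^w` with
`‖f‖_{l,r} < ∞` for all `l, r > 0`. -/
def convSubalgebra (q : ℂˣ) : Subalgebra ℂ (TwistedSeries (dilation q)) where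
  carrier := {f | ∀ l r : ℝ≥0, 0 < l → 0 < r → convNorm q l r f < ∞}
  mul_mem' := fun {f g} hf hg l r hl hr => by
    have hl' : 0 < l * (1 + ‖(q : ℂ)‖₊ + ‖((q⁻¹ : ℂˣ) : ℂ)‖₊) := by positivity
    refine (convNorm_mul_le q hr ?_ ?_ ?_ (hf _ r hl' hr) (hg _ r hl' hr)).trans_lt
      (ENNReal.mul_lt_top (hf _ r hl' hr) (hg _ r hl' hr))
    · exact le_mul_of_one_le_right' (by rw [add_assoc]; exact le_self_add)
    · gcongr; exact le_add_right le_add_self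
    · gcongr; exact le_add_self
  add_mem' := fun hf hg l r hl hr =>
    (convNorm_add_le q l r _ _).trans_lt (ENNReal.add_lt_top.2 ⟨hf l r hl hr, hg l r hl hr⟩)
  algebraMap_mem' := fun c l r _ _ => by
    rw [Algebra.algebraMap_eq_smul_one]
    refine (convNorm_smul_le q l r c _).trans_lt (ENNReal.mul_lt_top enorm_lt_top ?_)
    exact (convNorm_mono_le q l r []).trans_lt (by simp)

/-- `A{x₁, x₂; β_q}` as a type of its own. -/
def ConvSeries (q : ℂˣ) : Type := convSubalgebra q

namespace ConvSeries

variable {q : ℂˣ}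

noncomputable instance : Ring (ConvSeries q) := inferInstanceAs (Ring (convSubalgebra q))
noncomputable instance : Algebra ℂ (ConvSeries q) :=
  inferInstanceAs (Algebra ℂ (convSubalgebra q))

/-- The underlying formal series. -/
def toSeries (f : ConvSeries q) : TwistedSeries (dilation q) := f.1

lemma convNorm_lt_top (f : ConvSeries q) {l r : ℝ≥0} (hl : 0 < l) (hr : 0 < r) :
    convNorm q l r f.toSeries < ∞ := f.2 l r hl hr

/-- `‖·‖_{l,r}` as a seminorm. -/
noncomputable def seminorm (q : ℂˣ) (lr : {l : ℝ≥0 // 0 < l} × {r : ℝ≥0 // 0 < r}) :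
    Seminorm ℂ (ConvSeries q) :=
  Seminorm.ofSMulLE (fun f => (convNorm q lr.1 lr.2 f.toSeries).toReal)
    (by
      have : convNorm q lr.1 lr.2 (0 : ConvSeries q).toSeries = 0 := convNorm_zero q _ _
      simp [this])
    (fun f g => by
      have hf := f.convNorm_lt_top lr.1.2 lr.2.2
      have hg := g.convNorm_lt_top lr.1.2 lr.2.2
      rw [← ENNReal.toReal_add hf.ne hg.ne]
      exact ENNReal.toReal_mono (ENNReal.add_lt_top.2 ⟨hf, hg⟩).ne (convNorm_add_le q _ _ _ _))
    (fun c f => by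
      have hf := f.convNorm_lt_top lr.1.2 lr.2.2
      rw [← toReal_enorm c, ← ENNReal.toReal_mul]
      exact ENNReal.toReal_mono (ENNReal.mul_lt_top enorm_lt_top hf).ne
        (convNorm_smul_le q _ _ _ _))

/-- The topology generated by the seminorms `‖·‖_{l,r}`. -/
noncomputable instance : TopologicalSpace (ConvSeries q) :=
  (SeminormFamily.moduleFilterBasis (𝕜 := ℂ) (seminorm q)).topology

/-- The monomial `x^v`. -/
noncomputable def mono (q : ℂˣ) (v : Word) : ConvSeries q :=
  ⟨TwistedSeries.mono (dilation q) v, fun l r _ _ =>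
    (convNorm_mono_le q l r v).trans_lt (ENNReal.pow_lt_top ENNReal.coe_lt_top)⟩

/-- The generator `x₁`. -/
noncomputable def x₁ (q : ℂˣ) : ConvSeries q := mono q [0]

/-- The generator `x₂`. -/
noncomputable def x₂ (q : ℂˣ) : ConvSeries q := mono q [1]

/-- The closure `I` of the two-sided ideal generated by `x₁ x₂ - 1` and `x₂ x₁ - 1`. -/
def closedIdeal (q : ℂˣ) : Set (ConvSeries q) :=
  closure (TwoSidedIdeal.span ({x₁ q * x₂ q - 1, x₂ q * x₁ q - 1} : Set (ConvSeries q)) :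
    Set (ConvSeries q))

/-- `φ_{m,n}(f) = ∑_{c(w) = n} f_w^{(m)}`. -/
noncomputable def φ (m : ℕ) (n : ℤ) (f : ConvSeries q) : ℂ :=
  ∑' w : {w : Word // w.c = n}, taylorCoeff (f.toSeries.coeff w) m

/-- The quotient seminorm `‖f‖^∨_{l,r} = inf {‖f + g‖_{l,r} : g ∈ I}`. -/
noncomputable def quotientNorm (l r : ℝ≥0) (f : ConvSeries q) : ℝ≥0∞ :=
  ⨅ g ∈ closedIdeal q, convNorm q l r (f + g).toSeries

end ConvSeries

/-! ### The space of Laurent series -/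

/-- The weighted `ℓ¹` seminorm `‖a‖'_{l,r}` of a series `∑_{m ≥ 0, n ∈ ℤ} a_n^{(m)} z^m x^n`. -/
noncomputable def laurentNorm (q : ℂˣ) (l r : ℝ≥0) (a : ℕ → ℤ → ℂ) : ℝ≥0∞ :=
  (∑' p : {p : ℕ × ℤ // ‖(q : ℂ)‖₊ ^ p.1 ≤ r}, ‖a p.1.1 p.1.2‖ₑ *
    ((l ^ p.1.1 * ‖(q : ℂ)‖₊ ^ (-(p.1.1 * max (p.1.2 - 1) 0) : ℤ) * r ^ |p.1.2| : ℝ≥0) : ℝ≥0∞)) +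
  (∑' p : {p : ℕ × ℤ // 0 < p.2 ∧ r < ‖(q : ℂ)‖₊ ^ p.1 ∧ ‖(q : ℂ)‖₊ ^ p.1 ≤ r ^ 2},
    ‖a p.1.1 p.1.2‖ₑ *
      ((l ^ p.1.1 * ‖(q : ℂ)‖₊ ^ (-(p.1.1 * (p.1.2 + 1)) : ℤ) * r ^ (p.1.2 + 2) : ℝ≥0) : ℝ≥0∞)) +
  (∑' p : {p : ℕ × ℤ // p.2 ≤ 0 ∧ r < ‖(q : ℂ)‖₊ ^ p.1 ∧ ‖(q : ℂ)‖₊ ^ p.1 ≤ r ^ 2},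
    ‖a p.1.1 p.1.2‖ₑ * ((l ^ p.1.1 * r ^ |p.1.2| : ℝ≥0) : ℝ≥0∞))

lemma laurentNorm_add_le (q : ℂˣ) (l r : ℝ≥0) (a b : ℕ → ℤ → ℂ) :
    laurentNorm q l r (a + b) ≤ laurentNorm q l r a + laurentNorm q l r b := by
  unfold laurentNorm
  rw [add_add_add_comm, add_add_add_comm (∑' _, _)]
  simp only [← ENNReal.tsum_add, ← add_mul]
  gcongr <;> exact enorm_add_le _ _

lemma laurentNorm_smul (q : ℂˣ) (l r : ℝ≥0) (c : ℂ) (a : ℕ → ℤ → ℂ) :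
    laurentNorm q l r (c • a) = ‖c‖ₑ * laurentNorm q l r a := by
  unfold laurentNorm
  simp only [mul_add, ← ENNReal.tsum_mul_left, ← mul_assoc, Pi.smul_apply, smul_eq_mul, enorm_mul]

/-- The space of all series with `‖a‖'_{l,r} < ∞` for all `l, r > 0`. -/
def laurentSubmodule (q : ℂˣ) : Submodule ℂ (ℕ → ℤ → ℂ) where
  carrier := {a | ∀ l r : ℝ≥0, 0 < l → 0 < r → laurentNorm q l r a < ∞}
  add_mem' := fun ha hb l r hl hr =>
    (laurentNorm_add_le q l r _ _).trans_lt (ENNReal.add_lt_top.2 ⟨ha l r hl hr, hb l r hl hr⟩)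
  zero_mem' := fun l r _ _ => by
    have := laurentNorm_smul q l r 0 0
    simp at this
    simp [this]
  smul_mem' := fun c a ha l r hl hr => by
    rw [laurentNorm_smul]
    exact ENNReal.mul_lt_top enorm_lt_top (ha l r hl hr)

/-- The space of Laurent series as a type of its own. -/
def LaurentSpace (q : ℂˣ) : Type := laurentSubmodule q

namespace LaurentSpace

variable {q : ℂˣ}

noncomputable instance : AddCommGroup (LaurentSpace q) :=
  inferInstanceAs (AddCommGroup (laurentSubmodule q))
noncomputable instance : Module ℂ (LaurentSpace q) :=
  inferInstanceAs (Module ℂ (laurentSubmodule q))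

/-- The coefficient `a_n^{(m)}` of `z^m x^n`. -/
def coeff (a : LaurentSpace q) : ℕ → ℤ → ℂ := a.1

lemma laurentNorm_lt_top (a : LaurentSpace q) {l r : ℝ≥0} (hl : 0 < l) (hr : 0 < r) :
    laurentNorm q l r a.coeff < ∞ := a.2 l r hl hr

/-- `‖·‖'_{l,r}` as a seminorm. -/
noncomputable def seminorm (q : ℂˣ) (lr : {l : ℝ≥0 // 0 < l} × {r : ℝ≥0 // 0 < r}) :
    Seminorm ℂ (LaurentSpace q) :=
  Seminorm.of (fun a => (laurentNorm q lr.1 lr.2 a.coeff).toReal)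
    (fun a b => by
      have ha := a.laurentNorm_lt_top lr.1.2 lr.2.2
      have hb := b.laurentNorm_lt_top lr.1.2 lr.2.2
      rw [← ENNReal.toReal_add ha.ne hb.ne]
      exact ENNReal.toReal_mono (ENNReal.add_lt_top.2 ⟨ha, hb⟩).ne
        (laurentNorm_add_le q _ _ _ _))
    (fun c a => by
      have : laurentNorm q lr.1 lr.2 (c • a).coeff = ‖c‖ₑ * laurentNorm q lr.1 lr.2 a.coeff :=
        laurentNorm_smul q _ _ c _
      rw [this, ENNReal.toReal_mul, toReal_enorm])

/-- The topology generated by the seminorms `‖·‖'_{l,r}`. -/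
noncomputable instance : TopologicalSpace (LaurentSpace q) :=
  (SeminormFamily.moduleFilterBasis (𝕜 := ℂ) (seminorm q)).topology

end LaurentSpace

universe u

/-! ### Peaks of words and the seminorms `‖·‖^{(w)}` -/

namespace Word

/-! Let M(w) be the largest value of c on the proper prefixes of w. Since |q| > 1, the seminorm
‖·‖^{(w)}_λ is just ‖·‖ at the radius λ|q|^{-M(w)} (`wordNorm_eq_entireNorm`): one may put all of a
into a slot of greatest height, and submultiplicativity at the smaller radius shows that no other
representation does better. Hence A{x₁,x₂;α} is a weighted ℓ¹ space, in which z^m x^w has weight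
(λ|q|^{-M(w)})^m ρ^{|w|}.

Modulo x₁x₂ = x₂x₁ = 1 the monomial x^w depends only on n = c(w), and identifying basis vectors of
an ℓ¹ space gives ℓ¹ with the infimum of the weights over each class. Computing the infimum is a
question about paths: a word of height M ending at n has at least 2M - n letters, so beyond the
shortest words a unit of height costs two letters, a factor ρ²/|q|^m. This produces the ranges |q|^m
≤ ρ, ρ < |q|^m ≤ ρ² and |q|^m > ρ² (weight 0) in the definition of E (`laurentNorm_eq_tsum`).

One inequality for the quotient seminorm is the triangle inequality on the fibres of c
(`tsum_φ_le`). For the other, a series is truncated and each word replaced by an almost optimal one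
with the same c, a change inside the ideal (`exists_add_mem_convNorm_le`); the same estimate shows
that I is the whole common kernel. Surjectivity needs one choice of words that serves all seminorms
at once (`exists_slow_index`).

An absolutely convergent sum over pairs of words, grouped in two ways, shows that φ turns products
into twisted convolutions (`hasSum_φ_mul`), so E inherits a product. Taking the maximum of c over
all prefixes instead of the proper ones changes λ by at most a factor |q| and makes the seminorms
submultiplicative (`wordWeight_append_le`). For the universal property, θ(z)^m is moved to the
highest point of a word; every submultiplicative seminorm of θ(z)^m μ(1)^n is then bounded, up to a
constant, by the weight of every word ending at n (`LaurentTriple.le_term`). So ∑ a_n^{(m)} θ(z^m)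
μ(1)^n converges absolutely and defines the only possible homomorphism. -/

@[simp] lemma c_nil : Word.c [] = 0 := rfl

@[simp] lemma c_cons (s : Fin 2) (w : Word) : Word.c (s :: w) = letterSign s + Word.c w := by
  simp [Word.c]

lemma letterSign_eq (s : Fin 2) : letterSign s = 1 ∨ letterSign s = -1 := by
  unfold letterSign
  split_ifs <;> simp

lemma abs_c_le (w : Word) : |w.c| ≤ w.length := by
  induction w with
  | nil => simp
  | cons s w ih =>
    rw [c_cons]
    rcases letterSign_eq s with h | h <;> rw [h] <;> rw [abs_le] at * <;>
      simp only [List.length_cons, Nat.cast_add, Nat.cast_one] <;> omega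

lemma c_emod_two (w : Word) : w.c % 2 = (w.length : ℤ) % 2 := by
  induction w with
  | nil => simp
  | cons s w ih =>
    rw [c_cons]
    rcases letterSign_eq s with h | h <;> rw [h] <;>
      simp only [List.length_cons, Nat.cast_add, Nat.cast_one] <;> omega

/-- The maximum of `c` over all prefixes of a word. -/
def peak : Word → ℤ
  | [] => 0
  | s :: w => max 0 (letterSign s + peak w)

@[simp] lemma peak_nil : peak [] = 0 := rfl

lemma peak_nonneg (w : Word) : 0 ≤ peak w := by
  cases w <;> simp [peak]

lemma c_le_peak (w : Word) : w.c ≤ peak w := by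
  induction w with
  | nil => simp
  | cons s w ih => rw [c_cons, peak]; exact le_max_of_le_right (by omega)

/-- The second word starts at height c(v). This rule is behind the submultiplicativity in
`wordWeight_append_le`. -/
lemma peak_append (v w : Word) : peak (v ++ w) = max (peak v) (v.c + peak w) := by
  induction v with
  | nil => simp [peak_nonneg]
  | cons s v ih =>
    rw [List.cons_append, peak, ih, peak, c_cons, ← max_add_add_left, max_assoc, add_assoc]

lemma p_le_peak (w : Word) (i : ℕ) : w.p i ≤ peak w := by
  conv_rhs => rw [← List.take_append_drop i w, peak_append]
  exact le_max_of_le_left (c_le_peak _)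

lemma exists_p_eq_peak (w : Word) : ∃ i ≤ w.length, w.p i = peak w := by
  induction w with
  | nil => exact ⟨0, le_rfl, rfl⟩
  | cons s w ih =>
    obtain ⟨i, hi, h⟩ := ih
    rcases le_total (letterSign s + peak w) 0 with h0 | h0
    · exact ⟨0, by simp, by simp [Word.p, peak, max_eq_left h0]⟩
    · refine ⟨i + 1, by simpa using hi, ?_⟩
      rw [peak, max_eq_right h0, ← h]
      simp [Word.p]

/-- The maximum of `c` over all proper prefixes of a word, and `0` for the empty word. -/
def innerPeak (w : Word) : ℤ := peak w.dropLast

lemma p_dropLast (w : Word) {i : ℕ} (hi : i < w.length) : Word.p w.dropLast i = w.p i := by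
  unfold Word.p
  rw [List.dropLast_eq_take, List.take_take]
  congr 2
  omega

lemma p_le_innerPeak (w : Word) {i : ℕ} (hi : i < w.length) : w.p i ≤ innerPeak w :=
  (p_dropLast w hi).symm.le.trans (p_le_peak _ i)

lemma exists_p_eq_innerPeak {w : Word} (hw : w ≠ []) : ∃ i < w.length, w.p i = innerPeak w := by
  obtain ⟨i, hi, h⟩ := exists_p_eq_peak w.dropLast
  have := List.length_pos_iff.2 hw
  rw [List.length_dropLast] at hi
  exact ⟨i, by omega, by rw [← p_dropLast w (by omega), h]; rfl⟩

lemma innerPeak_nonneg (w : Word) : 0 ≤ innerPeak w := peak_nonneg _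

lemma innerPeak_le_peak (w : Word) : innerPeak w ≤ peak w := by
  rcases eq_or_ne w [] with rfl | hw
  · rfl
  · obtain ⟨i, -, h⟩ := exists_p_eq_innerPeak hw
    rw [← h]; exact p_le_peak _ _

/-- Only the full word is missing from the inner maximum, and the last letter rises by at most one.
The two heights therefore lead to equivalent families of seminorms. -/
lemma peak_le_innerPeak_add_one (w : Word) : peak w ≤ innerPeak w + 1 := by
  rcases eq_or_ne w [] with rfl | hw
  · simp [innerPeak]
  · conv_lhs => rw [← List.dropLast_append_getLast hw, peak_append]
    have h1 := c_le_peak w.dropLast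
    have : peak [w.getLast hw] ≤ 1 := by
      rcases letterSign_eq (w.getLast hw) with h | h <;> simp [peak, h]
    unfold innerPeak
    exact max_le (by omega) (by omega)

lemma innerPeak_le_length (w : Word) : innerPeak w ≤ w.length := by
  rcases eq_or_ne w [] with rfl | hw
  · simp [innerPeak]
  · obtain ⟨i, hi, h⟩ := exists_p_eq_innerPeak hw
    rw [← h]
    refine (le_abs_self _).trans ((abs_c_le _).trans ?_)
    simp

/-- A word reaching height `M` before its last letter has at least `2 M - c(w)` letters. -/
lemma two_mul_innerPeak_le (w : Word) : 2 * innerPeak w ≤ w.length + w.c := by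
  rcases eq_or_ne w [] with rfl | hw
  · simp [innerPeak]
  · obtain ⟨i, hi, h⟩ := exists_p_eq_innerPeak hw
    have h1 := abs_le.1 (abs_c_le (w.take i))
    have h2 := abs_le.1 (abs_c_le (w.drop i))
    have h3 : w.c = w.p i + Word.c (w.drop i) := by
      unfold Word.p; rw [← Word.c_append, List.take_append_drop]
    have h4 : Word.c (w.take i) = w.p i := rfl
    simp only [List.length_take, List.length_drop] at h1 h2
    omega

lemma c_le_innerPeak_add_one (w : Word) : w.c ≤ innerPeak w + 1 :=
  (c_le_peak w).trans (peak_le_innerPeak_add_one w)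

/-- A proper prefix that already stands at height c(w) has at least c(w) letters, so w has one more,
and parity forces a second one. `two_mul_innerPeak_le` alone would give only c(w) letters. -/
lemma length_of_innerPeak_eq_c {w : Word} (hw : w ≠ []) (h : innerPeak w = w.c) :
    w.c + 2 ≤ w.length := by
  obtain ⟨i, hi, h'⟩ := exists_p_eq_innerPeak hw
  have h1 := abs_le.1 (abs_c_le (w.take i))
  have h3 : w.c = w.p i + Word.c (w.drop i) := by
    unfold Word.p; rw [← Word.c_append, List.take_append_drop]
  have h4 : Word.c (w.take i) = w.p i := rfl
  have h5 := c_emod_two w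
  simp only [List.length_take] at h1
  omega

/-- The word consisting of `a` letters `1` followed by `b` letters `2`. -/
def upDown (a b : ℕ) : Word := List.replicate a 0 ++ List.replicate b 1

@[simp] lemma length_upDown (a b : ℕ) : (upDown a b).length = a + b := by simp [upDown]

@[simp] lemma c_upDown (a b : ℕ) : (upDown a b).c = a - b := by
  simp [upDown, Word.c, letterSign, sub_eq_add_neg]

lemma peak_upDown (a b : ℕ) : peak (upDown a b) = a := by
  have h1 : ∀ a : ℕ, peak (List.replicate a (0 : Fin 2)) = a := by
    intro a
    induction a with
    | zero => rfl
    | succ a ih =>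
      rw [List.replicate_succ, peak, ih]
      simp only [letterSign, if_true]
      push_cast
      omega
  have h2 : ∀ b : ℕ, peak (List.replicate b (1 : Fin 2)) = 0 := by
    intro b
    induction b with
    | zero => rfl
    | succ b ih => rw [List.replicate_succ, peak, ih]; simp [letterSign]
  rw [upDown, peak_append, h1, h2]
  simp [Word.c, letterSign]

/-- A trailing letter `2` turns the top into a proper prefix. Without one, as in the next lemma, the
top is the full word and the inner height is one lower. -/
lemma innerPeak_upDown_succ (a b : ℕ) : innerPeak (upDown a (b + 1)) = a := by
  rw [innerPeak, ← peak_upDown a b]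
  congr 1
  rw [upDown, upDown, List.dropLast_append_of_ne_nil (by simp)]
  simp [List.dropLast_replicate]

lemma innerPeak_upDown_zero (a : ℕ) : innerPeak (upDown (a + 1) 0) = a := by
  rw [innerPeak, ← peak_upDown a 0]
  congr 1
  simp [upDown, List.dropLast_replicate]

end Word

/-! ### Dilations and the seminorms of words on entire functions -/

lemma taylorCoeff_dilation_zpow (q : ℂˣ) (k : ℤ) (f : Entire) (m : ℕ) :
    taylorCoeff ((dilation q ^ k) f) m = (q : ℂ) ^ (k * m) * taylorCoeff f m := by
  have hq : (q : ℂ) ^ m ≠ 0 := pow_ne_zero _ q.ne_zero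
  induction k generalizing f with
  | zero => simp
  | succ k ih =>
    rw [zpow_add_one, AlgEquiv.mul_apply, ih, taylorCoeff_dilation, add_mul, one_mul,
      zpow_add₀ q.ne_zero, zpow_natCast, mul_assoc]
  | pred k ih =>
    have h := ih f
    have h1 : (dilation q ^ (-(k : ℤ))) f =
        dilation q ((dilation q ^ (-(k : ℤ) - 1)) f) := by
      rw [← AlgEquiv.mul_apply, ← zpow_one_add]; congr 2; ring
    rw [h1, taylorCoeff_dilation] at h
    apply mul_left_cancel₀ hq
    rw [h, sub_mul, one_mul, zpow_sub₀ q.ne_zero, zpow_natCast]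
    field_simp

lemma entireNorm_dilation_zpow (q : ℂˣ) (l : ℝ≥0) (k : ℤ) (f : Entire) :
    entireNorm l ((dilation q ^ k) f) = entireNorm (l * ‖(q : ℂ)‖₊ ^ k) f := by
  unfold entireNorm
  refine tsum_congr fun m => ?_
  rw [taylorCoeff_dilation_zpow, enorm_mul, ENNReal.coe_mul, mul_pow, ← ENNReal.coe_pow,
    ← ENNReal.coe_pow, ← zpow_natCast (_ ^ k), ← zpow_mul, ← nnnorm_zpow, ← enorm_eq_nnnorm]
  ring

/-- A dilation by q^k multiplies the radius by |q|^k. Starting from l|q|^{-M}, no factor is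
evaluated beyond radius l, because its height is at most M. -/
lemma entireNorm_wordProd_le {q : ℂˣ} (hq : 1 ≤ ‖(q : ℂ)‖₊) (l : ℝ≥0) (M : ℤ) (w : Word)
    (x : List Entire) (h : ∀ i < x.length, w.p i ≤ M) :
    entireNorm (l * ‖(q : ℂ)‖₊ ^ (-M)) (wordProd (dilation q) w x) ≤
      (x.map (entireNorm l)).prod := by
  have hprod : ∀ y : List Entire, entireNorm (l * ‖(q : ℂ)‖₊ ^ (-M)) y.prod ≤
      (y.map (entireNorm (l * ‖(q : ℂ)‖₊ ^ (-M)))).prod := by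
    intro y
    induction y with
    | nil => simp [entireNorm_one]
    | cons a y ih =>
      simp only [List.prod_cons, List.map_cons]
      exact (entireNorm_mul_le _ _ _).trans (by gcongr)
  refine (hprod _).trans ?_
  refine List.Forall₂.prod_le_prod' (List.forall₂_iff_get.2 ⟨by simp, fun i h1 h2 => ?_⟩)
  simp only [List.length_map, List.length_mapIdx] at h1 h2
  simp only [List.get_eq_getElem, List.getElem_map, List.getElem_mapIdx]
  rw [entireNorm_dilation_zpow]
  refine entireNorm_mono ?_ _
  rw [mul_assoc, ← zpow_add₀ (by positivity)]
  exact mul_le_of_le_one_right' (zpow_le_one_of_nonpos₀ hq (by have := h i h2; omega))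

lemma wordProd_set_one (α : Entire ≃ₐ[ℂ] Entire) (w : Word) (n i : ℕ) (hi : i < n) (a : Entire) :
    wordProd α w ((List.replicate n 1).set i a) = (α ^ w.p i) a := by
  unfold wordProd
  have : ((List.replicate n 1).set i a).mapIdx (fun i a => (α ^ Word.p w i) a) =
      (List.replicate n 1).set i ((α ^ w.p i) a) := by
    apply List.ext_getElem (by simp)
    intro j h1 h2
    rw [List.getElem_mapIdx, List.getElem_set, List.getElem_set]
    split_ifs with h
    · rw [h]
    · simp
  rw [this]
  induction n generalizing i with
  | zero => omega
  | succ n ih =>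
    cases i with
    | zero => simp [List.replicate_succ]
    | succ i =>
      have := List.prod_set (List.replicate (n + 1) (1 : Entire)) (i + 1) ((α ^ w.p (i + 1)) a)
      rw [this]
      simp [hi]

/-- For the dilation with `|q| ≥ 1`, the seminorm attached to a word is the seminorm of a smaller
radius. -/
lemma wordNorm_eq_entireNorm {q : ℂˣ} (hq : 1 ≤ ‖(q : ℂ)‖₊) (l : ℝ≥0) (w : Word) (a : Entire) :
    wordNorm (entireNorm l) (dilation q) w a =
      entireNorm (l * ‖(q : ℂ)‖₊ ^ (-w.innerPeak)) a := by
  rcases eq_or_ne w [] with rfl | hw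
  · simp [wordNorm_nil, Word.innerPeak]
  apply le_antisymm
  -- Upper bound: a single product with α^{-p_i}(a) in a slot i of greatest height and 1 in all
  -- other slots.
  · obtain ⟨i, hi, h⟩ := Word.exists_p_eq_innerPeak hw
    have key := wordNorm_le (entireNorm l) (dilation q) hw
      [(List.replicate w.length 1).set i ((dilation q ^ (-w.p i)) a)] (by simp)
    simp only [List.map_cons, List.map_nil, List.sum_cons, List.sum_nil, add_zero] at key
    rw [wordProd_set_one _ _ _ _ hi, ← AlgEquiv.mul_apply, ← zpow_add, add_neg_cancel, zpow_zero,
      AlgEquiv.one_apply] at key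
    refine key.trans ?_
    rw [← h, ← entireNorm_dilation_zpow, List.map_set, List.map_replicate, entireNorm_one,
      List.prod_set]
    simp [hi]
  -- Lower bound: each product of a representation is estimated at the reduced radius, where every
  -- slot is below the maximal height.
  · conv_rhs => rw [wordNorm, if_neg hw]
    refine le_iInf fun ⟨r, h1, h2⟩ => ?_
    simp only
    rw [← h2]
    clear h2
    induction r with
    | nil => simp [entireNorm_zero]
    | cons x r ih =>
      simp only [List.map_cons, List.sum_cons]
      refine (entireNorm_add_le _ _ _).trans (add_le_add ?_ (ih fun y hy => h1 y (by simp [hy])))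
      exact entireNorm_wordProd_le hq l _ w x fun i hi =>
        Word.p_le_innerPeak _ ((h1 x (by simp)) ▸ hi)

/-! ### Weights -/

/-- The weight `l^m |q|^{-m h(w)} r^{|w|}` of `z^m x^w`, for a height function `h`. -/
noncomputable def wordWeight (q : ℂˣ) (h : Word → ℤ) (l r : ℝ≥0) (m : ℕ) (w : Word) : ℝ≥0 :=
  (l * ‖(q : ℂ)‖₊ ^ (-h w)) ^ m * r ^ w.length

/-- The infimum of the weights of `z^m x^w` over all `w` with `c(w) = n`. -/
noncomputable def minWeight (q : ℂˣ) (h : Word → ℤ) (l r : ℝ≥0) (m : ℕ) (n : ℤ) : ℝ≥0∞ :=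
  ⨅ w : {w : Word // w.c = n}, (wordWeight q h l r m w : ℝ≥0∞)

lemma convNorm_eq {q : ℂˣ} (hq : 1 ≤ ‖(q : ℂ)‖₊) (l r : ℝ≥0) (f : TwistedSeries (dilation q)) :
    convNorm q l r f =
      ∑' w : Word, ∑' m : ℕ, ‖taylorCoeff (f.coeff w) m‖ₑ *
        (wordWeight q Word.innerPeak l r m w : ℝ≥0∞) := by
  unfold convNorm
  refine tsum_congr fun w => ?_
  rw [wordNorm_eq_entireNorm hq, entireNorm, ← ENNReal.tsum_mul_right]
  refine tsum_congr fun m => ?_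
  rw [wordWeight, ENNReal.coe_mul (_ ^ m), ENNReal.coe_pow, ENNReal.coe_pow, mul_assoc]

lemma wordWeight_mono (q : ℂˣ) (h : Word → ℤ) {l l' r r' : ℝ≥0} (hl : l ≤ l') (hr : r ≤ r')
    (m : ℕ) (w : Word) : wordWeight q h l r m w ≤ wordWeight q h l' r' m w := by
  unfold wordWeight
  gcongr

lemma minWeight_le (q : ℂˣ) (h : Word → ℤ) (l r : ℝ≥0) (m : ℕ) (w : Word) :
    minWeight q h l r m w.c ≤ wordWeight q h l r m w :=
  iInf_le (fun v : {v : Word // v.c = w.c} => (wordWeight q h l r m v : ℝ≥0∞)) ⟨w, rfl⟩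

lemma exists_c_eq (n : ℤ) : ∃ w : Word, w.c = n :=
  ⟨Word.upDown n.toNat (-n).toNat, by rw [Word.c_upDown]; omega⟩

instance (n : ℤ) : Nonempty {w : Word // w.c = n} := nonempty_subtype.2 (exists_c_eq n)

lemma minWeight_ne_top (q : ℂˣ) (h : Word → ℤ) (l r : ℝ≥0) (m : ℕ) (n : ℤ) :
    minWeight q h l r m n ≠ ∞ := by
  obtain ⟨w, rfl⟩ := exists_c_eq n
  exact ne_top_of_le_ne_top ENNReal.coe_ne_top (minWeight_le q h l r m w)

/-! ### Evaluation of the minimal weights -/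

lemma wordWeight_eq (q : ℂˣ) (h : Word → ℤ) (l r : ℝ≥0) (m : ℕ) (w : Word) :
    wordWeight q h l r m w = l ^ m * (‖(q : ℂ)‖₊ ^ m) ^ (-h w) * r ^ (w.length : ℤ) := by
  rw [wordWeight, mul_pow, zpow_natCast, ← zpow_natCast (_ ^ (-h w)), ← zpow_natCast ‖(q : ℂ)‖₊,
    zpow_comm]

section

variable {x r : ℝ≥0}

/-- Comparison of two weights by their quotient: with x = |q|^m, the pair K, N is the height and
length of a candidate word and M, L those of a competitor. -/
lemma zpow_neg_mul_zpow_le (hx : 0 < x) (hr : 0 < r) {K N M L : ℤ}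
    (h : x ^ (M - K) ≤ r ^ (L - N)) : x ^ (-K) * r ^ N ≤ x ^ (-M) * r ^ L := by
  have e1 : x ^ (-K) = x ^ (-M) * x ^ (M - K) := by rw [← zpow_add₀ hx.ne']; congr 1; ring
  have e2 : r ^ L = r ^ N * r ^ (L - N) := by rw [← zpow_add₀ hr.ne']; congr 1; ring
  rw [e1, e2, mul_assoc, mul_comm (r ^ N)]
  gcongr

lemma zpow_le_zpow_of_sq_le (hx : 1 ≤ x) (h : x ≤ r ^ 2) {d e : ℤ} (hd : 0 ≤ d)
    (he : 2 * d ≤ e) : x ^ d ≤ r ^ e := by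
  have hr : 1 ≤ r := by
    by_contra! hr
    exact (hx.trans h).not_gt (pow_lt_one₀ (zero_le) hr two_ne_zero)
  lift d to ℕ using hd
  calc x ^ (d : ℤ) ≤ (r ^ 2) ^ (d : ℤ) := by simp only [zpow_natCast]; gcongr
    _ = r ^ (2 * d : ℤ) := by rw [zpow_mul]; norm_cast
    _ ≤ r ^ e := zpow_le_zpow_right₀ hr he

lemma zpow_le_zpow_of_le (hx : 1 ≤ x) (h : x ≤ r) {d e : ℤ} (hd : 0 ≤ d)
    (he : d ≤ e) : x ^ d ≤ r ^ e := by
  lift d to ℕ using hd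
  calc x ^ (d : ℤ) ≤ r ^ (d : ℤ) := by simp only [zpow_natCast]; gcongr
    _ ≤ r ^ e := zpow_le_zpow_right₀ (hx.trans h) he

/-- Nonpositive exponents reverse the comparison of the bases. This is for competitors lower than
the candidate word. -/
lemma zpow_le_zpow_of_nonpos (hr : 1 ≤ r) (h : r ≤ x) {d e : ℤ} (hd : d ≤ 0)
    (he : d ≤ e) : x ^ d ≤ r ^ e := by
  obtain ⟨k, rfl⟩ : ∃ k : ℕ, d = -k := ⟨d.natAbs, by omega⟩
  calc x ^ (-k : ℤ) ≤ r ^ (-k : ℤ) := by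
        rw [zpow_neg, zpow_neg, zpow_natCast, zpow_natCast]
        have : 0 < r := one_pos.trans_le hr
        gcongr
    _ ≤ r ^ e := zpow_le_zpow_right₀ hr he

end

section

variable {q : ℂˣ} (hq : 1 ≤ ‖(q : ℂ)‖₊) (l : ℝ≥0) {r : ℝ≥0} (hr : 0 < r) {m : ℕ} {n : ℤ}
include hq hr

/-- A word realises the infimum as soon as it beats all competitors with the same c; `h` is this
comparison in the form required by `zpow_neg_mul_zpow_le`. -/
lemma minWeight_innerPeak_eq {K N : ℤ} (w : Word) (hw : w.c = n) (hK : w.innerPeak = K)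
    (hN : (w.length : ℤ) = N)
    (h : ∀ v : Word, v.c = n →
      (‖(q : ℂ)‖₊ ^ m) ^ (v.innerPeak - K) ≤ r ^ ((v.length : ℤ) - N)) :
    minWeight q Word.innerPeak l r m n =
      ((l ^ m * ‖(q : ℂ)‖₊ ^ (-(m * K) : ℤ) * r ^ N : ℝ≥0) : ℝ≥0∞) := by
  have e : ‖(q : ℂ)‖₊ ^ (-(m * K) : ℤ) = (‖(q : ℂ)‖₊ ^ m) ^ (-K) := by
    rw [← zpow_natCast, ← zpow_mul]; congr 1; ring
  rw [e]
  apply le_antisymm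
  · subst hw
    refine (minWeight_le q _ l r m w).trans ?_
    rw [wordWeight_eq, hK, hN]
  · refine le_iInf fun ⟨v, hv⟩ => ENNReal.coe_le_coe.2 ?_
    rw [wordWeight_eq, mul_assoc, mul_assoc]
    gcongr 1
    exact zpow_neg_mul_zpow_le (pow_pos (one_pos.trans_le hq) m) hr (h v hv)

/-- Here height is never worth its letters: compared with the shortest word, 1^n or 2^{|n|}, a
competitor gains no more height than it spends letters. For n > 0 the height is n - 1 because the
last letter of 1^n does not count. -/
lemma minWeight_innerPeak_of_pow_le (h : ‖(q : ℂ)‖₊ ^ m ≤ r) :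
    minWeight q Word.innerPeak l r m n =
      ((l ^ m * ‖(q : ℂ)‖₊ ^ (-(m * max (n - 1) 0) : ℤ) * r ^ |n| : ℝ≥0) : ℝ≥0∞) := by
  have hv : ∀ v : Word, v.c = n →
      (‖(q : ℂ)‖₊ ^ m) ^ (v.innerPeak - max (n - 1) 0) ≤ r ^ ((v.length : ℤ) - |n|) := by
    intro v hv
    have h1 := v.c_le_innerPeak_add_one
    have h2 := v.innerPeak_nonneg
    have h3 := v.two_mul_innerPeak_le
    have h4 := v.abs_c_le
    rw [hv] at h1 h3 h4
    have h6 := abs_cases n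
    refine zpow_le_zpow_of_le (one_le_pow₀ hq) h (by omega) ?_
    rcases eq_or_ne v [] with rfl | hne
    · rw [← hv]; simp [Word.innerPeak]
    -- Needed for n > 0 and a competitor of height exactly n: one unit higher than 1^n, it must be
    -- longer.
    · have h5 := Word.length_of_innerPeak_eq_c hne
      rw [hv] at h5
      omega
  have hn' := abs_cases n
  rcases le_or_gt n 0 with hn | hn
  · refine minWeight_innerPeak_eq hq l hr (Word.upDown 0 (-n).toNat) (by simp; omega) ?_
      (by simp; omega) hv
    rcases hk : (-n).toNat with _ | k
    · simp [Word.innerPeak, Word.upDown]; omega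
    · rw [Word.innerPeak_upDown_succ]; omega
  · refine minWeight_innerPeak_eq hq l hr (Word.upDown ((n - 1).toNat + 1) 0) (by simp; omega) ?_
      (by simp; omega) hv
    rw [Word.innerPeak_upDown_zero]; omega

/-- Passing from 1^n to 1^{n+1}2 costs two letters but gains two units of height, since the last
letter 1 becomes interior: a factor r²/|q|^{2m} < 1. Each further unit costs two letters, a factor
r²/|q|^m ≥ 1, so 1^{n+1}2 is optimal. -/
lemma minWeight_innerPeak_of_pos (h1 : r < ‖(q : ℂ)‖₊ ^ m) (h2 : ‖(q : ℂ)‖₊ ^ m ≤ r ^ 2)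
    (hn : 0 < n) :
    minWeight q Word.innerPeak l r m n =
      ((l ^ m * ‖(q : ℂ)‖₊ ^ (-(m * (n + 1)) : ℤ) * r ^ (n + 2) : ℝ≥0) : ℝ≥0∞) := by
  refine minWeight_innerPeak_eq hq l hr (Word.upDown (n + 1).toNat (0 + 1)) (by simp; omega)
    (by rw [Word.innerPeak_upDown_succ]; omega) (by simp; omega) fun v hv => ?_
  have hne : v ≠ [] := by rintro rfl; simp at hv; omega
  have hr1 : 1 ≤ r := by
    by_contra! hr
    exact ((one_le_pow₀ hq).trans h2).not_gt (pow_lt_one₀ (zero_le) hr two_ne_zero)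
  have a1 := v.c_le_innerPeak_add_one
  have a3 := v.two_mul_innerPeak_le
  have a4 := v.abs_c_le
  have a5 := Word.length_of_innerPeak_eq_c hne
  rw [hv] at a1 a3 a4 a5
  have a6 := abs_cases n
  -- Competitors at least as high pay two letters per unit; lower ones have height n or n - 1 and
  -- save no more letters than height.
  rcases le_or_gt 0 (v.innerPeak - (n + 1)) with hd | hd
  · exact zpow_le_zpow_of_sq_le (one_le_pow₀ hq) h2 hd (by omega)
  · exact zpow_le_zpow_of_nonpos hr1 h1.le hd.le (by omega)

/-- The word 2^{|n|} has height 0, and each unit of height above it costs two letters, a factor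
r²/|q|^m ≥ 1. -/
lemma minWeight_innerPeak_of_nonpos (h2 : ‖(q : ℂ)‖₊ ^ m ≤ r ^ 2) (hn : n ≤ 0) :
    minWeight q Word.innerPeak l r m n = ((l ^ m * r ^ |n| : ℝ≥0) : ℝ≥0∞) := by
  have hn' := abs_cases n
  have := minWeight_innerPeak_eq hq l hr (m := m) (n := n) (K := 0) (N := |n|)
    (Word.upDown 0 (-n).toNat) (by simp; omega) ?_ (by simp; omega) fun v hv => ?_
  · simpa using this
  · rcases hk : (-n).toNat with _ | k
    · simp [Word.innerPeak, Word.upDown]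
    · rw [Word.innerPeak_upDown_succ]; rfl
  · have a2 := v.innerPeak_nonneg
    have a3 := v.two_mul_innerPeak_le
    rw [hv] at a3
    exact zpow_le_zpow_of_sq_le (one_le_pow₀ hq) h2 (by omega) (by omega)

/-- The words 1^a 2^{a-n} with a > n have height a and length 2a - n, so their weights form a
geometric progression of ratio r²/|q|^m < 1. -/
lemma minWeight_innerPeak_of_sq_lt (h : r ^ 2 < ‖(q : ℂ)‖₊ ^ m) :
    minWeight q Word.innerPeak l r m n = 0 := by
  set x := ‖(q : ℂ)‖₊ ^ m with hx
  have hx0 : 0 < x := pow_pos (one_pos.trans_le hq) m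
  have hlim : Filter.Tendsto (fun a : ℕ => l ^ m * r ^ (-n) * (r ^ 2 / x) ^ a) Filter.atTop
      (𝓝 (l ^ m * r ^ (-n) * 0)) :=
    (tendsto_pow_atTop_nhds_zero_of_lt_one (zero_le) ((div_lt_one hx0).2 h)).const_mul _
  rw [mul_zero] at hlim
  have hlim' := ENNReal.tendsto_coe.2 hlim
  rw [ENNReal.coe_zero] at hlim'
  refine le_antisymm (ge_of_tendsto hlim' ?_) zero_le
  filter_upwards [Filter.eventually_ge_atTop (n.natAbs + 1)] with a ha
  -- At least one letter `2` is kept, so that the top of the word is a proper prefix.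
  obtain ⟨b, hb⟩ : ∃ b : ℕ, (b : ℤ) + 1 = a - n := ⟨(a - n - 1).toNat, by omega⟩
  have hc : (Word.upDown a (b + 1)).c = n := by simp; omega
  have hle := minWeight_le q Word.innerPeak l r m (Word.upDown a (b + 1))
  rw [hc] at hle
  refine hle.trans (ENNReal.coe_le_coe.2 (le_of_eq ?_))
  rw [wordWeight_eq, Word.innerPeak_upDown_succ, ← hx, Word.length_upDown, mul_assoc, mul_assoc]
  congr 1
  have : ((a + (b + 1) : ℕ) : ℤ) = 2 * a + (-n) := by push_cast; omega
  rw [this, zpow_add₀ hr.ne', zpow_mul, div_pow, zpow_neg, zpow_natCast, zpow_natCast]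
  norm_cast
  field_simp

/-- The norm `‖·‖'_{l,r}` is the weighted `ℓ¹` norm with the minimal weights. -/
lemma laurentNorm_eq_tsum (a : ℕ → ℤ → ℂ) :
    laurentNorm q l r a =
      ∑' p : ℕ × ℤ, ‖a p.1 p.2‖ₑ * minWeight q Word.innerPeak l r p.1 p.2 := by
  have key : ∀ (s : Set (ℕ × ℤ)) (F : ℕ × ℤ → ℝ≥0∞),
      (∀ p ∈ s, F p = minWeight q Word.innerPeak l r p.1 p.2) →
      ∑' p : s, ‖a p.1.1 p.1.2‖ₑ * F p.1 = ∑' p : ℕ × ℤ,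
        s.indicator (fun p => ‖a p.1 p.2‖ₑ * minWeight q Word.innerPeak l r p.1 p.2) p := by
    intro s F h
    rw [← tsum_subtype]
    exact tsum_congr fun p => by rw [h p.1 p.2]
  unfold laurentNorm
  have e1 := key {p | ‖(q : ℂ)‖₊ ^ p.1 ≤ r} (fun p =>
    ((l ^ p.1 * ‖(q : ℂ)‖₊ ^ (-(p.1 * max (p.2 - 1) 0) : ℤ) * r ^ |p.2| : ℝ≥0) : ℝ≥0∞))
    fun p hp => (minWeight_innerPeak_of_pow_le hq l hr hp).symm
  have e2 := key {p | 0 < p.2 ∧ r < ‖(q : ℂ)‖₊ ^ p.1 ∧ ‖(q : ℂ)‖₊ ^ p.1 ≤ r ^ 2} (fun p =>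
    ((l ^ p.1 * ‖(q : ℂ)‖₊ ^ (-(p.1 * (p.2 + 1)) : ℤ) * r ^ (p.2 + 2) : ℝ≥0) : ℝ≥0∞))
    fun p hp => (minWeight_innerPeak_of_pos hq l hr hp.2.1 hp.2.2 hp.1).symm
  have e3 := key {p | p.2 ≤ 0 ∧ r < ‖(q : ℂ)‖₊ ^ p.1 ∧ ‖(q : ℂ)‖₊ ^ p.1 ≤ r ^ 2} (fun p =>
    ((l ^ p.1 * r ^ |p.2| : ℝ≥0) : ℝ≥0∞))
    fun p hp => (minWeight_innerPeak_of_nonpos hq l hr hp.2.2 hp.1).symm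
  refine (congrArg₂ _ (congrArg₂ _ e1 e2) e3).trans ?_
  rw [← ENNReal.tsum_add, ← ENNReal.tsum_add]
  refine tsum_congr fun p => ?_
  simp only [Set.indicator, Set.mem_ofPred_eq]
  by_cases h1 : ‖(q : ℂ)‖₊ ^ p.1 ≤ r
  · simp [h1, h1.not_gt]
  · by_cases h2 : ‖(q : ℂ)‖₊ ^ p.1 ≤ r ^ 2
    · by_cases h3 : 0 < p.2
      · simp [h1, h2, h3, h3.not_ge, not_le.1 h1]
      · simp [h1, h2, h3, not_le.1 h1, not_lt.1 h3]
    -- Indices outside the three ranges have weight 0 and contribute nothing.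
    · simp [h1, h2, minWeight_innerPeak_of_sq_lt hq l hr (not_le.1 h2)]

end

/-! ### The functionals `φ_{m,n}` -/

lemma WithSeminorms.continuous_of_le {E F ι κ : Type*} [AddCommGroup E] [Module ℂ E]
    [TopologicalSpace E] [AddCommGroup F] [Module ℂ F] [TopologicalSpace F]
    {p : SeminormFamily ℂ E ι} {p' : SeminormFamily ℂ F κ} (hp : WithSeminorms p)
    (hp' : WithSeminorms p') (f : E →ₗ[ℂ] F)
    (h : ∀ j, ∃ (i : ι) (C : ℝ), ∀ x, p' j (f x) ≤ C * p i x) : Continuous f := by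
  have := hp.topologicalAddGroup
  refine continuous_iff_continuousAt.2 fun x₀ => (hp'.tendsto_nhds _ _).2 fun j ε hε => ?_
  obtain ⟨i, C, hC⟩ := h j
  have hc : Continuous fun x => C * p i (x - x₀) :=
    continuous_const.mul ((hp.continuous_seminorm i).comp (continuous_id.sub continuous_const))
  filter_upwards [hc.continuousAt.eventually_lt_const 
    (show C * p i (x₀ - x₀) < ε by simpa using hε)] with x hx
  rw [← map_sub]
  exact (hC _).trans_lt hx

namespace ConvSeries

variable {q : ℂˣ}

/-- The coefficient of `z^m x^w`. -/
noncomputable def tc (f : ConvSeries q) (w : Word) (m : ℕ) : ℂ := taylorCoeff (f.toSeries.coeff w) m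

lemma tc_add (f g : ConvSeries q) (w : Word) (m : ℕ) : (f + g).tc w m = f.tc w m + g.tc w m :=
  taylorCoeff_add _ _ _

lemma tc_smul (c : ℂ) (f : ConvSeries q) (w : Word) (m : ℕ) : (c • f).tc w m = c * f.tc w m :=
  taylorCoeff_smul _ _ _

/-- The weighted `ℓ¹` norm on `A{x₁, x₂; β_q}` with the weights given by a height function. -/
noncomputable def wNorm (h : Word → ℤ) (l r : ℝ≥0) (f : ConvSeries q) : ℝ≥0∞ :=
  ∑' w : Word, ∑' m : ℕ, ‖f.tc w m‖ₑ * (wordWeight q h l r m w : ℝ≥0∞)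

lemma withSeminorms (q : ℂˣ) : WithSeminorms (seminorm q) := ⟨rfl⟩

lemma seminorm_apply (lr : {l : ℝ≥0 // 0 < l} × {r : ℝ≥0 // 0 < r}) (f : ConvSeries q) :
    seminorm q lr f = (convNorm q lr.1 lr.2 f.toSeries).toReal := rfl


variable [hq : Fact (1 < ‖(q : ℂ)‖₊)]

lemma convNorm_eq_wNorm (l r : ℝ≥0) (f : ConvSeries q) :
    convNorm q l r f.toSeries = wNorm Word.innerPeak l r f := convNorm_eq hq.out.le l r _

/-- Height never exceeds length, so at radius R|q|^m the factor |q|^{-mM(w)} is absorbed by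
|q|^{m|w|}. For fixed m the coefficients are thus summable against every geometric weight in |w|. -/
lemma tsum_tc_le (f : ConvSeries q) (m : ℕ) (R : ℝ≥0) :
    ∑' w : Word, ‖f.tc w m‖ₑ * ((R ^ w.length : ℝ≥0) : ℝ≥0∞) ≤
      convNorm q 1 (R * ‖(q : ℂ)‖₊ ^ m) f.toSeries := by
  rw [convNorm_eq_wNorm]
  refine ENNReal.tsum_le_tsum fun w => le_trans ?_ (ENNReal.le_tsum m)
  gcongr
  rw [wordWeight, one_mul, mul_pow, mul_left_comm]
  refine le_mul_of_one_le_right' ?_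
  have h0 : ‖(q : ℂ)‖₊ ≠ 0 := (zero_lt_one.trans hq.out).ne'
  rw [← zpow_natCast, ← zpow_natCast, ← zpow_natCast, ← zpow_mul, ← zpow_mul, ← zpow_add₀ h0]
  refine one_le_zpow₀ hq.out.le ?_
  have := mul_nonneg (Int.natCast_nonneg m) (sub_nonneg.2 w.innerPeak_le_length)
  linarith

lemma tsum_tc_lt_top (f : ConvSeries q) (m : ℕ) (R : ℝ≥0) :
    ∑' w : Word, ‖f.tc w m‖ₑ * ((R ^ w.length : ℝ≥0) : ℝ≥0∞) < ∞ := by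
  have hq0 : 0 < ‖(q : ℂ)‖₊ := zero_lt_one.trans hq.out
  -- R + 1 replaces R because finiteness is given only at positive radii.
  refine lt_of_le_of_lt ?_ ((f.tsum_tc_le m (R + 1)).trans_lt
    (f.convNorm_lt_top one_pos (by positivity)))
  gcongr
  exact le_self_add

/-- Leaves room for the twisting factors q^{c(w)j} of the product, which grow at most geometrically
in |w|. -/
lemma summable_tc_mul (f : ConvSeries q) (m : ℕ) (b : Word → ℂ) (R : ℝ≥0)
    (hb : ∀ w, ‖b w‖₊ ≤ R ^ w.length) : Summable fun w => ‖b w * f.tc w m‖ := by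
  have h : ∑' w : Word, ‖b w * f.tc w m‖ₑ ≠ ∞ := by
    refine ne_top_of_le_ne_top (f.tsum_tc_lt_top m R).ne (ENNReal.tsum_le_tsum fun w => ?_)
    rw [enorm_mul, mul_comm]
    gcongr
    exact ENNReal.coe_le_coe.2 (hb w)
  exact summable_norm_iff.2 (Summable.of_enorm h)

lemma summable_tc (f : ConvSeries q) (m : ℕ) : Summable fun w => f.tc w m := by
  have := f.summable_tc_mul m (fun _ => 1) 1 (by simp)
  simpa using summable_norm_iff.1 this

omit hq in
lemma φ_eq_tsum_ite (m : ℕ) (n : ℤ) (f : ConvSeries q) :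
    φ m n f = ∑' w : Word, if w.c = n then f.tc w m else 0 := by
  have := tsum_subtype {w : Word | w.c = n} fun w => f.tc w m
  refine this.trans (tsum_congr fun w => ?_)
  simp [Set.indicator]

lemma hasSum_φ (m : ℕ) (n : ℤ) (f : ConvSeries q) :
    HasSum (fun w : {w : Word // w.c = n} => f.tc w m) (φ m n f) :=
  ((f.summable_tc m).subtype {w : Word | w.c = n}).hasSum

lemma φ_add (m : ℕ) (n : ℤ) (f g : ConvSeries q) : φ m n (f + g) = φ m n f + φ m n g := by
  refine HasSum.unique (hasSum_φ m n _) ?_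
  simp only [tc_add]
  exact (hasSum_φ m n f).add (hasSum_φ m n g)

lemma φ_smul (m : ℕ) (n : ℤ) (c : ℂ) (f : ConvSeries q) : φ m n (c • f) = c * φ m n f := by
  refine HasSum.unique (hasSum_φ m n _) ?_
  simp only [tc_smul]
  exact (hasSum_φ m n f).mul_left c

omit hq in
-- Triangle inequality on each fibre of c, with every weight bounded below by the infimum over its
-- fibre. This is the lower bound for the quotient seminorm.
lemma tsum_φ_le (h : Word → ℤ) (l r : ℝ≥0) (f : ConvSeries q) :
    ∑' p : ℕ × ℤ, ‖φ p.1 p.2 f‖ₑ * minWeight q h l r p.1 p.2 ≤ wNorm h l r f := by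
  rw [ENNReal.tsum_prod', wNorm, ENNReal.tsum_comm (α := Word)]
  refine ENNReal.tsum_le_tsum fun m => ?_
  rw [← ENNReal.tsum_fiberwise _ Word.c]
  refine ENNReal.tsum_le_tsum fun n => ?_
  refine (mul_le_mul_left enorm_tsum_le_tsum_enorm _).trans ?_
  rw [← ENNReal.tsum_mul_right]
  refine ENNReal.tsum_le_tsum fun w => ?_
  exact mul_le_mul_right (iInf_le _ w) _

lemma enorm_φ_le (m : ℕ) (n : ℤ) (f : ConvSeries q) :
    ‖φ m n f‖ₑ ≤ convNorm q 1 (‖(q : ℂ)‖₊ ^ m) f.toSeries := by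
  have h := f.tsum_tc_le m 1
  simp only [one_pow, ENNReal.coe_one, mul_one, one_mul] at h
  refine enorm_tsum_le_tsum_enorm.trans (le_trans ?_ h)
  exact ENNReal.tsum_comp_le_tsum_of_injective Subtype.val_injective fun w => ‖f.tc w m‖ₑ

variable (q) in
/-- The functional `φ_{m,n}` as a continuous linear map. -/
noncomputable def φL (m : ℕ) (n : ℤ) : ConvSeries q →L[ℂ] ℂ where
  toFun := φ m n
  map_add' := φ_add m n
  map_smul' := φ_smul m n
  cont := by
    refine (withSeminorms q).continuous_of_le (norm_withSeminorms ℂ ℂ)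
      (⟨⟨φ m n, φ_add m n⟩, φ_smul m n⟩ : ConvSeries q →ₗ[ℂ] ℂ) fun _ => ?_
    refine ⟨(⟨1, one_pos⟩, ⟨‖(q : ℂ)‖₊ ^ m, pow_pos (zero_lt_one.trans hq.out) m⟩), 1, fun f => ?_⟩
    rw [one_mul, seminorm_apply]
    have := ENNReal.toReal_mono (f.convNorm_lt_top one_pos
      (pow_pos (zero_lt_one.trans hq.out) m)).ne (enorm_φ_le m n f)
    rwa [toReal_enorm] at this

variable (q) in
/-- The map `f ↦ (φ_{m,n}(f))` to the space of Laurent series. -/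
noncomputable def toLaurent : ConvSeries q →ₗ[ℂ] LaurentSpace q where
  toFun f := ⟨fun m n => φ m n f, fun l r hl hr => by
    rw [laurentNorm_eq_tsum hq.out.le l hr]
    refine (tsum_φ_le _ l r f).trans_lt ?_
    rw [← convNorm_eq_wNorm]
    exact f.convNorm_lt_top hl hr⟩
  map_add' f g := Subtype.ext (funext fun m => funext fun n => φ_add m n f g)
  map_smul' c f := Subtype.ext (funext fun m => funext fun n => φ_smul m n c f)

lemma coeff_toLaurent (f : ConvSeries q) (m : ℕ) (n : ℤ) :
    (toLaurent q f).coeff m n = φ m n f := rfl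

/-! ### Multiplicativity -/

omit hq in
lemma tc_mul (f g : ConvSeries q) (u : Word) (m : ℕ) :
    (f * g).tc u m = ∑ d ∈ Finset.HasAntidiagonal.antidiagonal u.length,
      ∑ ij ∈ Finset.HasAntidiagonal.antidiagonal m,
        (q : ℂ) ^ (Word.c (u.take d.1) * ij.2) * f.tc (u.take d.1) ij.1 * g.tc (u.drop d.1) ij.2 := by
  have e : (f * g).tc u m = taylorCoeff ((f.toSeries * g.toSeries).coeff u) m := rfl
  rw [e, TwistedSeries.coeff_mul]
  have hsum : ∀ (s : Finset (ℕ × ℕ)) (T : ℕ × ℕ → Entire),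
      taylorCoeff (∑ d ∈ s, T d) m = ∑ d ∈ s, taylorCoeff (T d) m := by
    intro s T
    have := map_sum (⟨⟨fun f => taylorCoeff f m, by simpa using taylorCoeff_smul 0 0 m⟩,
      fun a b => taylorCoeff_add a b m⟩ : Entire →+ ℂ) T s
    exact this
  rw [hsum]
  refine Finset.sum_congr rfl fun d _ => ?_
  rw [taylorCoeff_mul]
  refine Finset.sum_congr rfl fun ij _ => ?_
  rw [taylorCoeff_dilation_zpow, mul_left_comm, mul_assoc]
  rfl

omit hq in
-- Two words concatenate to u exactly when they arise from a cut of u. This turns the finite sum in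
-- the definition of the product into a fibre of a sum over all pairs.
lemma tsum_append_fiber (G : Word × Word → ℂ) (u : Word) :
    ∑' b : (fun p : Word × Word => p.1 ++ p.2) ⁻¹' {u}, G b =
      ∑ d ∈ Finset.HasAntidiagonal.antidiagonal u.length, G (u.take d.1, u.drop d.1) := by
  classical
  have hinj : Set.InjOn (fun d : ℕ × ℕ => (u.take d.1, u.drop d.1))
      (Finset.HasAntidiagonal.antidiagonal u.length : Finset (ℕ × ℕ)) := by
    rintro ⟨i, j⟩ h ⟨i', j'⟩ h' hh
    simp only [Finset.mem_coe, Finset.HasAntidiagonal.mem_antidiagonal] at h h'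
    have hl := congrArg (fun p : Word × Word => p.1.length) hh
    simp only [List.length_take] at hl
    ext <;> simp <;> omega
  rw [← Finset.sum_image (f := G) hinj, ← Finset.tsum_subtype']
  have hset : (fun p : Word × Word => p.1 ++ p.2) ⁻¹' {u} =
      ((Finset.HasAntidiagonal.antidiagonal u.length).image
        fun d : ℕ × ℕ => (u.take d.1, u.drop d.1) : Finset (Word × Word)) := by
    ext ⟨v, w⟩
    simp only [Set.mem_preimage, Set.mem_singleton_iff, Finset.coe_image, Set.mem_image,
      Finset.mem_coe, Finset.HasAntidiagonal.mem_antidiagonal, Prod.mk.injEq]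
    constructor
    · rintro rfl
      exact ⟨(v.length, w.length), by simp, by simp, by simp⟩
    · rintro ⟨d, -, rfl, rfl⟩
      exact List.take_append_drop _ _
  rw [hset]

lemma nnnorm_zpow_c_mul_le (w : Word) (j : ℕ) :
    ‖(q : ℂ) ^ (w.c * j)‖₊ ≤ (‖(q : ℂ)‖₊ ^ j) ^ w.length := by
  rw [nnnorm_zpow, ← pow_mul, ← zpow_natCast]
  refine zpow_le_zpow_right₀ hq.out.le ?_
  have := mul_le_mul_of_nonneg_right ((le_abs_self _).trans w.abs_c_le) (Int.natCast_nonneg j)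
  push_cast
  linarith

/-- The contribution of a pair of words to the coefficient of `z^m` in a product. -/
noncomputable def mulTerm (f g : ConvSeries q) (m : ℕ) (p : Word × Word) : ℂ :=
  ∑ ij ∈ Finset.HasAntidiagonal.antidiagonal m,
    ((q : ℂ) ^ (p.1.c * ij.2) * f.tc p.1 ij.1) * g.tc p.2 ij.2

lemma summable_mulTerm (f g : ConvSeries q) (m : ℕ) : Summable (mulTerm f g m) := by
  have hf : ∀ i j : ℕ, Summable fun w : Word => ‖(q : ℂ) ^ (w.c * j) * f.tc w i‖ := fun i j =>
    f.summable_tc_mul i _ _ fun w => nnnorm_zpow_c_mul_le w j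
  have hg : ∀ j : ℕ, Summable fun w : Word => ‖g.tc w j‖ := fun j => (g.summable_tc j).norm
  have h : ∀ ij ∈ Finset.HasAntidiagonal.antidiagonal m, Summable fun p : Word × Word =>
      ((q : ℂ) ^ (p.1.c * ij.2) * f.tc p.1 ij.1) * g.tc p.2 ij.2 := fun ij _ =>
    summable_mul_of_summable_norm (f := fun w : Word => (q : ℂ) ^ (w.c * ij.2) * f.tc w ij.1)
      (g := fun w : Word => g.tc w ij.2) (hf ij.1 ij.2) (hg ij.2)
  exact summable_sum h

/-- The absolutely convergent sum over pairs of words, grouped by their concatenation, recovers the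
coefficients of `f * g`. -/
lemma hasSum_mulTerm (m : ℕ) (n : ℤ) (f g : ConvSeries q) :
    HasSum ({p : Word × Word | p.1.c + p.2.c = n}.indicator (mulTerm f g m)) (φ m n (f * g)) := by
  have hs := ((summable_mulTerm f g m).indicator {p : Word × Word | p.1.c + p.2.c = n}).hasSum
  suffices h : φ m n (f * g) =
      ∑' p, {p : Word × Word | p.1.c + p.2.c = n}.indicator (mulTerm f g m) p by rwa [h]
  rw [← (hs.tsum_fiberwise fun p : Word × Word => p.1 ++ p.2).tsum_eq, φ_eq_tsum_ite]
  refine tsum_congr fun u => ?_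
  rw [tsum_append_fiber, tc_mul]
  have hc : ∀ d : ℕ, Word.c (u.take d) + Word.c (u.drop d) = u.c := fun d => by
    rw [← Word.c_append, List.take_append_drop]
  by_cases hu : u.c = n
  · rw [if_pos hu]
    refine Finset.sum_congr rfl fun d _ => ?_
    rw [Set.indicator_of_mem (by simp [hc, hu])]
    rfl
  · rw [if_neg hu]
    refine (Finset.sum_eq_zero fun d _ => ?_).symm
    rw [Set.indicator_of_notMem (by simp [hc, hu])]

omit hq in
lemma indicator_mulTerm (f g : ConvSeries q) (m : ℕ) (n k : ℤ) (p : Word × Word) :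
    ((fun p : Word × Word => p.1.c) ⁻¹' {k}).indicator
        ({p : Word × Word | p.1.c + p.2.c = n}.indicator (mulTerm f g m)) p =
      ∑ ij ∈ Finset.HasAntidiagonal.antidiagonal m,
        ((q : ℂ) ^ (k * ij.2) * if p.1.c = k then f.tc p.1 ij.1 else 0) *
          (if p.2.c = n - k then g.tc p.2 ij.2 else 0) := by
  by_cases hk : p.1.c = k
  · rw [Set.indicator_of_mem (by simpa using hk)]
    by_cases hn : p.2.c = n - k
    · rw [Set.indicator_of_mem (by simp; omega)]
      simp only [mulTerm, hk, hn, if_true]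
    · rw [Set.indicator_of_notMem (by simp; omega)]
      simp [hn]
  · rw [Set.indicator_of_notMem (by simpa using hk)]
    simp [hk]

/-- The sum of `hasSum_mulTerm`, now grouped by k = c(v) for the first word v: the second word has c
equal to n - k, and each group factors. The result involves f and g only through their φ-values, so
the common kernel is an ideal and the product descends. -/
lemma hasSum_φ_mul (m : ℕ) (n : ℤ) (f g : ConvSeries q) :
    HasSum (fun k : ℤ => ∑ ij ∈ Finset.HasAntidiagonal.antidiagonal m,
      (q : ℂ) ^ (k * ij.2) * φ ij.1 k f * φ ij.2 (n - k) g) (φ m n (f * g)) := by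
  have h := (hasSum_mulTerm m n f g).tsum_fiberwise fun p : Word × Word => p.1.c
  refine (congrArg (fun F : ℤ → ℂ => HasSum F (φ m n (f * g))) (funext fun k => ?_)).mp h
  rw [tsum_subtype, tsum_congr (indicator_mulTerm f g m n k)]
  have s1 : ∀ i j : ℕ, Summable fun w : Word =>
      ‖(q : ℂ) ^ (k * j) * if w.c = k then f.tc w i else 0‖ := fun i j =>
    (((f.summable_tc i).indicator {w : Word | w.c = k}).mul_left ((q : ℂ) ^ (k * j))).norm.congr
      fun w => by simp [Set.indicator]
  have s2 : ∀ j : ℕ, Summable fun w : Word => ‖if w.c = n - k then g.tc w j else 0‖ := fun j =>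
    ((g.summable_tc j).indicator {w : Word | w.c = n - k}).norm.congr
      fun w => by simp [Set.indicator]
  have s3 : ∀ ij ∈ Finset.HasAntidiagonal.antidiagonal m, Summable fun p : Word × Word =>
      ((q : ℂ) ^ (k * ij.2) * if p.1.c = k then f.tc p.1 ij.1 else 0) *
          (if p.2.c = n - k then g.tc p.2 ij.2 else 0) := fun ij _ =>
    summable_mul_of_summable_norm
      (f := fun w : Word => (q : ℂ) ^ (k * ij.2) * if w.c = k then f.tc w ij.1 else 0)
      (g := fun w : Word => if w.c = n - k then g.tc w ij.2 else 0) (s1 ij.1 ij.2) (s2 ij.2)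
  rw [Summable.tsum_finsetSum s3]
  refine Finset.sum_congr rfl fun ij _ => ?_
  rw [φ_eq_tsum_ite, φ_eq_tsum_ite, ← tsum_mul_left (a := (q : ℂ) ^ (k * ij.2))]
  exact (tsum_mul_tsum_of_summable_norm
    (f := fun w : Word => (q : ℂ) ^ (k * ij.2) * if w.c = k then f.tc w ij.1 else 0)
    (g := fun w : Word => if w.c = n - k then g.tc w ij.2 else 0) (s1 ij.1 ij.2) (s2 ij.2)).symm

end ConvSeries

/-! ### Taylor series of entire functions -/

namespace Entire

lemma differentiable (f : Entire) : Differentiable ℂ (fun z => f.1 z) := f.2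

lemma hasSum_taylor (f : Entire) (z : ℂ) :
    HasSum (fun m => taylorCoeff f m * z ^ m) (f.1 z) := by
  have h := Complex.hasSum_taylorSeries_of_entire f.differentiable 0 z
  have e : (fun m => taylorCoeff f m * z ^ m) = fun m : ℕ => (m.factorial : ℂ)⁻¹ • (z - 0) ^ m •
      iteratedDeriv m (fun z => f.1 z) 0 := funext fun m => by
    simp only [taylorCoeff, sub_zero, smul_eq_mul]
    ring
  rw [e]
  exact h

lemma taylorCoeff_eq_of_hasSum {f : Entire} {c : ℕ → ℂ}
    (h : ∀ z, HasSum (fun m => c m * z ^ m) (f.1 z)) (m : ℕ) : taylorCoeff f m = c m := by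
  have h1 : HasFPowerSeriesAt (fun z => f.1 z) (FormalMultilinearSeries.ofScalars ℂ c) 0 :=
    hasFPowerSeriesAt_iff.2 (Filter.Eventually.of_forall fun z => by
      simpa [mul_comm, FormalMultilinearSeries.coeff_ofScalars] using h z)
  have h2 : HasFPowerSeriesAt (fun z => f.1 z)
      (FormalMultilinearSeries.ofScalars ℂ (taylorCoeff f)) 0 :=
    hasFPowerSeriesAt_iff.2 (Filter.Eventually.of_forall fun z => by
      simpa [mul_comm, FormalMultilinearSeries.coeff_ofScalars] using f.hasSum_taylor z)
  have := congrArg (fun p => FormalMultilinearSeries.coeff p m) (h2.eq_formalMultilinearSeries h1)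
  simpa [FormalMultilinearSeries.coeff_ofScalars] using this

lemma summable_norm_of_tsum {c : ℕ → ℂ} {l : ℝ≥0} (h : ∑' m, ‖c m‖ₑ * (l : ℝ≥0∞) ^ m < ∞) :
    Summable fun m => ‖c m‖ * (l : ℝ) ^ m := by
  have : Summable fun m => ‖c m * ((l : ℝ) : ℂ) ^ m‖ := by
    refine summable_norm_iff.2 (Summable.of_enorm ?_)
    refine ne_top_of_le_ne_top h.ne (ENNReal.tsum_le_tsum fun m => ?_)
    rw [enorm_mul, enorm_pow]
    gcongr
    simp [enorm_eq_nnnorm]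
  simpa using this

/-- The entire function with given Taylor coefficients. -/
noncomputable def ofCoeff (c : ℕ → ℂ) (h : ∀ l : ℝ≥0, ∑' m, ‖c m‖ₑ * (l : ℝ≥0∞) ^ m < ∞) :
    Entire :=
  have hd : Differentiable ℂ fun z => ∑' m, c m * z ^ m := fun z => by
    have h1 := Complex.differentiableOn_tsum_of_summable_norm (F := fun m z => c m * z ^ m)
      (U := Metric.ball 0 (‖z‖ + 1)) (summable_norm_of_tsum (h (‖z‖₊ + 1)))
      (fun m => by fun_prop) Metric.isOpen_ball (fun m w hw => by
        rw [norm_mul, norm_pow]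
        have : ‖w‖ ≤ ‖z‖ + 1 := (by simpa using hw : ‖w‖ < ‖z‖ + 1).le
        gcongr
        simpa using this)
    exact h1.differentiableAt (Metric.isOpen_ball.mem_nhds (by simp))
  ⟨⟨fun z => ∑' m, c m * z ^ m, hd.continuous⟩, hd⟩

lemma taylorCoeff_ofCoeff (c : ℕ → ℂ) (h) (m : ℕ) : taylorCoeff (ofCoeff c h) m = c m := by
  refine taylorCoeff_eq_of_hasSum (fun z => ?_) m
  refine Summable.hasSum (summable_norm_iff.1 ?_)
  simpa using summable_norm_of_tsum (h ‖z‖₊)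

/-- The coordinate function. -/
noncomputable def Z : Entire := ⟨⟨fun z => z, continuous_id⟩, differentiable_id⟩

lemma Z_pow_apply (m : ℕ) (z : ℂ) : (Z ^ m).1 z = z ^ m := by
  induction m with
  | zero => rfl
  | succ m ih =>
    rw [pow_succ, pow_succ, ← ih]
    rfl

lemma taylorCoeff_Z_pow (m k : ℕ) : taylorCoeff (Z ^ m) k = if k = m then 1 else 0 := by
  refine taylorCoeff_eq_of_hasSum (c := fun k => if k = m then 1 else 0) (fun z => ?_) k
  rw [Z_pow_apply]
  convert hasSum_ite_eq m (z ^ m) using 2 with k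
  split_ifs with h <;> simp [h]

lemma dilation_Z (q : ℂˣ) : dilation q Z = (q : ℂ) • Z :=
  Subtype.ext (ContinuousMap.ext fun _ => rfl)

/-! ### The compact-open topology and the norms of Taylor coefficients -/

instance : IsTopologicalAddGroup Entire :=
  inferInstanceAs (IsTopologicalAddGroup (Subalgebra.toSubmodule entireSubalgebra))

lemma isInducing_val : Topology.IsInducing (fun f : Entire => f.1) :=
  Topology.IsInducing.subtypeVal

/-- Cauchy's estimates on the circle of radius 2l bound the m-th term by C 2^{-m}; the geometric
series gives the factor 2. Finiteness of the norms and their continuity at 0 follow. -/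
lemma entireNorm_le_of_norm_le (f : Entire) {l : ℝ≥0} (hl : 0 < l) {C : ℝ≥0}
    (h : ∀ z : ℂ, ‖z‖ = 2 * l → ‖f.1 z‖ ≤ C) : entireNorm l f ≤ 2 * C := by
  have hm : ∀ m, ‖taylorCoeff f m‖ₑ * (l : ℝ≥0∞) ^ m ≤ C * 2⁻¹ ^ m := by
    intro m
    have h1 := Complex.norm_iteratedDeriv_le_of_forall_mem_sphere_norm_le (c := 0) (R := 2 * l)
      (C := C) (f := fun z => f.1 z) m (by positivity) f.differentiable.diffContOnCl
      (fun z hz => h z (by simpa using hz))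
    have h2 : ‖taylorCoeff f m‖₊ * l ^ m ≤ C * 2⁻¹ ^ m := by
      rw [← NNReal.coe_le_coe]
      push_cast
      rw [taylorCoeff, norm_div, Complex.norm_natCast]
      have hfac : (0 : ℝ) < m.factorial := by exact_mod_cast m.factorial_pos
      have hl' : (0 : ℝ) < l := hl
      calc _ ≤ (m.factorial * C / (2 * l) ^ m) / m.factorial * (l : ℝ) ^ m := by gcongr
        _ = C * 2⁻¹ ^ m := by rw [inv_pow, mul_pow]; field_simp
    have h3 := ENNReal.coe_le_coe.2 h2
    rw [ENNReal.coe_mul, ENNReal.coe_mul, ENNReal.coe_pow, ENNReal.coe_pow,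
      ENNReal.coe_inv two_ne_zero] at h3
    exact h3
  refine (ENNReal.tsum_le_tsum hm).trans ?_
  rw [ENNReal.tsum_mul_left, ENNReal.tsum_geometric, ENNReal.one_sub_inv_two, inv_inv, mul_comm]

lemma entireNorm_lt_top (l : ℝ≥0) (f : Entire) : entireNorm l f < ∞ := by
  refine (entireNorm_mono (le_self_add : l ≤ l + 1) f).trans_lt ?_
  obtain ⟨C, hC⟩ := (isCompact_sphere (0 : ℂ) (2 * (l + 1 : ℝ≥0))).exists_bound_of_continuousOn
    f.differentiable.continuous.continuousOn
  refine (f.entireNorm_le_of_norm_le (C := C.toNNReal) (by positivity) fun z hz => ?_).trans_lt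
    (ENNReal.mul_lt_top (by simp) ENNReal.coe_lt_top)
  exact (hC z (by simpa using hz)).trans (Real.le_coe_toNNReal C)

lemma eventually_entireNorm_le {l ε : ℝ≥0} (hl : 0 < l) (hε : 0 < ε) :
    ∀ᶠ f : Entire in 𝓝 0, entireNorm l f ≤ ε := by
  have h1 := (ContinuousMap.tendsto_iff_forall_isCompact_tendstoUniformlyOn.1
    (isInducing_val.continuous.tendsto (0 : Entire)) _ (isCompact_closedBall (0 : ℂ) (2 * l)))
  have h2 := Metric.tendstoUniformlyOn_iff.1 h1 (ε / 2 : ℝ≥0) (by positivity)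
  filter_upwards [h2] with f hf
  refine (f.entireNorm_le_of_norm_le hl (C := ε / 2) fun z hz => ?_).trans (le_of_eq ?_)
  · have := hf z (by simp [hz])
    rw [dist_eq_norm] at this
    have e : (0 : Entire).1 z = 0 := rfl
    rw [e, zero_sub, norm_neg] at this
    exact this.le
  · rw [← ENNReal.coe_ofNat, ← ENNReal.coe_mul, mul_div_cancel₀ _ two_ne_zero]

/-- Weierstrass test on a compact set inside the disc of radius R, with majorant the series for the
norm at R. Continuous linear maps on entire functions are thus determined by the powers of z. -/
lemma hasSum_Z_pow (f : Entire) : HasSum (fun m => taylorCoeff f m • Z ^ m) f := by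
  rw [HasSum, isInducing_val.tendsto_nhds_iff,
    ContinuousMap.tendsto_iff_forall_isCompact_tendstoUniformlyOn]
  intro K hK
  obtain ⟨R, hR⟩ := hK.isBounded.exists_norm_le
  have hs := summable_norm_of_tsum (c := taylorCoeff f) (l := R.toNNReal)
    (f.entireNorm_lt_top R.toNNReal)
  have h1 := tendstoUniformlyOn_tsum (f := fun m z => taylorCoeff f m * z ^ m) (s := K) hs
    (fun m z hz => by
      rw [norm_mul, norm_pow]
      gcongr
      exact (hR z hz).trans (Real.le_coe_toNNReal R))
  refine (h1.congr (Filter.Eventually.of_forall fun s z _ => ?_)).congr_right fun z _ =>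
    (f.hasSum_taylor z).tsum_eq
  have e : ∀ s : Finset ℕ, ((∑ m ∈ s, taylorCoeff f m • Z ^ m : Entire)).1 z =
      ∑ m ∈ s, taylorCoeff f m * z ^ m := by
    intro s
    classical
    induction s using Finset.induction_on with
    | empty => rfl
    | insert a s ha ih =>
      rw [Finset.sum_insert ha, Finset.sum_insert ha, ← ih, ← Z_pow_apply]
      rfl
  exact (e s).symm

end Entire

/-! ### Elements of `A{x₁, x₂; β_q}` -/

namespace ConvSeries

variable {q : ℂˣ} [hq : Fact (1 < ‖(q : ℂ)‖₊)]

omit hq in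
lemma ext_coeff {f g : ConvSeries q} (h : ∀ w, f.toSeries.coeff w = g.toSeries.coeff w) : f = g :=
  Subtype.ext (TwistedSeries.ext (funext h))

variable (q) in
/-- The series `a x^w`. -/
noncomputable def single (w : Word) (a : Entire) : ConvSeries q :=
  ⟨⟨fun u => if u = w then a else 0⟩, fun l r _ _ => by
    unfold convNorm
    rw [tsum_eq_single w]
    · simp only [if_true]
      rw [wordNorm_eq_entireNorm hq.out.le]
      exact ENNReal.mul_lt_top (a.entireNorm_lt_top _) (ENNReal.pow_lt_top ENNReal.coe_lt_top)
    · intro u hu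
      simp [hu, wordNorm_zero (entireNorm_zero l)]⟩

lemma coeff_single (w u : Word) (a : Entire) :
    (single q w a).toSeries.coeff u = if u = w then a else 0 := rfl

lemma mono_eq_single (w : Word) : mono q w = single q w 1 := rfl

lemma single_one : single q [] 1 = 1 := rfl

lemma tc_single (w u : Word) (a : Entire) (m : ℕ) :
    (single q w a).tc u m = if u = w then taylorCoeff a m else 0 := by
  unfold tc
  rw [coeff_single]
  split_ifs
  · rfl
  · simpa using taylorCoeff_smul 0 0 m

lemma single_mul_single (v w : Word) (a b : Entire) :
    single q v a * single q w b = single q (v ++ w) (a * (dilation q ^ v.c) b) := by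
  refine ext_coeff fun u => ?_
  have e : (single q v a * single q w b).toSeries.coeff u =
    ((single q v a).toSeries * (single q w b).toSeries).coeff u := rfl
  rw [e, TwistedSeries.coeff_mul, coeff_single]
  simp only [coeff_single]
  split_ifs with hu
  · subst hu
    rw [Finset.sum_eq_single (v.length, w.length)]
    · simp
    · rintro ⟨i, j⟩ hij hne
      simp only [Finset.HasAntidiagonal.mem_antidiagonal, List.length_append] at hij
      have : List.take i (v ++ w) ≠ v := fun h => by
        have := congrArg List.length h
        simp only [List.length_take, List.length_append] at this
        apply hne
        ext <;> simp <;> omega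
      simp [this]
    · intro h
      simp at h
  · refine Finset.sum_eq_zero fun d _ => ?_
    by_cases h1 : List.take d.1 u = v
    · have h2 : List.drop d.1 u ≠ w := fun h2 => hu (by rw [← h1, ← h2, List.take_append_drop])
      simp [h2]
    · simp [h1]

lemma single_eq_mul_mono (w : Word) (a : Entire) : single q w a = single q [] a * mono q w := by
  rw [mono_eq_single, single_mul_single]
  simp

lemma mono_append (v w : Word) : mono q (v ++ w) = mono q v * mono q w := by
  simp only [mono_eq_single, single_mul_single, map_one, mul_one]

/-- Multiplying the radius by |q|^{M(w)} cancels the height of the single word w, so each row of the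
array defines an entire function. -/
lemma tsum_row_lt_top {b : Word → ℕ → ℂ} (h : ∀ l r : ℝ≥0, 0 < l → 0 < r →
    ∑' w : Word, ∑' m : ℕ, ‖b w m‖ₑ * (wordWeight q Word.innerPeak l r m w : ℝ≥0∞) < ∞)
    (w : Word) (l : ℝ≥0) : ∑' m, ‖b w m‖ₑ * (l : ℝ≥0∞) ^ m < ∞ := by
  have hq0 : 0 < ‖(q : ℂ)‖₊ := zero_lt_one.trans hq.out
  refine lt_of_le_of_lt ?_ ((ENNReal.le_tsum w).trans_lt
    (h ((l + 1) * ‖(q : ℂ)‖₊ ^ w.innerPeak) 1 (by positivity) one_pos))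
  refine ENNReal.tsum_le_tsum fun m => ?_
  rw [wordWeight, mul_assoc, ← zpow_add₀ hq0.ne', ← ENNReal.coe_pow]
  simp only [add_neg_cancel, zpow_zero, mul_one, one_pow]
  gcongr
  exact le_self_add

/-- The series with a given array of coefficients. -/
noncomputable def ofArray (b : Word → ℕ → ℂ) (h : ∀ l r : ℝ≥0, 0 < l → 0 < r →
    ∑' w : Word, ∑' m : ℕ, ‖b w m‖ₑ * (wordWeight q Word.innerPeak l r m w : ℝ≥0∞) < ∞) :
    ConvSeries q :=
  ⟨⟨fun w => Entire.ofCoeff (b w) (tsum_row_lt_top h w)⟩, fun l r hl hr => by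
    rw [convNorm_eq hq.out.le]
    simp only [Entire.taylorCoeff_ofCoeff]
    exact h l r hl hr⟩

lemma tc_ofArray (b : Word → ℕ → ℂ) (h) (w : Word) (m : ℕ) :
    (ofArray (q := q) b h).tc w m = b w m :=
  Entire.taylorCoeff_ofCoeff (b w) (tsum_row_lt_top h w) m

/-! ### Surjectivity -/

/-- A diagonal argument. Level k is allowed only off a finite set outside which the k-th sum is
below 2^{-k}; whatever levels are chosen, the total is then at most the sum at level 0 plus a
geometric series. Each index takes the largest allowed level not exceeding its code, so the levels
tend to infinity. -/
lemma exists_slow_index {ι : Type*} [Encodable ι] (g : ℕ → ι → ℝ≥0∞)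
    (hg : ∀ k, ∑' p, g k p ≠ ∞) :
    ∃ κ : ι → ℕ, (∀ k, {p | κ p < k}.Finite) ∧ ∑' p, g (κ p) p ≠ ∞ := by
  classical
  have hs : ∀ k, ∃ s : Finset ι, ∑' p : {p // p ∉ s}, g k p < 2⁻¹ ^ k := fun k =>
    ((ENNReal.tendsto_tsum_compl_atTop_zero (hg k)).eventually_lt_const
      (ENNReal.pow_pos (by simp) k)).exists
  choose s hs using hs
  -- The code of p bounds the search. The default value 0, taken when no level is allowed, is paid
  -- for by the extra term `g 0 p`.
  refine ⟨fun p => Nat.findGreatest (fun k => p ∉ s k) (Encodable.encode p), fun k => ?_, ?_⟩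
  · refine Set.Finite.subset (s := (s k : Set ι) ∪ Encodable.encode ⁻¹' (Set.Iio k)) ?_ ?_
    · exact (s k).finite_toSet.union
        ((Set.finite_Iio k).preimage Encodable.encode_injective.injOn)
    · intro p hp
      by_contra! h
      simp only [Set.mem_union, Finset.mem_coe, Set.mem_preimage, Set.mem_Iio, not_or,
        not_lt] at h
      exact (Nat.le_findGreatest (P := fun k => p ∉ s k) h.2 h.1).not_gt hp
  · have h1 : ∀ p, g (Nat.findGreatest (fun k => p ∉ s k) (Encodable.encode p)) p ≤
        g 0 p + ∑' k, ({p | p ∉ s k} : Set ι).indicator (g k) p := by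
      intro p
      rcases eq_or_ne (Nat.findGreatest (fun k => p ∉ s k) (Encodable.encode p)) 0 with h | h
      · rw [h]; exact le_self_add
      · have h2 : p ∉ s _ := Nat.findGreatest_of_ne_zero (P := fun k => p ∉ s k) rfl h
        refine le_trans (le_of_eq ?_) ((ENNReal.le_tsum (Nat.findGreatest (fun k => p ∉ s k)
          (Encodable.encode p))).trans le_add_self)
        exact (Set.indicator_of_mem (show p ∈ {p | p ∉ s _} from h2) _).symm
    refine ne_top_of_le_ne_top ?_ (ENNReal.tsum_le_tsum h1)
    rw [ENNReal.tsum_add, ENNReal.tsum_comm]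
    refine ENNReal.add_ne_top.2 ⟨hg 0, ?_⟩
    refine ne_top_of_le_ne_top (b := ∑' k, (2⁻¹ : ℝ≥0∞) ^ k) ?_ (ENNReal.tsum_le_tsum fun k => ?_)
    · rw [ENNReal.tsum_geometric, ENNReal.one_sub_inv_two, inv_inv]; simp
    · rw [← tsum_subtype]; exact (hs k).le

omit hq in
-- The infimum of the weights need not be attained, hence the slack ε. It is measured after
-- multiplication by |c|, so that the errors can be summed over all indices.
lemma exists_word_lt (h : Word → ℤ) (l r : ℝ≥0) (m : ℕ) (n : ℤ) (c : ℂ) {ε : ℝ≥0}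
    (hε : 0 < ε) : ∃ w : Word, w.c = n ∧
      ‖c‖ₑ * (wordWeight q h l r m w : ℝ≥0∞) < ‖c‖ₑ * minWeight q h l r m n + ε := by
  have h1 : ‖c‖ₑ * minWeight q h l r m n < ‖c‖ₑ * minWeight q h l r m n + ε :=
    ENNReal.lt_add_right (ENNReal.mul_ne_top enorm_ne_top (minWeight_ne_top q h l r m n))
      (by simpa using hε.ne')
  rw [minWeight, ENNReal.mul_iInf' (fun h => (enorm_ne_top h).elim) (fun _ => inferInstance), iInf_lt_iff] at h1
  obtain ⟨⟨w, hw⟩, h1⟩ := h1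
  refine ⟨w, hw, ?_⟩
  rw [minWeight, ENNReal.mul_iInf' (fun h => (enorm_ne_top h).elim) (fun _ => inferInstance)]
  exact h1

/-- Each coefficient is placed on one word, although the almost optimal word depends on (λ, ρ). The
word for (m, n) is chosen at both radii equal to κ + 1, with κ from `exists_slow_index`. For given
(λ, ρ) all but finitely many indices have κ + 1 above both radii, and weights increase with the
radii. -/
lemma toLaurent_surjective : Function.Surjective (toLaurent q) := by
  intro a
  have hg : ∀ k : ℕ, ∑' p : ℕ × ℤ, ‖a.coeff p.1 p.2‖ₑ *
      minWeight q Word.innerPeak (k + 1) (k + 1) p.1 p.2 ≠ ∞ := fun k => by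
    rw [← laurentNorm_eq_tsum hq.out.le _ (by positivity)]
    exact (a.laurentNorm_lt_top (by positivity) (by positivity)).ne
  obtain ⟨κ, hκ, hsum⟩ := exists_slow_index _ hg
  obtain ⟨ε, hε, hεs⟩ := ENNReal.exists_pos_sum_of_countable one_ne_zero (ℕ × ℤ)
  choose v hv hva using fun p : ℕ × ℤ => exists_word_lt (q := q) Word.innerPeak
    ((κ p : ℝ≥0) + 1) (κ p + 1) p.1 p.2 (a.coeff p.1 p.2) (hε p)
  classical
  -- Every (m, n) occupies exactly one place of the array, so sums over w and m become sums over (m,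
  -- n).
  set b : Word → ℕ → ℂ := fun w m => if w = v (m, w.c) then a.coeff m w.c else 0 with hb
  have hbn : ∀ (m : ℕ) (n : ℤ) (F : ℂ → Word → ℝ≥0∞), (∀ w, F 0 w = 0) →
      ∑' w : Word.c ⁻¹' {n}, F (b w m) w = F (a.coeff m n) (v (m, n)) := by
    intro m n F hF
    rw [tsum_eq_single ⟨v (m, n), hv (m, n)⟩]
    · simp [hb, hv (m, n)]
    · rintro ⟨w, hw⟩ hne
      have hw' : w.c = n := hw
      have : w ≠ v (m, n) := fun h => hne (Subtype.ext h)
      simp [hb, hw', this, hF]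
  have hfin : ∀ l r : ℝ≥0, 0 < l → 0 < r → ∑' w : Word, ∑' m : ℕ, ‖b w m‖ₑ *
      (wordWeight q Word.innerPeak l r m w : ℝ≥0∞) < ∞ := by
    intro l r hl hr
    have e : ∑' w : Word, ∑' m : ℕ, ‖b w m‖ₑ * (wordWeight q Word.innerPeak l r m w : ℝ≥0∞) =
        ∑' p : ℕ × ℤ, ‖a.coeff p.1 p.2‖ₑ * (wordWeight q Word.innerPeak l r p.1 (v p) : ℝ≥0∞) := by
      rw [ENNReal.tsum_prod', ENNReal.tsum_comm (α := Word)]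
      refine tsum_congr fun m => ?_
      rw [← ENNReal.tsum_fiberwise _ Word.c]
      refine tsum_congr fun n => ?_
      exact hbn m n (fun c w => ‖c‖ₑ * (wordWeight q Word.innerPeak l r m w : ℝ≥0∞)) (by simp)
    rw [e]
    obtain ⟨k, hk⟩ := exists_nat_ge (max l r)
    -- The finitely many indices of low level are bounded by their own terms, the others by the
    -- diagonal sum and its slack.
    have hbound : ∀ p : ℕ × ℤ,
        ‖a.coeff p.1 p.2‖ₑ * (wordWeight q Word.innerPeak l r p.1 (v p) : ℝ≥0∞) ≤
        ({p | κ p < k} : Set (ℕ × ℤ)).indicator (fun p => ‖a.coeff p.1 p.2‖ₑ *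
          (wordWeight q Word.innerPeak l r p.1 (v p) : ℝ≥0∞)) p +
        (‖a.coeff p.1 p.2‖ₑ * minWeight q Word.innerPeak (κ p + 1) (κ p + 1) p.1 p.2 + ε p) := by
      intro p
      by_cases hp : κ p < k
      · rw [Set.indicator_of_mem (show p ∈ {p | κ p < k} from hp)]
        exact le_self_add
      · rw [Set.indicator_of_notMem (show p ∉ {p | κ p < k} from hp), zero_add]
        refine le_trans ?_ (hva p).le
        have hkk : (k : ℝ≥0) ≤ κ p + 1 := by exact_mod_cast (not_lt.1 hp).trans (Nat.le_succ _)
        gcongr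
        exact wordWeight_mono q _ ((le_max_left _ _).trans (hk.trans hkk))
          ((le_max_right _ _).trans (hk.trans hkk)) _ _
    refine (ENNReal.tsum_le_tsum hbound).trans_lt ?_
    rw [ENNReal.tsum_add, ENNReal.tsum_add]
    refine ENNReal.add_lt_top.2 ⟨?_, ENNReal.add_lt_top.2 ⟨hsum.lt_top, hεs.trans (by simp)⟩⟩
    have := (hκ k).fintype
    rw [← tsum_subtype, tsum_fintype]
    exact ENNReal.sum_lt_top.2 fun p _ => ENNReal.mul_lt_top enorm_lt_top ENNReal.coe_lt_top
  refine ⟨ofArray b hfin, Subtype.ext (funext fun m => funext fun n => ?_)⟩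
  change ∑' w : {w : Word // w.c = n}, (ofArray (q := q) b hfin).tc w m = a.coeff m n
  simp only [tc_ofArray]
  rw [tsum_eq_single ⟨v (m, n), hv (m, n)⟩]
  · simp [hb, hv (m, n)]
  · rintro ⟨w, hw⟩ hne
    have : w ≠ v (m, n) := fun h => hne (Subtype.ext h)
    simp [hb, hw, this]

end ConvSeries

/-! ### The closed ideal and the quotient seminorms -/

namespace ConvSeries

variable {q : ℂˣ} [hq : Fact (1 < ‖(q : ℂ)‖₊)]

lemma φ_single (w : Word) (a : Entire) (m : ℕ) (n : ℤ) :
    φ m n (single q w a) = if n = w.c then taylorCoeff a m else 0 := by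
  rw [φ_eq_tsum_ite, tsum_eq_single w]
  · simp [tc_single, eq_comm]
  · intro u hu
    simp [tc_single, hu]

lemma φ_sub (m : ℕ) (n : ℤ) (f g : ConvSeries q) : φ m n (f - g) = φ m n f - φ m n g :=
  map_sub (φL q m n) f g

lemma φ_mul_eq_zero_left {f : ConvSeries q} (hf : ∀ m n, φ m n f = 0) (g : ConvSeries q) (m : ℕ)
    (n : ℤ) : φ m n (f * g) = 0 :=
  (hasSum_φ_mul m n f g).unique (by simp [hf])

lemma φ_mul_eq_zero_right (f : ConvSeries q) {g : ConvSeries q} (hg : ∀ m n, φ m n g = 0) (m : ℕ)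
    (n : ℤ) : φ m n (f * g) = 0 :=
  (hasSum_φ_mul m n f g).unique (by simp [hg])

variable (q) in
/-- The common kernel of the functionals `φ_{m,n}`. -/
noncomputable def kerIdeal : TwoSidedIdeal (ConvSeries q) :=
  .mk' {f | ∀ m n, φ m n f = 0} (fun m n => map_zero (φL q m n))
    (fun {f g} hf hg m n => by rw [φ_add, hf, hg, add_zero])
    (fun {f} hf m n => (map_neg (φL q m n) f).trans (by
      rw [show φL q m n f = φ m n f from rfl, hf, neg_zero]))
    (fun {f g} hg => φ_mul_eq_zero_right f hg)
    (fun {f g} hf => φ_mul_eq_zero_left hf g)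

lemma mem_kerIdeal {f : ConvSeries q} : f ∈ kerIdeal q ↔ ∀ m n, φ m n f = 0 :=
  TwoSidedIdeal.mem_mk' ..

variable (q) in
/-- The two-sided ideal generated by `x₁ x₂ - 1` and `x₂ x₁ - 1`. -/
noncomputable def relIdeal : TwoSidedIdeal (ConvSeries q) :=
  TwoSidedIdeal.span {x₁ q * x₂ q - 1, x₂ q * x₁ q - 1}

lemma relIdeal_le_kerIdeal : relIdeal q ≤ kerIdeal q := by
  rw [relIdeal, TwoSidedIdeal.span_le]
  have h : ∀ s t : Fin 2, letterSign s + letterSign t = 0 →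
      mono q [s] * mono q [t] - 1 ∈ kerIdeal q := by
    intro s t hst
    rw [← mono_append, mono_eq_single, ← single_one, mem_kerIdeal]
    intro m n
    have hc : Word.c ([s] ++ [t]) = Word.c [] := by simp [hst]
    rw [φ_sub, φ_single, φ_single, hc, sub_self]
  rintro f (rfl | rfl)
  · exact h 0 1 (by simp [letterSign])
  · exact h 1 0 (by simp [letterSign])

/-- Modulo the relations the two letters are inverse to each other, so the class of x^w is the power
with exponent c(w) of a unit. -/
lemma mono_sub_mono_mem {v w : Word} (h : v.c = w.c) : mono q v - mono q w ∈ relIdeal q := by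
  set π := (relIdeal q).ringCon.mk' with hπ
  have hmem : ∀ f, f ∈ ({x₁ q * x₂ q - 1, x₂ q * x₁ q - 1} : Set (ConvSeries q)) →
      f ∈ relIdeal q := fun f hf => TwoSidedIdeal.subset_span hf
  have h0 : ∀ f g, π f = π g ↔ f - g ∈ relIdeal q := fun f g => by
    rw [← TwoSidedIdeal.rel_iff]
    exact RingCon.eq _
  have h12 : π (x₁ q) * π (x₂ q) = 1 := by
    rw [← map_mul, ← map_one π, h0]
    exact hmem _ (by simp)
  have h21 : π (x₂ q) * π (x₁ q) = 1 := by
    rw [← map_mul, ← map_one π, h0]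
    exact hmem _ (by simp)
  let U : ((relIdeal q).ringCon.Quotient)ˣ := ⟨π (x₁ q), π (x₂ q), h12, h21⟩
  have key : ∀ w : Word, π (mono q w) = (U ^ w.c : ((relIdeal q).ringCon.Quotient)ˣ) := by
    intro w
    induction w with
    | nil =>
      rw [mono_eq_single, single_one, map_one]
      simp
    | cons s w ih =>
      rw [← List.singleton_append, mono_append, map_mul, ih, List.singleton_append, Word.c_cons,
        zpow_add, Units.val_mul]
      congr 1
      fin_cases s
      · simp only [letterSign]
        exact (congrArg Units.val (zpow_one U)).symm
      · simp only [letterSign]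
        exact (congrArg Units.val (zpow_neg_one U)).symm
  rw [← h0, key, key, h]

lemma single_sub_single_mem {v w : Word} (h : v.c = w.c) (a : Entire) :
    single q v a - single q w a ∈ relIdeal q := by
  rw [single_eq_mul_mono v, single_eq_mul_mono w, ← mul_sub]
  exact (relIdeal q).mul_mem_left _ _ (mono_sub_mono_mem h)

omit hq in
lemma smul_mem_relIdeal (c : ℂ) {f : ConvSeries q} (hf : f ∈ relIdeal q) :
    c • f ∈ relIdeal q := by
  rw [Algebra.smul_def]
  exact (relIdeal q).mul_mem_left _ _ hf

omit hq in
lemma closedIdeal_eq_closure : closedIdeal q = closure (relIdeal q : Set (ConvSeries q)) := rfl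

/-- The common kernel is an ideal by `hasSum_φ_mul`, contains the relations, and is closed by
continuity of the functionals. -/
lemma closedIdeal_subset_ker : closedIdeal q ⊆ {f | ∀ m n, φ m n f = 0} := by
  rw [closedIdeal_eq_closure]
  refine closure_minimal (fun f hf => mem_kerIdeal.1 (relIdeal_le_kerIdeal hf)) ?_
  have : {f : ConvSeries q | ∀ m n, φ m n f = 0} = ⋂ m, ⋂ n, φL q m n ⁻¹' {0} := by
    ext f
    simp only [Set.mem_iInter]
    rfl
  rw [this]
  exact isClosed_iInter fun m => isClosed_iInter fun n =>
    isClosed_singleton.preimage (φL q m n).continuous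

lemma laurentNorm_φ_le {l r : ℝ≥0} (hr : 0 < r) (f : ConvSeries q) :
    laurentNorm q l r (fun m n => φ m n f) ≤ convNorm q l r f.toSeries := by
  rw [laurentNorm_eq_tsum hq.out.le l hr, convNorm_eq_wNorm]
  exact tsum_φ_le _ l r f

/-! ### Finite truncations and the upper bound for the quotient seminorm -/

lemma convNorm_single_Z_pow (l r : ℝ≥0) (w : Word) (m : ℕ) :
    convNorm q l r (single q w (Entire.Z ^ m)).toSeries = wordWeight q Word.innerPeak l r m w := by
  rw [convNorm_eq_wNorm, wNorm, tsum_eq_single w, tsum_eq_single m]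
  · simp [tc_single, Entire.taylorCoeff_Z_pow]
  · intro k hk
    simp [tc_single, Entire.taylorCoeff_Z_pow, hk]
  · intro u hu
    simp [tc_single, hu]

omit hq in
lemma convNorm_sum_le {ι : Type*} (l r : ℝ≥0) (s : Finset ι) (F : ι → ConvSeries q) :
    convNorm q l r (∑ i ∈ s, F i).toSeries ≤ ∑ i ∈ s, convNorm q l r (F i).toSeries :=
  Finset.le_sum_of_subadditive (fun f : ConvSeries q => convNorm q l r f.toSeries)
    (convNorm_zero q l r).le (fun f g => convNorm_add_le q l r f.toSeries g.toSeries) s F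

/-- The part of a series supported on a finite set of monomials. -/
noncomputable def trunc (f : ConvSeries q) (F : Finset (Word × ℕ)) : ConvSeries q :=
  ∑ p ∈ F, f.tc p.1 p.2 • single q p.1 (Entire.Z ^ p.2)

lemma tc_sub_trunc (f : ConvSeries q) (F : Finset (Word × ℕ)) [DecidableEq (Word × ℕ)]
    (w : Word) (m : ℕ) :
    (f - trunc f F).tc w m = if (w, m) ∈ F then 0 else f.tc w m := by
  have hneg : ∀ g : ConvSeries q, (-g).tc w m = -g.tc w m := fun g => by
    rw [← neg_one_smul ℂ g, tc_smul, neg_one_mul]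
  have hsum : (trunc f F).tc w m = if (w, m) ∈ F then f.tc w m else 0 := by
    unfold trunc
    have := map_sum (⟨⟨fun f => tc f w m, by simpa using tc_smul 0 (0 : ConvSeries q) w m⟩,
      fun a b => tc_add a b w m⟩ : ConvSeries q →+ ℂ)
      (fun p : Word × ℕ => f.tc p.1 p.2 • single q p.1 (Entire.Z ^ p.2)) F
    refine this.trans ?_
    simp only [AddMonoidHom.coe_mk, ZeroHom.coe_mk, tc_smul, tc_single, Entire.taylorCoeff_Z_pow]
    rw [← Finset.sum_ite_eq F (w, m) fun p => f.tc p.1 p.2]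
    refine Finset.sum_congr rfl fun p _ => ?_
    by_cases h1 : w = p.1
    · by_cases h2 : m = p.2
      · simp [h1, h2]
      · simp [h2, Prod.ext_iff]
    · simp [h1, Prod.ext_iff]
  rw [sub_eq_add_neg, tc_add, hneg, hsum]
  split_ifs <;> simp

lemma exists_trunc (f : ConvSeries q) {l r : ℝ≥0} (hl : 0 < l) (hr : 0 < r) {ε : ℝ≥0}
    (hε : 0 < ε) : ∃ F, convNorm q l r (f - trunc f F).toSeries < ε := by
  classical
  set T : Word × ℕ → ℝ≥0∞ := fun p =>
    ‖f.tc p.1 p.2‖ₑ * (wordWeight q Word.innerPeak l r p.2 p.1 : ℝ≥0∞) with hT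
  have h1 : ∑' p, T p ≠ ∞ := by
    have := (f.convNorm_lt_top hl hr).ne
    rwa [convNorm_eq_wNorm, wNorm, ← ENNReal.tsum_prod (f := fun w m => T (w, m))] at this
  obtain ⟨F, hF⟩ := ((ENNReal.tendsto_tsum_compl_atTop_zero h1).eventually_lt_const
    (show (0 : ℝ≥0∞) < ε by simpa using hε)).exists
  refine ⟨F, lt_of_le_of_lt (le_of_eq ?_) hF⟩
  have h2 := tsum_subtype {p | p ∉ F} T
  refine Eq.trans ?_ h2.symm
  rw [convNorm_eq_wNorm, wNorm, ← ENNReal.tsum_prod (f := fun w m =>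
    ‖(f - trunc f F).tc w m‖ₑ * (wordWeight q Word.innerPeak l r m w : ℝ≥0∞))]
  refine tsum_congr fun p => ?_
  rw [tc_sub_trunc]
  by_cases hp : p ∈ F
  · rw [Set.indicator_of_notMem (by simpa using hp)]
    simp [hp]
  · rw [Set.indicator_of_mem (by simpa using hp)]
    simp [hp, hT]

lemma φ_trunc (f : ConvSeries q) (F : Finset (Word × ℕ)) (m : ℕ) (n : ℤ) :
    φ m n (trunc f F) =
      ∑ p ∈ F, if n = p.1.c ∧ m = p.2 then f.tc p.1 p.2 else 0 := by
  refine (map_sum (φL q m n) _ F).trans (Finset.sum_congr rfl fun p _ => ?_)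
  change φ m n _ = _
  rw [φ_smul, φ_single, Entire.taylorCoeff_Z_pow]
  by_cases h1 : n = p.1.c <;> by_cases h2 : m = p.2 <;> simp [h1, h2]

/-- After truncation, every z^m x^w is moved to an almost optimal word with the same c, which
changes the series only by an element of the ideal. Coefficients with equal (m, n) meet on the same
word and add up to φ_{m,n}, so their cancellation is kept. The truncation error counts twice, once
for f and once for its φ-values; the third ε is for the choice of words. -/
lemma exists_add_mem_convNorm_le (f : ConvSeries q) {l r : ℝ≥0} (hl : 0 < l) (hr : 0 < r)
    {ε : ℝ≥0} (hε : 0 < ε) : ∃ g ∈ relIdeal q, convNorm q l r (f + g).toSeries ≤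
      laurentNorm q l r (fun m n => φ m n f) + (ε + ε + ε) := by
  classical
  obtain ⟨F, hF⟩ := exists_trunc f hl hr hε
  obtain ⟨δ, hδ, hδs⟩ := ENNReal.exists_pos_sum_of_countable
    (ENNReal.coe_ne_zero.2 hε.ne') (ℕ × ℤ)
  choose v hv hvw using fun p : ℕ × ℤ => exists_word_lt (q := q) Word.innerPeak l r p.1 p.2
    (φ p.1 p.2 (trunc f F)) (hδ p)
  set S : Finset (ℕ × ℤ) := F.image fun p => (p.2, p.1.c) with hS
  set h : ConvSeries q := ∑ p ∈ S, φ p.1 p.2 (trunc f F) • single q (v p) (Entire.Z ^ p.1) with hh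
  -- `h` is defined over the distinct indices (m, n), which suits the norm estimate. Rewritten over
  -- F it is the truncation with each monomial moved to another word, which shows that the
  -- difference lies in the ideal.
  have e1 : h = ∑ p ∈ F, f.tc p.1 p.2 • single q (v (p.2, p.1.c)) (Entire.Z ^ p.2) := by
    have : ∀ p ∈ S, φ p.1 p.2 (trunc f F) • single q (v p) (Entire.Z ^ p.1) =
        ∑ u ∈ F with (u.2, u.1.c) = p,
          f.tc u.1 u.2 • single q (v (u.2, u.1.c)) (Entire.Z ^ u.2) := by
      intro p _
      rw [φ_trunc, Finset.sum_smul, Finset.sum_filter]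
      refine Finset.sum_congr rfl fun u _ => ?_
      by_cases hu : (u.2, u.1.c) = p
      · rw [← hu]; simp
      · rw [if_neg hu, if_neg, zero_smul]
        rintro ⟨h1, h2⟩
        exact hu (Prod.ext h2.symm h1.symm)
    rw [hh, Finset.sum_congr rfl this]
    exact Finset.sum_fiberwise_of_maps_to (fun u hu => Finset.mem_image_of_mem _ hu) _
  refine ⟨h - trunc f F, ?_, ?_⟩
  · rw [e1, trunc, ← Finset.sum_sub_distrib]
    refine sum_mem fun p _ => ?_
    rw [← smul_sub]
    exact smul_mem_relIdeal _ (single_sub_single_mem (hv _) _)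
  · have e2 : f + (h - trunc f F) = (f - trunc f F) + h := by abel
    have e3 : laurentNorm q l r (fun m n => φ m n (trunc f F)) ≤
        laurentNorm q l r (fun m n => φ m n f) + ε := by
      have : (fun m n => φ m n (trunc f F)) =
          (fun m n => φ m n f) + fun m n => φ m n (trunc f F - f) := by
        funext m n
        simp [φ_sub]
      rw [this]
      refine (laurentNorm_add_le _ _ _ _ _).trans (by
        gcongr
        refine (laurentNorm_φ_le hr _).trans (le_trans ?_ hF.le)
        rw [← neg_sub, ← neg_one_smul ℂ]
        refine (convNorm_smul_le q l r (-1) (f - trunc f F).toSeries).trans ?_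
        simp)
    have e4 : convNorm q l r h.toSeries ≤
        laurentNorm q l r (fun m n => φ m n (trunc f F)) + ε := by
      rw [laurentNorm_eq_tsum hq.out.le l hr]
      refine (convNorm_sum_le l r S _).trans ?_
      refine le_trans (Finset.sum_le_sum fun p _ => ?_) ((ENNReal.sum_le_tsum S).trans
        ((ENNReal.tsum_add).le.trans (add_le_add le_rfl hδs.le)))
      refine le_trans ?_ (hvw p).le
      refine (convNorm_smul_le q l r _ (single q (v p) (Entire.Z ^ p.1)).toSeries).trans ?_
      rw [convNorm_single_Z_pow]
    rw [e2]
    calc _ ≤ convNorm q l r (f - trunc f F).toSeries + convNorm q l r h.toSeries :=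
          convNorm_add_le q l r _ _
      _ ≤ ε + (laurentNorm q l r (fun m n => φ m n f) + ε + ε) :=
          add_le_add hF.le (e4.trans (add_le_add e3 le_rfl))
      _ = _ := by ring

/-- When all φ_{m,n}(f) vanish, `exists_add_mem_convNorm_le` makes f + g small with g in the ideal,
so -g approximates f. -/
lemma ker_subset_closedIdeal : {f | ∀ m n, φ m n f = 0} ⊆ closedIdeal q := by
  intro f hf
  rw [closedIdeal_eq_closure, mem_closure_iff_nhds]
  intro U hU
  obtain ⟨s, ρ, hρ, hsU⟩ := ((withSeminorms q).mem_nhds_iff f U).1 hU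
  -- Seminorms increase with both radii, so one common radius controls the finitely many of a basic
  -- neighbourhood.
  obtain ⟨l, hl, hls⟩ : ∃ l : ℝ≥0, 0 < l ∧ ∀ i ∈ s, i.1.1 ≤ l ∧ i.2.1 ≤ l := by
    refine ⟨s.sup (fun i => max i.1.1 i.2.1) + 1, by positivity, fun i hi => ?_⟩
    have := (Finset.le_sup (f := fun i : {l : ℝ≥0 // 0 < l} × {r : ℝ≥0 // 0 < r} =>
      max i.1.1 i.2.1) hi).trans le_self_add (c := s.sup (fun i => max i.1.1 i.2.1) + 1)
    exact max_le_iff.1 this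
  -- A quarter, because three such errors must stay strictly below ρ.
  have hε : 0 < ρ.toNNReal / 4 := by have := Real.toNNReal_pos.2 hρ; positivity
  obtain ⟨g, hg, hgn⟩ := exists_add_mem_convNorm_le f hl hl hε
  have h0 : laurentNorm q l l (fun m n => φ m n f) = 0 := by
    rw [laurentNorm_eq_tsum hq.out.le l hl]
    simp [show ∀ m n, φ m n f = 0 from hf]
  refine ⟨-g, hsU ?_, (relIdeal q).neg_mem hg⟩
  rw [Seminorm.mem_ball]
  refine Seminorm.finset_sup_apply_lt hρ fun i hi => ?_
  rw [← map_neg_eq_map, neg_sub, sub_neg_eq_add, seminorm_apply]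
  have h1 : convNorm q i.1 i.2 (f + g).toSeries ≤ convNorm q l l (f + g).toSeries := by
    rw [convNorm_eq_wNorm, convNorm_eq_wNorm]
    refine ENNReal.tsum_le_tsum fun w => ENNReal.tsum_le_tsum fun m => ?_
    gcongr
    exact wordWeight_mono q _ (hls i hi).1 (hls i hi).2 _ _
  have h2 := h1.trans hgn
  rw [h0, zero_add, ← ENNReal.coe_add, ← ENNReal.coe_add] at h2
  have h3 := ENNReal.toReal_mono ENNReal.coe_ne_top h2
  rw [ENNReal.coe_toReal] at h3
  refine h3.trans_lt ?_
  push_cast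
  rw [Real.coe_toNNReal _ hρ.le]
  linarith

theorem closedIdeal_eq : closedIdeal q = {f | ∀ m n, φ m n f = 0} :=
  closedIdeal_subset_ker.antisymm ker_subset_closedIdeal

/-- Elements of I do not change the φ-values, which bound the norm from below; conversely the ideal
before closure already comes within every ε. -/
theorem quotientNorm_eq {l r : ℝ≥0} (hl : 0 < l) (hr : 0 < r) (f : ConvSeries q) :
    quotientNorm l r f = laurentNorm q l r fun m n => φ m n f := by
  apply le_antisymm
  · refine ENNReal.le_of_forall_pos_le_add fun ε hε _ => ?_
    obtain ⟨g, hg, h⟩ := exists_add_mem_convNorm_le f hl hr (show 0 < ε / 3 by positivity)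
    refine (iInf₂_le g (subset_closure hg)).trans (h.trans (le_of_eq ?_))
    rw [← ENNReal.coe_add, ← ENNReal.coe_add]
    congr 2
    rw [← NNReal.coe_inj]
    push_cast
    ring
  · refine le_iInf₂ fun g hg => ?_
    refine le_trans (le_of_eq ?_) (laurentNorm_φ_le hr (f + g))
    congr 1
    funext m n
    rw [φ_add, closedIdeal_subset_ker hg m n, add_zero]

end ConvSeries

/-! ### Arens-Michael algebras -/

lemma ArensMichaelAlgebra.of_family {B ι : Type*} [Ring B] [Algebra ℂ B] [UniformSpace B]
    [IsUniformAddGroup B] [CompleteSpace B] [T2Space B] {p : SeminormFamily ℂ B ι}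
    (hp : WithSeminorms p) (hmul : ∀ i a b, p i (a * b) ≤ p i a * p i b) :
    ArensMichaelAlgebra B where
  isUniformAddGroup := inferInstance
  completeSpace := inferInstance
  t2Space := inferInstance
  exists_seminorms := by
    refine ⟨Set.range p, ?_, hp.congr ?_ ?_⟩
    · rintro _ ⟨i, rfl⟩
      exact hmul i
    · rintro ⟨_, i, rfl⟩
      refine ⟨{i}, 1, ?_⟩
      rw [Finset.sup_singleton, one_smul]
      rfl
    · intro i
      refine ⟨{⟨p i, i, rfl⟩}, 1, ?_⟩
      rw [Finset.sup_singleton, one_smul]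
      rfl

lemma continuousMul_of_submultiplicative {B ι : Type*} [Ring B] [Algebra ℂ B] [TopologicalSpace B]
    {p : SeminormFamily ℂ B ι} (hp : WithSeminorms p)
    (hmul : ∀ i a b, p i (a * b) ≤ p i a * p i b) : ContinuousMul B := by
  have := hp.topologicalAddGroup
  refine ⟨continuous_iff_continuousAt.2 fun x₀ => (hp.tendsto_nhds _ _).2 fun i ε hε => ?_⟩
  have hc : Continuous fun x : B × B => p i (x.1 - x₀.1) * p i (x.2 - x₀.2) +
      p i x₀.1 * p i (x.2 - x₀.2) + p i (x.1 - x₀.1) * p i x₀.2 := by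
    have h := hp.continuous_seminorm i
    fun_prop
  filter_upwards [hc.continuousAt.eventually_lt_const (show p i (x₀.1 - x₀.1) *
    p i (x₀.2 - x₀.2) + p i x₀.1 * p i (x₀.2 - x₀.2) + p i (x₀.1 - x₀.1) * p i x₀.2 < ε by
      simpa using hε)] with x hx
  refine lt_of_le_of_lt ?_ hx
  have e : x.1 * x.2 - x₀.1 * x₀.2 =
      (x.1 - x₀.1) * (x.2 - x₀.2) + x₀.1 * (x.2 - x₀.2) + (x.1 - x₀.1) * x₀.2 := by noncomm_ring
  rw [e]
  refine (map_add_le_add _ _ _).trans (add_le_add ((map_add_le_add _ _ _).trans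
    (add_le_add ?_ ?_)) ?_) <;> exact hmul _ _ _

lemma ArensMichaelAlgebra.continuousMul (B : Type*) [Ring B] [Algebra ℂ B] [UniformSpace B]
    [h : ArensMichaelAlgebra B] : ContinuousMul B := by
  obtain ⟨P, hP, hw⟩ := h.exists_seminorms
  exact continuousMul_of_submultiplicative hw fun i => hP i i.2

instance ArensMichaelAlgebra.ulift {B : Type*} [Ring B] [Algebra ℂ B] [UniformSpace B]
    [h : ArensMichaelAlgebra B] : ArensMichaelAlgebra (ULift.{u} B) := by
  have := h.isUniformAddGroup
  have := h.completeSpace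
  have := h.t2Space
  obtain ⟨P, hP, hw⟩ := h.exists_seminorms
  have hind : Topology.IsInducing (ULift.moduleEquiv (R := ℂ) (M := B)).toLinearMap := ⟨rfl⟩
  have : IsUniformAddGroup (ULift.{u} B) :=
    IsUniformAddGroup.comap (ULift.ringEquiv (R := B)).toAddEquiv
  exact .of_family (hind.withSeminorms hw) fun i a b => hP i i.2 a.down b.down

/-! ### The algebra structure on the space of Laurent series -/

namespace LaurentSpace

variable {q : ℂˣ}

lemma ext_coeff {a b : LaurentSpace q} (h : ∀ m n, a.coeff m n = b.coeff m n) : a = b :=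
  Subtype.ext (funext fun m => funext fun n => h m n)

lemma withSeminorms (q : ℂˣ) : WithSeminorms (seminorm q) := ⟨rfl⟩

instance : IsTopologicalAddGroup (LaurentSpace q) := (withSeminorms q).topologicalAddGroup
noncomputable instance : UniformSpace (LaurentSpace q) := IsTopologicalAddGroup.rightUniformSpace _
instance : IsUniformAddGroup (LaurentSpace q) := isUniformAddGroup_of_addCommGroup

variable [hq : Fact (1 < ‖(q : ℂ)‖₊)]

/-- The preimages are arbitrary: by `ConvSeries.hasSum_φ_mul` the product depends only on their
images. Hence `toLaurent` is multiplicative and the ring axioms descend along it. -/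
noncomputable instance : Mul (LaurentSpace q) :=
  ⟨fun a b => ConvSeries.toLaurent q
    (Function.surjInv ConvSeries.toLaurent_surjective a *
      Function.surjInv ConvSeries.toLaurent_surjective b)⟩

noncomputable instance : One (LaurentSpace q) := ⟨ConvSeries.toLaurent q 1⟩

/-- The coefficients of a product are given by a twisted convolution. -/
lemma hasSum_coeff_mul (a b : LaurentSpace q) (m : ℕ) (n : ℤ) :
    HasSum (fun k : ℤ => ∑ ij ∈ Finset.HasAntidiagonal.antidiagonal m,
      (q : ℂ) ^ (k * ij.2) * a.coeff ij.1 k * b.coeff ij.2 (n - k)) ((a * b).coeff m n) := by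
  have h := ConvSeries.hasSum_φ_mul m n (Function.surjInv ConvSeries.toLaurent_surjective a)
    (Function.surjInv ConvSeries.toLaurent_surjective b)
  simp only [← ConvSeries.coeff_toLaurent, Function.surjInv_eq] at h
  exact h

lemma toLaurent_mul (f g : ConvSeries q) :
    ConvSeries.toLaurent q (f * g) = ConvSeries.toLaurent q f * ConvSeries.toLaurent q g :=
  ext_coeff fun m n => by
    have h := hasSum_coeff_mul (ConvSeries.toLaurent q f) (ConvSeries.toLaurent q g) m n
    simp only [ConvSeries.coeff_toLaurent] at h
    rw [ConvSeries.coeff_toLaurent]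
    exact (ConvSeries.hasSum_φ_mul m n f g).unique h

lemma toLaurent_one : ConvSeries.toLaurent q 1 = 1 := rfl

noncomputable instance : Ring (LaurentSpace q) :=
  { (inferInstance : AddCommGroup (LaurentSpace q)) with
    mul_assoc := fun a b c => by
      obtain ⟨a, rfl⟩ := ConvSeries.toLaurent_surjective a
      obtain ⟨b, rfl⟩ := ConvSeries.toLaurent_surjective b
      obtain ⟨c, rfl⟩ := ConvSeries.toLaurent_surjective c
      simp only [← toLaurent_mul, mul_assoc]
    one_mul := fun a => by
      obtain ⟨a, rfl⟩ := ConvSeries.toLaurent_surjective a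
      rw [← toLaurent_one, ← toLaurent_mul, one_mul]
    mul_one := fun a => by
      obtain ⟨a, rfl⟩ := ConvSeries.toLaurent_surjective a
      rw [← toLaurent_one, ← toLaurent_mul, mul_one]
    left_distrib := fun a b c => by
      obtain ⟨a, rfl⟩ := ConvSeries.toLaurent_surjective a
      obtain ⟨b, rfl⟩ := ConvSeries.toLaurent_surjective b
      obtain ⟨c, rfl⟩ := ConvSeries.toLaurent_surjective c
      rw [← map_add, ← toLaurent_mul, mul_add, map_add, toLaurent_mul, toLaurent_mul]
    right_distrib := fun a b c => by
      obtain ⟨a, rfl⟩ := ConvSeries.toLaurent_surjective a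
      obtain ⟨b, rfl⟩ := ConvSeries.toLaurent_surjective b
      obtain ⟨c, rfl⟩ := ConvSeries.toLaurent_surjective c
      rw [← map_add, ← toLaurent_mul, add_mul, map_add, toLaurent_mul, toLaurent_mul]
    zero_mul := fun a => by
      obtain ⟨a, rfl⟩ := ConvSeries.toLaurent_surjective a
      rw [← map_zero (ConvSeries.toLaurent q), ← toLaurent_mul, zero_mul]
    mul_zero := fun a => by
      obtain ⟨a, rfl⟩ := ConvSeries.toLaurent_surjective a
      rw [← map_zero (ConvSeries.toLaurent q), ← toLaurent_mul, mul_zero] }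

noncomputable instance : Algebra ℂ (LaurentSpace q) :=
  Algebra.ofModule
    (fun c a b => by
      obtain ⟨a, rfl⟩ := ConvSeries.toLaurent_surjective a
      obtain ⟨b, rfl⟩ := ConvSeries.toLaurent_surjective b
      rw [← map_smul, ← toLaurent_mul, ← toLaurent_mul, smul_mul_assoc, map_smul])
    (fun c a b => by
      obtain ⟨a, rfl⟩ := ConvSeries.toLaurent_surjective a
      obtain ⟨b, rfl⟩ := ConvSeries.toLaurent_surjective b
      rw [← map_smul, ← toLaurent_mul, ← toLaurent_mul, mul_smul_comm, map_smul])

/-! ### Submultiplicative seminorms -/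

/-- Moving z^j past x^v costs |q|^{c(v)j}, paid for by the height of vw, which is at least c(v) plus
the height of w. The maximum over all prefixes matters: with the inner height the estimate can fail
for empty w, when v reaches a new maximum with its last letter. -/
lemma wordWeight_append_le (l r : ℝ≥0) (i j : ℕ) (v w : Word) :
    ‖(q : ℂ)‖₊ ^ (v.c * j) * wordWeight q Word.peak l r (i + j) (v ++ w) ≤
      wordWeight q Word.peak l r i v * wordWeight q Word.peak l r j w := by
  have hq0 : ‖(q : ℂ)‖₊ ≠ 0 := (zero_lt_one.trans hq.out).ne'
  have h1 : Word.peak v ≤ Word.peak (v ++ w) := by rw [Word.peak_append]; exact le_max_left _ _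
  have h2 : v.c + Word.peak w ≤ Word.peak (v ++ w) := by
    rw [Word.peak_append]; exact le_max_right _ _
  unfold wordWeight
  rw [zpow_mul, zpow_natCast, pow_add, List.length_append, pow_add]
  calc _ = (l * ‖(q : ℂ)‖₊ ^ (-Word.peak (v ++ w))) ^ i *
        (l * (‖(q : ℂ)‖₊ ^ v.c * ‖(q : ℂ)‖₊ ^ (-Word.peak (v ++ w)))) ^ j *
          (r ^ v.length * r ^ w.length) := by
        simp only [mul_pow]
        ring
    _ ≤ (l * ‖(q : ℂ)‖₊ ^ (-Word.peak v)) ^ i * (l * ‖(q : ℂ)‖₊ ^ (-Word.peak w)) ^ j *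
          (r ^ v.length * r ^ w.length) := by
        rw [← zpow_add₀ hq0]
        have h3 := zpow_le_zpow_right₀ hq.out.le (neg_le_neg h1)
        have h4 := zpow_le_zpow_right₀ hq.out.le
          (show v.c + -Word.peak (v ++ w) ≤ -Word.peak w by omega)
        gcongr
    _ = _ := by ring

/-- Concatenations are among the words ending at k + n, so the infimum over the latter is no larger.
-/
lemma minWeight_mul_le (l r : ℝ≥0) (i j : ℕ) (k n : ℤ) :
    ((‖(q : ℂ)‖₊ ^ (k * j) : ℝ≥0) : ℝ≥0∞) * minWeight q Word.peak l r (i + j) (k + n) ≤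
      minWeight q Word.peak l r i k * minWeight q Word.peak l r j n := by
  refine ENNReal.le_iInf_mul_iInf ⟨Classical.arbitrary _, ENNReal.coe_ne_top⟩
    ⟨Classical.arbitrary _, ENNReal.coe_ne_top⟩ fun ⟨v, hv⟩ ⟨w, hw⟩ => ?_
  have h := minWeight_le q Word.peak l r (i + j) (v ++ w)
  rw [Word.c_append, hv, hw] at h
  refine (mul_le_mul_right h _).trans ?_
  rw [← ENNReal.coe_mul, ← ENNReal.coe_mul, ENNReal.coe_le_coe]
  have h' := wordWeight_append_le (q := q) l r i j v w
  rwa [hv] at h'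

/-- The weighted `ℓ¹` norm with the minimal weights for the height `Word.peak`. -/
noncomputable def peakNorm (l r : ℝ≥0) (a : LaurentSpace q) : ℝ≥0∞ :=
  ∑' p : ℕ × ℤ, ‖a.coeff p.1 p.2‖ₑ * minWeight q Word.peak l r p.1 p.2

/-- The usual estimate for convolution in a weighted ℓ¹ space; `minWeight_mul_le` absorbs the twist.
-/
lemma peakNorm_mul_le (l r : ℝ≥0) (a b : LaurentSpace q) :
    peakNorm l r (a * b) ≤ peakNorm l r a * peakNorm l r b := by
  set F : ℕ → ℤ → ℝ≥0∞ := fun m n => ‖a.coeff m n‖ₑ * minWeight q Word.peak l r m n with hF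
  set G : ℕ → ℤ → ℝ≥0∞ := fun m n => ‖b.coeff m n‖ₑ * minWeight q Word.peak l r m n with hG
  have h1 : ∀ m n, ‖(a * b).coeff m n‖ₑ * minWeight q Word.peak l r m n ≤
      ∑' k : ℤ, ∑ ij ∈ Finset.HasAntidiagonal.antidiagonal m, F ij.1 k * G ij.2 (n - k) := by
    intro m n
    rw [← (hasSum_coeff_mul a b m n).tsum_eq]
    refine (mul_le_mul_left enorm_tsum_le_tsum_enorm _).trans ?_
    rw [← ENNReal.tsum_mul_right]
    refine ENNReal.tsum_le_tsum fun k => ?_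
    refine (mul_le_mul_left (enorm_sum_le _ _) _).trans ?_
    rw [Finset.sum_mul]
    refine Finset.sum_le_sum fun ij hij => ?_
    rw [Finset.HasAntidiagonal.mem_antidiagonal] at hij
    have h := minWeight_mul_le (q := q) l r ij.1 ij.2 k (n - k)
    rw [hij, add_sub_cancel] at h
    have e : ‖(q : ℂ) ^ (k * ij.2)‖ₑ = ((‖(q : ℂ)‖₊ ^ (k * ij.2) : ℝ≥0) : ℝ≥0∞) := by
      rw [enorm_eq_nnnorm, nnnorm_zpow]
    rw [enorm_mul, enorm_mul, e]
    calc _ = ‖a.coeff ij.1 k‖ₑ * ‖b.coeff ij.2 (n - k)‖ₑ *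
          (((‖(q : ℂ)‖₊ ^ (k * ij.2) : ℝ≥0) : ℝ≥0∞) * minWeight q Word.peak l r m n) := by ring
      _ ≤ ‖a.coeff ij.1 k‖ₑ * ‖b.coeff ij.2 (n - k)‖ₑ * _ := mul_le_mul_right h _
      _ = _ := by simp only [hF, hG]; ring
  have h2 : ∀ m, ∑' n : ℤ, ∑' k : ℤ, ∑ ij ∈ Finset.HasAntidiagonal.antidiagonal m,
      F ij.1 k * G ij.2 (n - k) =
      ∑ ij ∈ Finset.HasAntidiagonal.antidiagonal m, (∑' k, F ij.1 k) * ∑' n, G ij.2 n := by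
    intro m
    rw [ENNReal.tsum_comm]
    have h3 : ∀ k : ℤ, ∑' n : ℤ, ∑ ij ∈ Finset.HasAntidiagonal.antidiagonal m,
        F ij.1 k * G ij.2 (n - k) =
        ∑ ij ∈ Finset.HasAntidiagonal.antidiagonal m, F ij.1 k * ∑' n, G ij.2 n := by
      intro k
      rw [Summable.tsum_finsetSum fun _ _ => ENNReal.summable]
      refine Finset.sum_congr rfl fun ij _ => ?_
      rw [ENNReal.tsum_mul_left]
      congr 1
      exact (Equiv.subRight k).tsum_eq fun n => G ij.2 n
    simp only [h3]
    rw [Summable.tsum_finsetSum fun _ _ => ENNReal.summable]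
    simp only [ENNReal.tsum_mul_right]
  calc peakNorm l r (a * b) ≤ ∑' p : ℕ × ℤ, ∑' k : ℤ,
        ∑ ij ∈ Finset.HasAntidiagonal.antidiagonal p.1, F ij.1 k * G ij.2 (p.2 - k) :=
        ENNReal.tsum_le_tsum fun p => h1 p.1 p.2
    _ = ∑' m : ℕ, ∑ ij ∈ Finset.HasAntidiagonal.antidiagonal m,
          (∑' k, F ij.1 k) * ∑' n, G ij.2 n := by
        rw [ENNReal.tsum_prod']
        exact tsum_congr h2
    _ = ∑' p : ℕ × ℕ, (∑' k, F p.1 k) * ∑' n, G p.2 n := by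
        rw [← Finset.HasAntidiagonal.sigmaAntidiagonalEquivProd.tsum_eq, ENNReal.tsum_sigma']
        refine tsum_congr fun m => ?_
        rw [tsum_fintype, Finset.univ_eq_attach]
        exact (Finset.sum_attach (Finset.HasAntidiagonal.antidiagonal m) fun ij : ℕ × ℕ =>
          (∑' k, F ij.1 k) * ∑' n, G ij.2 n).symm
    _ = peakNorm l r a * peakNorm l r b := by
        rw [ENNReal.tsum_prod']
        simp only [ENNReal.tsum_mul_left, ENNReal.tsum_mul_right]
        rw [peakNorm, peakNorm, ENNReal.tsum_prod', ENNReal.tsum_prod']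

lemma laurentNorm_eq (l : ℝ≥0) {r : ℝ≥0} (hr : 0 < r) (a : LaurentSpace q) :
    laurentNorm q l r a.coeff =
      ∑' p : ℕ × ℤ, ‖a.coeff p.1 p.2‖ₑ * minWeight q Word.innerPeak l r p.1 p.2 :=
  laurentNorm_eq_tsum hq.out.le l hr _

lemma peakNorm_le_laurentNorm (l : ℝ≥0) {r : ℝ≥0} (hr : 0 < r) (a : LaurentSpace q) :
    peakNorm l r a ≤ laurentNorm q l r a.coeff := by
  rw [laurentNorm_eq l hr]
  refine ENNReal.tsum_le_tsum fun p => mul_le_mul_right (iInf_mono fun w => ?_) _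
  rw [ENNReal.coe_le_coe]
  unfold wordWeight
  have := zpow_le_zpow_right₀ hq.out.le (neg_le_neg (Word.innerPeak_le_peak w))
  gcongr

/-- The two heights differ by at most one, which costs a factor |q|^m, absorbed by the radius l.
With the previous bound, both families define the same topology. -/
lemma laurentNorm_le_peakNorm (l : ℝ≥0) {r : ℝ≥0} (hr : 0 < r) (a : LaurentSpace q) :
    laurentNorm q l r a.coeff ≤ peakNorm (l * ‖(q : ℂ)‖₊) r a := by
  rw [laurentNorm_eq l hr]
  refine ENNReal.tsum_le_tsum fun p => mul_le_mul_right (iInf_mono fun w => ?_) _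
  rw [ENNReal.coe_le_coe]
  unfold wordWeight
  have h := zpow_le_zpow_right₀ hq.out.le
    (show -Word.innerPeak w ≤ 1 + -Word.peak w by
      have := Word.peak_le_innerPeak_add_one w
      omega)
  rw [zpow_add₀ (zero_lt_one.trans hq.out).ne', zpow_one] at h
  rw [mul_assoc l]
  gcongr

lemma peakNorm_lt_top {l r : ℝ≥0} (hl : 0 < l) (hr : 0 < r) (a : LaurentSpace q) :
    peakNorm l r a < ∞ :=
  (peakNorm_le_laurentNorm l hr a).trans_lt (a.laurentNorm_lt_top hl hr)

variable (q) in
/-- The norms `peakNorm` as seminorms. -/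
noncomputable def peakSeminorm (lr : {l : ℝ≥0 // 0 < l} × {r : ℝ≥0 // 0 < r}) :
    Seminorm ℂ (LaurentSpace q) :=
  Seminorm.of (fun a => (peakNorm lr.1 lr.2 a).toReal)
    (fun a b => by
      have ha := peakNorm_lt_top lr.1.2 lr.2.2 a
      have hb := peakNorm_lt_top lr.1.2 lr.2.2 b
      rw [← ENNReal.toReal_add ha.ne hb.ne]
      refine ENNReal.toReal_mono (ENNReal.add_lt_top.2 ⟨ha, hb⟩).ne ?_
      unfold peakNorm
      rw [← ENNReal.tsum_add]
      refine ENNReal.tsum_le_tsum fun p => ?_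
      rw [← add_mul]
      gcongr
      exact enorm_add_le _ _)
    (fun c a => by
      have : peakNorm lr.1 lr.2 (c • a) = ‖c‖ₑ * peakNorm lr.1 lr.2 a := by
        unfold peakNorm
        rw [← ENNReal.tsum_mul_left]
        refine tsum_congr fun p => ?_
        rw [← mul_assoc, ← enorm_mul]
        rfl
      rw [this, ENNReal.toReal_mul, toReal_enorm])

lemma withSeminorms_peak : WithSeminorms (peakSeminorm q) := by
  refine (withSeminorms q).congr (fun i => ⟨{i}, 1, fun a => ?_⟩)
    (fun i => ⟨{(⟨i.1 * ‖(q : ℂ)‖₊, mul_pos i.1.2 (zero_lt_one.trans hq.out)⟩, i.2)}, 1,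
      fun a => ?_⟩)
  · rw [Finset.sup_singleton, one_smul]
    exact ENNReal.toReal_mono (a.laurentNorm_lt_top i.1.2 i.2.2).ne
      (peakNorm_le_laurentNorm _ i.2.2 a)
  · rw [Finset.sup_singleton, one_smul]
    exact ENNReal.toReal_mono
      (peakNorm_lt_top (mul_pos i.1.2 (zero_lt_one.trans hq.out)) i.2.2 a).ne
      (laurentNorm_le_peakNorm _ i.2.2 a)

lemma peakSeminorm_mul_le (i : {l : ℝ≥0 // 0 < l} × {r : ℝ≥0 // 0 < r}) (a b : LaurentSpace q) :
    peakSeminorm q i (a * b) ≤ peakSeminorm q i a * peakSeminorm q i b := by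
  change (peakNorm _ _ _).toReal ≤ (peakNorm _ _ _).toReal * (peakNorm _ _ _).toReal
  rw [← ENNReal.toReal_mul]
  exact ENNReal.toReal_mono (ENNReal.mul_lt_top (peakNorm_lt_top i.1.2 i.2.2 a)
    (peakNorm_lt_top i.1.2 i.2.2 b)).ne (peakNorm_mul_le _ _ a b)

/-! ### Completeness -/

omit hq in
lemma seminorm_apply (lr : {l : ℝ≥0 // 0 < l} × {r : ℝ≥0 // 0 < r}) (a : LaurentSpace q) :
    seminorm q lr a = (laurentNorm q lr.1 lr.2 a.coeff).toReal := rfl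

/-- The choice r = |q|^m puts the index in the range |q|^m ≤ r, where the weight is positive. For r²
< |q|^m the seminorm would not see the coefficient at all. -/
lemma exists_norm_coeff_le (m : ℕ) (n : ℤ) : ∃ (i : {l : ℝ≥0 // 0 < l} × {r : ℝ≥0 // 0 < r})
    (C : ℝ), ∀ a : LaurentSpace q, ‖a.coeff m n‖ ≤ C * seminorm q i a := by
  have hq0 : 0 < ‖(q : ℂ)‖₊ := zero_lt_one.trans hq.out
  set r : ℝ≥0 := ‖(q : ℂ)‖₊ ^ m with hr
  have hr0 : 0 < r := pow_pos hq0 m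
  have hw := minWeight_innerPeak_of_pow_le hq.out.le 1 hr0 (m := m) (n := n) le_rfl
  set W : ℝ≥0 := 1 ^ m * ‖(q : ℂ)‖₊ ^ (-(m * max (n - 1) 0) : ℤ) * r ^ |n| with hW
  have hW0 : 0 < W := by positivity
  refine ⟨(⟨1, one_pos⟩, ⟨r, hr0⟩), (W : ℝ)⁻¹, fun a => ?_⟩
  have h1 : ‖a.coeff m n‖ₑ * (W : ℝ≥0∞) ≤ laurentNorm q 1 r a.coeff := by
    rw [laurentNorm_eq 1 hr0, ← hw]
    exact ENNReal.le_tsum (f := fun p : ℕ × ℤ => ‖a.coeff p.1 p.2‖ₑ *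
      minWeight q Word.innerPeak 1 r p.1 p.2) (m, n)
  have h2 := ENNReal.toReal_mono (a.laurentNorm_lt_top one_pos hr0).ne h1
  rw [ENNReal.toReal_mul, toReal_enorm, ENNReal.coe_toReal] at h2
  rw [seminorm_apply, inv_mul_eq_div, le_div_iff₀ (by exact_mod_cast hW0)]
  exact h2

variable (q) in
/-- The coefficient functionals. -/
noncomputable def coeffL (m : ℕ) (n : ℤ) : LaurentSpace q →L[ℂ] ℂ where
  toFun a := a.coeff m n
  map_add' _ _ := rfl
  map_smul' _ _ := rfl
  cont := (withSeminorms q).continuous_of_le (norm_withSeminorms ℂ ℂ)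
    (⟨⟨fun a => a.coeff m n, fun _ _ => rfl⟩, fun _ _ => rfl⟩ : LaurentSpace q →ₗ[ℂ] ℂ)
    fun _ => exists_norm_coeff_le m n

lemma coeffL_apply (m : ℕ) (n : ℤ) (a : LaurentSpace q) : coeffL q m n a = a.coeff m n := rfl

instance : T2Space (LaurentSpace q) := by
  have : T1Space (LaurentSpace q) := (withSeminorms q).T1_of_separating fun a ha => by
    by_contra! h
    refine ha (ext_coeff fun m n => ?_)
    obtain ⟨i, C, hC⟩ := exists_norm_coeff_le (q := q) m n
    have := hC a
    rw [h, mul_zero] at this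
    exact norm_le_zero_iff.1 this
  infer_instance

/-- As for ℓ¹: coefficients converge, the Cauchy bound passes to the limit in every finite partial
sum, and then to the supremum of these sums. -/
instance : CompleteSpace (LaurentSpace q) := by
  refine ⟨fun {F} hF => ?_⟩
  have := hF.1
  have hlim : ∀ (m : ℕ) (n : ℤ), ∃ c, Filter.Tendsto (fun x : LaurentSpace q => x.coeff m n) F
      (𝓝 c) := fun m n =>
    CompleteSpace.complete (hF.map (coeffL q m n).uniformContinuous)
  choose a ha using hlim
  have hcauchy : ∀ (i : {l : ℝ≥0 // 0 < l} × {r : ℝ≥0 // 0 < r}) (ε : ℝ≥0), 0 < ε →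
      ∀ᶠ x : LaurentSpace q in F, laurentNorm q i.1 i.2 (x.coeff - a) ≤ ε := by
    intro i ε hε
    have hU : {x : LaurentSpace q × LaurentSpace q | seminorm q i (x.2 - x.1) < ε} ∈
        uniformity (LaurentSpace q) := by
      rw [uniformity_eq_comap_nhds_zero]
      refine Filter.mem_comap.2 ⟨{x | seminorm q i x < ε}, ?_, fun x hx => hx⟩
      have hc := (withSeminorms q).continuous_seminorm i
      exact hc.continuousAt.eventually_lt_const (by simpa using hε)
    obtain ⟨t, ht, htU⟩ := (cauchy_iff.1 hF).2 _ hU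
    filter_upwards [ht] with x hx
    rw [laurentNorm_eq_tsum hq.out.le _ i.2.2]
    rw [ENNReal.tsum_eq_iSup_sum]
    refine iSup_le fun s => ?_
    have hten : Filter.Tendsto (fun y : LaurentSpace q => ∑ p ∈ s,
        ‖(x - y).coeff p.1 p.2‖ₑ * minWeight q Word.innerPeak i.1 i.2 p.1 p.2) F
        (𝓝 (∑ p ∈ s, ‖(x.coeff - a) p.1 p.2‖ₑ *
          minWeight q Word.innerPeak i.1 i.2 p.1 p.2)) := by
      refine tendsto_finsetSum _ fun p _ => ?_
      refine ENNReal.Tendsto.mul_const ?_ (Or.inr (minWeight_ne_top _ _ _ _ _ _))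
      exact (tendsto_const_nhds.sub (ha p.1 p.2)).enorm
    refine le_of_tendsto hten ?_
    filter_upwards [ht] with y hy
    refine (ENNReal.sum_le_tsum s).trans ?_
    rw [← laurentNorm_eq _ i.2.2]
    have h := htU (Set.mk_mem_prod hy hx)
    have h' : seminorm q i (x - y) < ε := h
    rw [seminorm_apply] at h'
    rw [← ENNReal.toReal_le_toReal ((x - y).laurentNorm_lt_top i.1.2 i.2.2).ne
      ENNReal.coe_ne_top]
    exact h'.le
  have hmem : ∀ l r : ℝ≥0, 0 < l → 0 < r → laurentNorm q l r a < ∞ := by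
    intro l r hl hr
    obtain ⟨x, hx⟩ := (hcauchy (⟨l, hl⟩, ⟨r, hr⟩) 1 one_pos).exists
    have e : a = x.coeff + (-1 : ℂ) • (x.coeff - a) := by
      rw [neg_one_smul]; abel
    rw [e]
    refine (laurentNorm_add_le _ _ _ _ _).trans_lt (ENNReal.add_lt_top.2
      ⟨x.laurentNorm_lt_top hl hr, ?_⟩)
    rw [laurentNorm_smul]
    exact ENNReal.mul_lt_top enorm_lt_top (hx.trans_lt ENNReal.coe_lt_top)
  refine ⟨⟨a, hmem⟩, ?_⟩
  change Filter.Tendsto id F _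
  refine ((withSeminorms q).tendsto_nhds _ _).2 fun i ε hε => ?_
  filter_upwards [hcauchy i (ε / 2).toNNReal (Real.toNNReal_pos.2 (half_pos hε))] with x hx
  have h := ENNReal.toReal_mono ENNReal.coe_ne_top hx
  rw [ENNReal.coe_toReal, Real.coe_toNNReal _ (half_pos hε).le] at h
  exact lt_of_le_of_lt h (half_lt_self hε)

instance : ArensMichaelAlgebra (LaurentSpace q) :=
  .of_family withSeminorms_peak peakSeminorm_mul_le

instance : ContinuousMul (LaurentSpace q) := ArensMichaelAlgebra.continuousMul _

end LaurentSpace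

/-! ### Absolutely summable families -/

section

variable {B ι κ : Type*} [AddCommGroup B] [Module ℂ B] [UniformSpace B] [IsUniformAddGroup B]
  {p : SeminormFamily ℂ B ι}

lemma WithSeminorms.summable_of_summable [CompleteSpace B] (hp : WithSeminorms p) {u : κ → B}
    (h : ∀ i, Summable fun k => p i (u k)) : Summable u := by
  classical
  refine summable_iff_vanishing.2 fun e he => ?_
  obtain ⟨s, r, hr, hs⟩ := (hp.mem_nhds_iff 0 e).1 he
  have h1 : ∀ i, ∃ S : Finset κ, ∀ t : Finset κ, Disjoint t S → ∑ k ∈ t, p i (u k) < r := by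
    intro i
    obtain ⟨S, hS⟩ := summable_iff_vanishing_norm.1 (h i) r hr
    exact ⟨S, fun t ht => (le_abs_self _).trans_lt (hS t ht)⟩
  choose S hS using h1
  refine ⟨s.biUnion S, fun t ht => hs ?_⟩
  rw [Seminorm.mem_ball, sub_zero]
  refine Seminorm.finset_sup_apply_lt hr fun i hi => ?_
  refine lt_of_le_of_lt ?_ (hS i t (ht.mono_right (Finset.subset_biUnion_of_mem S hi)))
  exact Finset.le_sum_of_subadditive (p i) (map_zero _).le (map_add_le_add _) _ _

omit [IsUniformAddGroup B] in
lemma WithSeminorms.le_tsum_of_hasSum (hp : WithSeminorms p) {u : κ → B} {b : B} (hu : HasSum u b)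
    (i : ι) (h : Summable fun k => p i (u k)) : p i b ≤ ∑' k, p i (u k) := by
  refine le_of_tendsto (((hp.continuous_seminorm i).tendsto b).comp hu)
    (Filter.Eventually.of_forall fun s => ?_)
  exact (Finset.le_sum_of_subadditive (p i) (map_zero _).le (map_add_le_add _) _ _).trans
    (h.sum_le_tsum s fun _ _ => apply_nonneg _ _)

end

/-! ### Compatible triples -/

namespace LaurentTriple

section

variable {A : Type*} [Ring A] [Algebra ℂ A] [TopologicalSpace A] {α : A ≃ₐ[ℂ] A}
  {B : Type*} [Ring B] [Algebra ℂ B] [TopologicalSpace B] (s : LaurentTriple α B)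

lemma μ_one_mul_ν_one : s.μ 1 * s.ν 1 = 1 := by simp [s.compat₁]

lemma ν_one_mul_μ_one : s.ν 1 * s.μ 1 = 1 := by simp [s.compat₂]

lemma μ_eq (a : A) : s.μ a = s.θ a * s.μ 1 := by rw [← s.μ_left, mul_one]

lemma ν_eq (a : A) : s.ν a = s.θ a * s.ν 1 := by rw [← s.ν_left, mul_one]

/-- The invertible element `μ(1)`, with inverse `ν(1)`. -/
def unit : Bˣ := ⟨s.μ 1, s.ν 1, s.μ_one_mul_ν_one, s.ν_one_mul_μ_one⟩

@[simp] lemma val_unit : (s.unit : B) = s.μ 1 := rfl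

@[simp] lemma val_inv_unit : ((s.unit⁻¹ : Bˣ) : B) = s.ν 1 := rfl

lemma μ_one_mul_θ (a : A) : s.μ 1 * s.θ a = s.θ (α a) * s.μ 1 := by
  rw [← s.μ_right, one_mul, μ_eq]

lemma ν_one_mul_θ (a : A) : s.ν 1 * s.θ a = s.θ (α.symm a) * s.ν 1 := by
  rw [← s.ν_right, one_mul, ν_eq]

lemma unit_zpow_mul_θ (n : ℤ) (a : A) :
    (s.unit ^ n : Bˣ) * s.θ a = s.θ ((α ^ n) a) * (s.unit ^ n : Bˣ) := by
  induction n generalizing a with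
  | zero => simp
  | succ n ih =>
    rw [zpow_add_one, zpow_add_one, Units.val_mul, mul_assoc, val_unit, μ_one_mul_θ, ← mul_assoc,
      ih, mul_assoc]
    rfl
  | pred n ih =>
    rw [zpow_sub_one, zpow_sub_one, Units.val_mul, mul_assoc, val_inv_unit, ν_one_mul_θ,
      ← mul_assoc, ih, mul_assoc]
    rfl

/-- The image of a triple under a continuous homomorphism. -/
def map {B' : Type*} [Ring B'] [Algebra ℂ B'] [TopologicalSpace B'] (g : B →A[ℂ] B') :
    LaurentTriple α B' where
  θ := g.comp s.θ
  μ := (⟨g.toAlgHom.toLinearMap, g.cont⟩ : B →L[ℂ] B').comp s.μ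
  ν := (⟨g.toAlgHom.toLinearMap, g.cont⟩ : B →L[ℂ] B').comp s.ν
  μ_left a x := (congrArg g (s.μ_left a x)).trans (map_mul g _ _)
  μ_right x a := (congrArg g (s.μ_right x a)).trans (map_mul g _ _)
  ν_left a x := (congrArg g (s.ν_left a x)).trans (map_mul g _ _)
  ν_right x a := (congrArg g (s.ν_right x a)).trans (map_mul g _ _)
  compat₁ x y := (map_mul g _ _).symm.trans (congrArg g (s.compat₁ x y))
  compat₂ x y := (map_mul g _ _).symm.trans (congrArg g (s.compat₂ x y))

end

/-! ### Monomials of a compatible triple and their universal bound -/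

section

variable {q : ℂˣ} {B : Type*} [Ring B] [Algebra ℂ B] [TopologicalSpace B]
  (s : LaurentTriple (dilation q) B)

/-- The image `θ(z^m) μ(1)^n` of the monomial `z^m x^n`. -/
noncomputable def term (m : ℕ) (n : ℤ) : B := s.θ (Entire.Z ^ m) * (s.unit ^ n : Bˣ)

lemma dilation_zpow_Z_pow (n : ℤ) (m : ℕ) :
    (dilation q ^ n) (Entire.Z ^ m) = (q : ℂ) ^ (n * m) • Entire.Z ^ m := by
  have h1 : (dilation q ^ n) Entire.Z = (q : ℂ) ^ n • Entire.Z := by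
    induction n with
    | zero => simp
    | succ n ih =>
      rw [zpow_add_one, AlgEquiv.mul_apply, Entire.dilation_Z, map_smul, ih, smul_smul,
        zpow_add_one₀ q.ne_zero, mul_comm]
    | pred n ih =>
      have h : (dilation q).symm Entire.Z = (q : ℂ)⁻¹ • Entire.Z := by
        rw [AlgEquiv.symm_apply_eq, map_smul, Entire.dilation_Z, smul_smul,
          inv_mul_cancel₀ q.ne_zero, one_smul]
      have h' : (dilation q ^ (-(n : ℤ) - 1)) Entire.Z =
          (dilation q ^ (-(n : ℤ))) ((dilation q).symm Entire.Z) := by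
        rw [zpow_sub_one, AlgEquiv.mul_apply]
        rfl
      rw [h', h, map_smul, ih, smul_smul, zpow_sub_one₀ q.ne_zero, mul_comm]
  rw [map_pow, h1, smul_pow, zpow_mul, zpow_natCast]

lemma term_mul_term (m i : ℕ) (n j : ℤ) :
    s.term m n * s.term i j = (q : ℂ) ^ (n * i) • s.term (m + i) (n + j) := by
  unfold term
  rw [mul_assoc, ← mul_assoc (_ : B) (s.θ _), unit_zpow_mul_θ, dilation_zpow_Z_pow, map_smul,
    smul_mul_assoc, smul_mul_assoc, mul_smul_comm, mul_assoc (s.θ _), ← Units.val_mul,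
    ← zpow_add, ← mul_assoc, ← map_mul, ← pow_add]

lemma term_zero_zero : s.term 0 0 = 1 := by simp [term]

lemma term_zero (m : ℕ) : s.term m 0 = s.θ (Entire.Z ^ m) := by simp [term]

lemma term_zero_one : s.term 0 1 = s.μ 1 := by simp [term]

lemma term_zero_neg_one : s.term 0 (-1) = s.ν 1 := by simp [term]

variable {s} in
-- Negative powers come for free, since ν(1) is the inverse of μ(1).
lemma _root_.ContinuousAlgHom.map_term {B' : Type*} [Ring B'] [Algebra ℂ B'] [TopologicalSpace B']
    {s' : LaurentTriple (dilation q) B'} (f : B →A[ℂ] B') (hθ : ∀ a, f (s.θ a) = s'.θ a)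
    (hμ : f (s.μ 1) = s'.μ 1) (m : ℕ) (n : ℤ) : f (s.term m n) = s'.term m n := by
  unfold term
  have h : Units.map (f : B →* B') s.unit = s'.unit := Units.ext hμ
  rw [map_mul, hθ, ← h, ← map_zpow]
  rfl

omit [TopologicalSpace B] in
lemma le_pow {p : Seminorm ℂ B} (hp : ∀ a b, p (a * b) ≤ p a * p b) (b : B) (m : ℕ) :
    p (b ^ m) ≤ p 1 * p b ^ m := by
  induction m with
  | zero => simp
  | succ m ih =>
    rw [pow_succ, pow_succ, ← mul_assoc]
    exact (hp _ _).trans (mul_le_mul_of_nonneg_right ih (apply_nonneg _ _))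

/-- The word spells the power out as a product of |w| factors μ(1) or ν(1), with cancellations left
undone. -/
lemma le_unit_zpow_c {p : Seminorm ℂ B} (hp : ∀ a b, p (a * b) ≤ p a * p b) {R : ℝ}
    (hμ : p (s.μ 1) ≤ R) (hν : p (s.ν 1) ≤ R) (w : Word) :
    p (s.unit ^ w.c : Bˣ) ≤ p 1 * R ^ w.length := by
  have hR : 0 ≤ R := (apply_nonneg _ _).trans hμ
  induction w with
  | nil => simp
  | cons a w ih =>
    rw [Word.c_cons, zpow_add, Units.val_mul, List.length_cons, pow_succ, ← mul_assoc,
      mul_comm (_ * _) R]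
    refine (hp _ _).trans (mul_le_mul ?_ ih (apply_nonneg _ _) hR)
    rcases Word.letterSign_eq a with h | h
    · rw [h, zpow_one]; exact hμ
    · rw [h, zpow_neg_one]; exact hν

/-- Split w at a highest prefix, of height h. Then θ(z)^m μ(1)^n = q^{-hm} μ(1)^h θ(z)^m μ(1)^{n-h}
with n = c(w); the outer powers cost at most R^{|w|} together, and the scalar supplies |q|^{-hm}.
Each of the three factors brings one p(1), which need not be 1. -/
lemma le_term {p : Seminorm ℂ B} (hp : ∀ a b, p (a * b) ≤ p a * p b) {L R : ℝ≥0}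
    (hL : p (s.θ Entire.Z) ≤ L) (hμ : p (s.μ 1) ≤ R) (hν : p (s.ν 1) ≤ R) (m : ℕ) (w : Word) :
    p (s.term m w.c) ≤ p 1 ^ 3 * wordWeight q Word.peak L R m w := by
  obtain ⟨i, -, hi⟩ := Word.exists_p_eq_peak w
  have hq0 := q.ne_zero
  have hc : w.c = w.p i + Word.c (w.drop i) := by
    unfold Word.p; rw [← Word.c_append, List.take_append_drop]
  have e1 : s.term m w.c = (q : ℂ) ^ (-(w.p i * m)) • ((s.unit ^ w.p i : Bˣ) *
      (s.θ Entire.Z ^ m * (s.unit ^ Word.c (w.drop i) : Bˣ))) := by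
    rw [← mul_assoc, ← map_pow, unit_zpow_mul_θ, dilation_zpow_Z_pow, map_smul, smul_mul_assoc,
      smul_mul_assoc, smul_smul, ← zpow_add₀ hq0, neg_add_cancel, zpow_zero, one_smul, mul_assoc,
      ← Units.val_mul, ← zpow_add, ← hc]
    rfl
  have h1 := s.le_unit_zpow_c hp hμ hν (w.take i)
  have h2 := s.le_unit_zpow_c hp hμ hν (w.drop i)
  have h3 : p (s.θ Entire.Z ^ m) ≤ p 1 * (L : ℝ) ^ m := (le_pow hp _ m).trans (by gcongr)
  have h1' : p (s.unit ^ w.p i : Bˣ) ≤ p 1 * (R : ℝ) ^ (w.take i).length := h1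
  have hlen : w.length = (w.take i).length + (w.drop i).length := by
    rw [← List.length_append, List.take_append_drop]
  have h0 : 0 ≤ p 1 := apply_nonneg _ _
  rw [e1, map_smul_eq_mul, norm_zpow]
  calc _ ≤ ‖(q : ℂ)‖ ^ (-(w.p i * m)) * ((p 1 * (R : ℝ) ^ (w.take i).length) *
        ((p 1 * (L : ℝ) ^ m) * (p 1 * (R : ℝ) ^ (w.drop i).length))) := by
        refine mul_le_mul_of_nonneg_left ?_ (by positivity)
        refine (hp _ _).trans (mul_le_mul h1' ((hp _ _).trans (mul_le_mul h3 h2 ?_ ?_)) ?_ ?_)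
        all_goals first | exact apply_nonneg _ _ | positivity
    _ = _ := by
        rw [wordWeight, hlen, ← hi, neg_mul_eq_neg_mul, zpow_mul, zpow_natCast]
        push_cast
        ring

end

end LaurentTriple

namespace LaurentSpace

variable {q : ℂˣ} [hq : Fact (1 < ‖(q : ℂ)‖₊)]

/-! ### The triple of the space of Laurent series -/

lemma toLaurent_single_mul_single (v w : Word) (a b : Entire) :
    ConvSeries.toLaurent q (ConvSeries.single q v a) *
        ConvSeries.toLaurent q (ConvSeries.single q w b) =
      ConvSeries.toLaurent q (ConvSeries.single q (v ++ w) (a * (dilation q ^ v.c) b)) := by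
  rw [← toLaurent_mul, ConvSeries.single_mul_single]

lemma toLaurent_single_congr {v w : Word} (h : v.c = w.c) (a : Entire) :
    ConvSeries.toLaurent q (ConvSeries.single q v a) =
      ConvSeries.toLaurent q (ConvSeries.single q w a) :=
  ext_coeff fun m n => by
    rw [ConvSeries.coeff_toLaurent, ConvSeries.coeff_toLaurent, ConvSeries.φ_single,
      ConvSeries.φ_single, h]

lemma single_add (w : Word) (a b : Entire) :
    ConvSeries.single q w (a + b) = ConvSeries.single q w a + ConvSeries.single q w b :=
  ConvSeries.ext_coeff fun u => by
    change _ = (ConvSeries.single q w a).toSeries.coeff u +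
      (ConvSeries.single q w b).toSeries.coeff u
    simp only [ConvSeries.coeff_single]
    split_ifs <;> simp

lemma single_smul (w : Word) (c : ℂ) (a : Entire) :
    ConvSeries.single q w (c • a) = c • ConvSeries.single q w a :=
  ConvSeries.ext_coeff fun u => by
    change _ = c • (ConvSeries.single q w a).toSeries.coeff u
    simp only [ConvSeries.coeff_single]
    split_ifs <;> simp

variable (q) in
/-- The embedding of the algebra of entire functions, as a linear map. -/
noncomputable def θₗ : Entire →ₗ[ℂ] LaurentSpace q where
  toFun a := ConvSeries.toLaurent q (ConvSeries.single q [] a)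
  map_add' a b := by rw [single_add, map_add]
  map_smul' c a := by rw [single_smul, map_smul]; rfl

lemma seminorm_θₗ_le (i : {l : ℝ≥0 // 0 < l} × {r : ℝ≥0 // 0 < r}) (a : Entire) :
    seminorm q i (θₗ q a) ≤ (entireNorm i.1 a).toReal := by
  refine ENNReal.toReal_mono (a.entireNorm_lt_top _).ne ?_
  refine (ConvSeries.laurentNorm_φ_le i.2.2 (ConvSeries.single q [] a)).trans (le_of_eq ?_)
  rw [convNorm, tsum_eq_single []]
  · simp [ConvSeries.coeff_single, wordNorm_nil]
  · intro w hw
    simp [ConvSeries.coeff_single, hw, wordNorm_zero (entireNorm_zero i.1)]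

lemma continuous_θₗ : Continuous (θₗ q) := by
  refine continuous_of_continuousAt_zero (θₗ q) ?_
  refine ((withSeminorms q).tendsto_nhds _ _).2 fun i ε hε => ?_
  have h : 0 < (ε / 2).toNNReal := Real.toNNReal_pos.2 (half_pos hε)
  filter_upwards [Entire.eventually_entireNorm_le i.1.2 h] with a ha
  rw [map_zero, sub_zero]
  have h1 := ENNReal.toReal_mono ENNReal.coe_ne_top ha
  rw [ENNReal.coe_toReal, Real.coe_toNNReal _ (half_pos hε).le] at h1
  exact ((seminorm_θₗ_le i a).trans h1).trans_lt (half_lt_self hε)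

variable (q) in
/-- The embedding of the algebra of entire functions. -/
noncomputable def θ : Entire →A[ℂ] LaurentSpace q where
  toAlgHom := AlgHom.ofLinearMap (θₗ q) rfl fun a b => by
    change ConvSeries.toLaurent q _ = ConvSeries.toLaurent q _ * ConvSeries.toLaurent q _
    rw [toLaurent_single_mul_single]
    simp
  cont := continuous_θₗ

lemma θ_apply (a : Entire) : θ q a = ConvSeries.toLaurent q (ConvSeries.single q [] a) := rfl

variable (q) in
/-- The image of the letter `s`. -/
noncomputable def letter (s : Fin 2) : LaurentSpace q :=
  ConvSeries.toLaurent q (ConvSeries.single q [s] 1)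

lemma letter_mul_letter {s t : Fin 2} (h : letterSign s + letterSign t = 0) :
    letter q s * letter q t = 1 := by
  rw [letter, letter, toLaurent_single_mul_single, ← toLaurent_one, ← ConvSeries.single_one,
    map_one, mul_one]
  exact toLaurent_single_congr (by simp [h]) 1

lemma letter_mul_θ (s : Fin 2) (a : Entire) :
    letter q s * θ q a = θ q ((dilation q ^ letterSign s) a) * letter q s := by
  rw [letter, θ_apply, θ_apply, toLaurent_single_mul_single, toLaurent_single_mul_single]
  simp

variable (q) in
/-- The map `a ↦ θ(a) x_s` for a letter `s`. -/
noncomputable def mulLetter (s : Fin 2) : Entire →L[ℂ] LaurentSpace q where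
  toLinearMap := (LinearMap.mulRight ℂ (letter q s)).comp (θₗ q)
  cont := continuous_θₗ.mul continuous_const

lemma mulLetter_apply (s : Fin 2) (a : Entire) : mulLetter q s a = θ q a * letter q s := rfl

lemma mulLetter_mul_left (s : Fin 2) (a x : Entire) :
    mulLetter q s (a * x) = θ q a * mulLetter q s x := by
  rw [mulLetter_apply, mulLetter_apply, map_mul, mul_assoc]

lemma mulLetter_mul_right (s : Fin 2) (x a : Entire) :
    mulLetter q s (x * (dilation q ^ letterSign s) a) = mulLetter q s x * θ q a := by
  rw [mulLetter_apply, mulLetter_apply, map_mul, mul_assoc, mul_assoc, letter_mul_θ]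

lemma mulLetter_mul_mulLetter {s t : Fin 2} (h : letterSign s + letterSign t = 0)
    (x y : Entire) :
    mulLetter q s x * mulLetter q t y = θ q (x * (dilation q ^ letterSign s) y) := by
  rw [mulLetter_apply t, ← mul_assoc, ← mulLetter_mul_right, mulLetter_apply, mul_assoc,
    letter_mul_letter h, mul_one]

omit hq in
lemma dilation_zpow_letterSign_zero : dilation q ^ letterSign 0 = dilation q := by
  simp [letterSign]

omit hq in
lemma dilation_zpow_letterSign_one : dilation q ^ letterSign 1 = (dilation q).symm := by
  simp only [letterSign]
  exact zpow_neg_one _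

variable (q) in
/-- The compatible triple of the algebra of Laurent series. -/
noncomputable def triple : LaurentTriple (dilation q) (LaurentSpace q) where
  θ := θ q
  μ := mulLetter q 0
  ν := mulLetter q 1
  μ_left := mulLetter_mul_left 0
  μ_right x a := by
    have := mulLetter_mul_right (q := q) 0 x a
    rwa [dilation_zpow_letterSign_zero] at this
  ν_left := mulLetter_mul_left 1
  ν_right x a := by
    have := mulLetter_mul_right (q := q) 1 x a
    rwa [dilation_zpow_letterSign_one] at this
  compat₁ x y := by
    have := mulLetter_mul_mulLetter (q := q) (s := 0) (t := 1) (by simp [letterSign]) x y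
    rwa [dilation_zpow_letterSign_zero] at this
  compat₂ x y := by
    have := mulLetter_mul_mulLetter (q := q) (s := 1) (t := 0) (by simp [letterSign]) x y
    rwa [dilation_zpow_letterSign_one] at this

lemma letter_eq_unit_zpow (s : Fin 2) :
    letter q s = ((triple q).unit ^ letterSign s : (LaurentSpace q)ˣ) := by
  have h : ∀ t : Fin 2, mulLetter q t 1 = letter q t := fun t => by
    rw [mulLetter_apply, map_one, one_mul]
  fin_cases s
  · simp only [letterSign]
    exact (h 0).symm.trans (congrArg Units.val (zpow_one (triple q).unit)).symm
  · simp only [letterSign]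
    exact (h 1).symm.trans (congrArg Units.val (zpow_neg_one (triple q).unit)).symm

lemma toLaurent_mono (w : Word) : ConvSeries.toLaurent q (ConvSeries.single q w 1) =
    ((triple q).unit ^ w.c : (LaurentSpace q)ˣ) := by
  induction w with
  | nil => rw [ConvSeries.single_one, toLaurent_one]; simp
  | cons s w ih =>
    rw [Word.c_cons, zpow_add, Units.val_mul, ← ih, ← letter_eq_unit_zpow, letter,
      toLaurent_single_mul_single]
    simp

lemma coeff_θ_mul_unit_zpow (a : Entire) (k : ℤ) (m : ℕ) (n : ℤ) :
    (θ q a * ((triple q).unit ^ k : (LaurentSpace q)ˣ)).coeff m n =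
      if n = k then taylorCoeff a m else 0 := by
  obtain ⟨w, rfl⟩ := exists_c_eq k
  rw [← toLaurent_mono, θ_apply, toLaurent_single_mul_single, ConvSeries.coeff_toLaurent,
    ConvSeries.φ_single]
  simp

lemma coeff_term (k : ℕ) (j : ℤ) (m : ℕ) (n : ℤ) :
    ((triple q).term k j).coeff m n = if (m, n) = (k, j) then 1 else 0 := by
  refine (coeff_θ_mul_unit_zpow _ _ _ _).trans ?_
  rw [Entire.taylorCoeff_Z_pow]
  by_cases h1 : n = j <;> by_cases h2 : m = k <;> simp [h1, h2]

/-- The seminorm of the remainder of a partial sum is the tail of the convergent series for the norm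
of a. So the monomials span a dense subspace. -/
lemma hasSum_term (a : LaurentSpace q) :
    HasSum (fun p : ℕ × ℤ => a.coeff p.1 p.2 • (triple q).term p.1 p.2) a := by
  classical
  refine ((withSeminorms q).tendsto_nhds _ _).2 fun i ε hε => ?_
  set T : ℕ × ℤ → ℝ≥0∞ := fun p => ‖a.coeff p.1 p.2‖ₑ *
    minWeight q Word.innerPeak i.1 i.2 p.1 p.2 with hT
  have h1 : ∑' p, T p ≠ ∞ := by
    rw [← laurentNorm_eq _ i.2.2]
    exact (a.laurentNorm_lt_top i.1.2 i.2.2).ne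
  filter_upwards [(ENNReal.tendsto_tsum_compl_atTop_zero h1).eventually_lt_const
    (ENNReal.ofReal_pos.2 hε)] with s hs
  have hc : ∀ m n, (∑ p ∈ s, a.coeff p.1 p.2 • (triple q).term p.1 p.2 - a).coeff m n =
      if (m, n) ∈ s then 0 else -a.coeff m n := by
    intro m n
    rw [← coeffL_apply, map_sub, map_sum]
    simp only [map_smul, coeffL_apply, coeff_term, smul_eq_mul, mul_ite, mul_one, mul_zero]
    rw [Finset.sum_ite_eq s (m, n) fun p => a.coeff p.1 p.2]
    split_ifs <;> simp
  have h2 : laurentNorm q i.1 i.2 (∑ p ∈ s, a.coeff p.1 p.2 • (triple q).term p.1 p.2 - a).coeff =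
      ∑' p : {p // p ∉ s}, T p := by
    refine Eq.trans ?_ (tsum_subtype {p | p ∉ s} T).symm
    rw [laurentNorm_eq _ i.2.2]
    refine tsum_congr fun p => ?_
    rw [hc]
    by_cases hp : p ∈ s
    · rw [Set.indicator_of_notMem (by simpa using hp)]
      simp [hp]
    · rw [Set.indicator_of_mem (by simpa using hp)]
      simp [hp, hT]
  rw [seminorm_apply, h2]
  exact (ENNReal.lt_ofReal_iff_toReal_lt (ne_top_of_lt hs)).1 hs

lemma continuousLinearMap_ext {B : Type*} [AddCommGroup B] [Module ℂ B] [TopologicalSpace B]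
    [T2Space B] {f g : LaurentSpace q →L[ℂ] B}
    (h : ∀ m n, f ((triple q).term m n) = g ((triple q).term m n)) : f = g := by
  ext a
  have h1 := (hasSum_term a).mapL f
  have h2 := (hasSum_term a).mapL g
  simp only [map_smul, h] at h1 h2
  exact h1.unique h2

/-! ### The universal property -/

section Lift

variable {B : Type*} [Ring B] [Algebra ℂ B] [UniformSpace B] [hB : ArensMichaelAlgebra B]
  (s : LaurentTriple (dilation q) B)

omit hq hB in
-- The radii are read off the triple: bounds for θ(z) and for μ(1), ν(1), increased by 1 to be
-- positive. `LaurentTriple.le_term` holds for every word over n, hence for the infimum.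
lemma exists_le_term {p : Seminorm ℂ B} (hp : ∀ a b, p (a * b) ≤ p a * p b) :
    ∃ (i : {l : ℝ≥0 // 0 < l} × {r : ℝ≥0 // 0 < r}) (C : ℝ), 0 ≤ C ∧ ∀ (m : ℕ) (n : ℤ),
      p (s.term m n) ≤ C * (minWeight q Word.peak i.1 i.2 m n).toReal := by
  set L : ℝ≥0 := (p (s.θ Entire.Z)).toNNReal + 1
  set R : ℝ≥0 := (max (p (s.μ 1)) (p (s.ν 1))).toNNReal + 1
  have hL : p (s.θ Entire.Z) ≤ L := by
    have := Real.le_coe_toNNReal (p (s.θ Entire.Z))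
    push_cast [L]
    linarith
  have hR : max (p (s.μ 1)) (p (s.ν 1)) ≤ R := by
    have := Real.le_coe_toNNReal (max (p (s.μ 1)) (p (s.ν 1)))
    push_cast [R]
    linarith
  refine ⟨(⟨L, by positivity⟩, ⟨R, by positivity⟩), p 1 ^ 3, by positivity, fun m n => ?_⟩
  have h0 : (0 : ℝ) ≤ p 1 ^ 3 := by positivity
  have h1 : ENNReal.ofReal (p (s.term m n)) ≤
      ENNReal.ofReal (p 1 ^ 3) * minWeight q Word.peak L R m n := by
    rw [minWeight, ENNReal.mul_iInf' (fun h => (ENNReal.ofReal_ne_top h).elim)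
      (fun _ => inferInstance)]
    refine le_iInf fun ⟨w, hw⟩ => ?_
    subst hw
    refine (ENNReal.ofReal_le_ofReal (s.le_term hp hL ((le_max_left _ _).trans hR)
      ((le_max_right _ _).trans hR) m w)).trans ?_
    rw [ENNReal.ofReal_mul h0, ENNReal.ofReal_coe_nnreal]
  have h2 := ENNReal.toReal_mono
    (ENNReal.mul_ne_top ENNReal.ofReal_ne_top (minWeight_ne_top q _ _ _ _ _)) h1
  rwa [ENNReal.toReal_mul, ENNReal.toReal_ofReal (apply_nonneg _ _),
    ENNReal.toReal_ofReal h0] at h2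

omit hB in
lemma exists_summable_le {p : Seminorm ℂ B} (hp : ∀ a b, p (a * b) ≤ p a * p b) :
    ∃ (i : {l : ℝ≥0 // 0 < l} × {r : ℝ≥0 // 0 < r}) (C : ℝ), ∀ a : LaurentSpace q,
      (Summable fun k : ℕ × ℤ => p (a.coeff k.1 k.2 • s.term k.1 k.2)) ∧
        ∑' k : ℕ × ℤ, p (a.coeff k.1 k.2 • s.term k.1 k.2) ≤ C * peakSeminorm q i a := by
  obtain ⟨i, C, hC, h⟩ := exists_le_term s hp
  refine ⟨i, C, fun a => ?_⟩
  have hne := (peakNorm_lt_top i.1.2 i.2.2 a).ne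
  have h1 : Summable fun k : ℕ × ℤ => C * (‖a.coeff k.1 k.2‖ₑ *
      minWeight q Word.peak i.1 i.2 k.1 k.2).toReal :=
    (ENNReal.summable_toReal hne).mul_left C
  have h2 : ∀ k : ℕ × ℤ, p (a.coeff k.1 k.2 • s.term k.1 k.2) ≤
      C * (‖a.coeff k.1 k.2‖ₑ * minWeight q Word.peak i.1 i.2 k.1 k.2).toReal := by
    intro k
    rw [map_smul_eq_mul, ENNReal.toReal_mul, toReal_enorm, mul_left_comm]
    exact mul_le_mul_of_nonneg_left (h k.1 k.2) (norm_nonneg _)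
  have h3 := h1.of_nonneg_of_le (fun _ => apply_nonneg _ _) h2
  refine ⟨h3, (h3.tsum_le_tsum h2 h1).trans (le_of_eq ?_)⟩
  rw [tsum_mul_left]
  congr 1
  exact (ENNReal.tsum_toReal_eq fun k =>
    ENNReal.mul_ne_top enorm_ne_top (minWeight_ne_top q _ _ _ _ _)).symm

include hB in
lemma summable_lift (a : LaurentSpace q) :
    Summable fun k : ℕ × ℤ => a.coeff k.1 k.2 • s.term k.1 k.2 := by
  have := hB.isUniformAddGroup
  have := hB.completeSpace
  obtain ⟨P, hP, hw⟩ := hB.exists_seminorms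
  refine hw.summable_of_summable fun p => ?_
  obtain ⟨i, C, h⟩ := exists_summable_le s (hP p p.2)
  exact (h a).1

/-- The linear map determined by a triple. -/
noncomputable def liftₗ : LaurentSpace q →ₗ[ℂ] B where
  toFun a := ∑' k : ℕ × ℤ, a.coeff k.1 k.2 • s.term k.1 k.2
  map_add' a b := by
    have := hB.isUniformAddGroup
    have := hB.t2Space
    rw [← (summable_lift s a).tsum_add (summable_lift s b)]
    refine tsum_congr fun k => ?_
    rw [← add_smul]
    rfl
  map_smul' c a := by
    have := hB.isUniformAddGroup
    have := hB.t2Space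
    obtain ⟨P, hP, hw⟩ := hB.exists_seminorms
    have := hw.continuousSMul
    rw [RingHom.id_apply, ← (summable_lift s a).tsum_const_smul c]
    refine tsum_congr fun k => ?_
    rw [smul_smul]
    rfl

lemma continuous_liftₗ : Continuous (liftₗ s) := by
  have := hB.isUniformAddGroup
  have := hB.t2Space
  obtain ⟨P, hP, hw⟩ := hB.exists_seminorms
  refine withSeminorms_peak.continuous_of_le hw (liftₗ s) fun p => ?_
  obtain ⟨i, C, h⟩ := exists_summable_le s (hP p p.2)
  exact ⟨i, C, fun a => (hw.le_tsum_of_hasSum (summable_lift s a).hasSum p (h a).1).trans (h a).2⟩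

/-- The continuous linear map determined by a triple. -/
noncomputable def liftL : LaurentSpace q →L[ℂ] B := ⟨liftₗ s, continuous_liftₗ s⟩

lemma liftL_term (m : ℕ) (n : ℤ) : liftL s ((triple q).term m n) = s.term m n := by
  have := hB.t2Space
  change ∑' k : ℕ × ℤ, ((triple q).term m n).coeff k.1 k.2 • s.term k.1 k.2 = _
  rw [tsum_eq_single (m, n)]
  · rw [coeff_term]; simp
  · intro k hk
    rw [coeff_term, if_neg hk, zero_smul]

/-- Both sides are linear and continuous in each variable separately, so it suffices to compare them
on monomials, where `LaurentTriple.term_mul_term` gives the same rule in both algebras. -/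
lemma liftL_mul (a b : LaurentSpace q) : liftL s (a * b) = liftL s a * liftL s b := by
  have := hB.t2Space
  have := ArensMichaelAlgebra.continuousMul B
  let mr : B → B →L[ℂ] B := fun b => ⟨LinearMap.mulRight ℂ b, continuous_mul_const b⟩
  let ml : B → B →L[ℂ] B := fun b => ⟨LinearMap.mulLeft ℂ b, continuous_const_mul b⟩
  let mr' : LaurentSpace q → LaurentSpace q →L[ℂ] LaurentSpace q :=
    fun b => ⟨LinearMap.mulRight ℂ b, continuous_mul_const b⟩
  let ml' : LaurentSpace q → LaurentSpace q →L[ℂ] LaurentSpace q :=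
    fun b => ⟨LinearMap.mulLeft ℂ b, continuous_const_mul b⟩
  have h1 : ∀ m n b, liftL s ((triple q).term m n * b) = s.term m n * liftL s b := by
    intro m n b
    have : (liftL s).comp (ml' ((triple q).term m n)) = (ml (s.term m n)).comp (liftL s) :=
      continuousLinearMap_ext fun i j => by
        change liftL s ((triple q).term m n * (triple q).term i j) =
          s.term m n * liftL s ((triple q).term i j)
        rw [LaurentTriple.term_mul_term, map_smul, liftL_term, liftL_term,
          LaurentTriple.term_mul_term]
    exact congrArg (fun f => f b) this
  have : (liftL s).comp (mr' b) = (mr (liftL s b)).comp (liftL s) :=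
    continuousLinearMap_ext fun i j => by
      change liftL s ((triple q).term i j * b) = liftL s ((triple q).term i j) * liftL s b
      rw [h1, liftL_term]
  exact congrArg (fun f => f a) this

/-- The continuous algebra homomorphism determined by a triple. -/
noncomputable def lift : LaurentSpace q →A[ℂ] B where
  toAlgHom := AlgHom.ofLinearMap (liftₗ s)
    (by
      have := liftL_term s 0 0
      rwa [LaurentTriple.term_zero_zero, LaurentTriple.term_zero_zero] at this)
    (liftL_mul s)
  cont := continuous_liftₗ s

lemma lift_term (m : ℕ) (n : ℤ) : lift s ((triple q).term m n) = s.term m n := liftL_term s m n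

/-- Both sides are continuous in a and agree on the powers of z, so the Taylor expansion decides. -/
lemma lift_θ (a : Entire) : lift s ((triple q).θ a) = s.θ a := by
  have := hB.t2Space
  have h1 := (Entire.hasSum_Z_pow a).map ((lift s).comp (triple q).θ)
    ((lift s).comp (triple q).θ).continuous
  have h2 := (Entire.hasSum_Z_pow a).map s.θ s.θ.continuous
  refine h1.unique ?_
  convert h2 using 1
  funext m
  change lift s ((triple q).θ (taylorCoeff a m • Entire.Z ^ m)) =
    s.θ (taylorCoeff a m • Entire.Z ^ m)
  rw [map_smul, map_smul, map_smul, ← LaurentTriple.term_zero, lift_term, LaurentTriple.term_zero]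

lemma lift_μ (a : Entire) : lift s ((triple q).μ a) = s.μ a := by
  rw [LaurentTriple.μ_eq, map_mul, lift_θ, ← LaurentTriple.term_zero_one, lift_term,
    LaurentTriple.term_zero_one, ← LaurentTriple.μ_eq]

lemma lift_ν (a : Entire) : lift s ((triple q).ν a) = s.ν a := by
  rw [LaurentTriple.ν_eq, map_mul, lift_θ, ← LaurentTriple.term_zero_neg_one, lift_term,
    LaurentTriple.term_zero_neg_one, ← LaurentTriple.ν_eq]

lemma eq_lift (f : LaurentSpace q →A[ℂ] B) (hθ : ∀ a, f ((triple q).θ a) = s.θ a)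
    (hμ : ∀ a, f ((triple q).μ a) = s.μ a) : f = lift s := by
  have := hB.t2Space
  have h : (⟨f.toAlgHom.toLinearMap, f.cont⟩ : LaurentSpace q →L[ℂ] B) = liftL s :=
    continuousLinearMap_ext fun m n =>
      (f.map_term hθ (hμ 1) m n).trans (lift_term s m n).symm
  ext a
  exact congrArg (fun g : LaurentSpace q →L[ℂ] B => g a) h

end Lift

end LaurentSpace

/-! ### The topological Laurent tensor algebra -/

namespace LaurentSpace

variable {q : ℂˣ} [hq : Fact (1 < ‖(q : ℂ)‖₊)]

variable (q) in
/-- The lift to another universe, as a continuous algebra homomorphism. -/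
noncomputable def up : LaurentSpace q →A[ℂ] ULift.{u} (LaurentSpace q) where
  toAlgHom := (ULift.algEquiv (R := ℂ) (A := LaurentSpace q)).symm.toAlgHom
  cont := continuous_uliftUp

variable (q) in
/-- The inverse of `up`. -/
noncomputable def down : ULift.{u} (LaurentSpace q) →A[ℂ] LaurentSpace q where
  toAlgHom := (ULift.algEquiv (R := ℂ) (A := LaurentSpace q)).toAlgHom
  cont := continuous_uliftDown

/-- The space of series lives in the lowest universe, while the test algebras range over `Type u`;
hence the lift. -/
theorem isTopLaurentAlgebra_ulift : IsTopLaurentAlgebra.{u} (dilation q)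
    (ULift.{u} (LaurentSpace q)) ((triple q).map (up q)) := by
  intro B _ _ _ _ s
  refine ⟨(lift s).comp (down q), ⟨lift_θ s, lift_μ s, lift_ν s⟩, ?_⟩
  rintro f ⟨hθ, hμ, -⟩
  have h := eq_lift s (f.comp (up q)) hθ hμ
  rw [← h]
  rfl

end LaurentSpace

/-- Two topological Laurent tensor algebras are isomorphic. -/
theorem IsTopLaurentAlgebra.exists_equiv {A : Type*} [Ring A] [Algebra ℂ A] [TopologicalSpace A]
    {α : A ≃ₐ[ℂ] A} {L L' : Type u} [Ring L] [Algebra ℂ L] [UniformSpace L]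
    [ArensMichaelAlgebra L] [Ring L'] [Algebra ℂ L'] [UniformSpace L'] [ArensMichaelAlgebra L']
    {t : LaurentTriple α L} {t' : LaurentTriple α L'} (h : IsTopLaurentAlgebra α L t)
    (h' : IsTopLaurentAlgebra α L' t') :
    ∃ (e : L ≃L[ℂ] L') (f : L →A[ℂ] L'), (∀ a, e a = f a) ∧ (∀ a, f (t.θ a) = t'.θ a) ∧
      (∀ x, f (t.μ x) = t'.μ x) ∧ ∀ y, f (t.ν y) = t'.ν y := by
  obtain ⟨f, ⟨f1, f2, f3⟩, -⟩ := h L' t'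
  obtain ⟨g, ⟨g1, g2, g3⟩, -⟩ := h' L t
  have e1 : g.comp f = ContinuousAlgHom.id ℂ L :=
    (h L t).unique ⟨fun a => (congrArg g (f1 a)).trans (g1 a),
      fun a => (congrArg g (f2 a)).trans (g2 a), fun a => (congrArg g (f3 a)).trans (g3 a)⟩
      ⟨fun _ => rfl, fun _ => rfl, fun _ => rfl⟩
  have e2 : f.comp g = ContinuousAlgHom.id ℂ L' :=
    (h' L' t').unique ⟨fun a => (congrArg f (g1 a)).trans (f1 a),
      fun a => (congrArg f (g2 a)).trans (f2 a), fun a => (congrArg f (g3 a)).trans (f3 a)⟩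
      ⟨fun _ => rfl, fun _ => rfl, fun _ => rfl⟩
  exact ⟨ContinuousLinearEquiv.equivOfInverse ⟨f.toAlgHom.toLinearMap, f.cont⟩
    ⟨g.toAlgHom.toLinearMap, g.cont⟩ (fun a => congrArg (fun k : L →A[ℂ] L => k a) e1)
    (fun a => congrArg (fun k : L' →A[ℂ] L' => k a) e2), f, fun _ => rfl, f1, f2, f3⟩

/-! ### The main theorem -/

theorem mainTheorem9 (q : ℂˣ) (hq : 1 < ‖(q : ℂ)‖) :
    -- the functionals `φ_{m,n}` are given by convergent sums, linear and continuous
    (∀ (m : ℕ) (n : ℤ),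
      (∀ f : ConvSeries q,
        Summable fun w : {w : Word // w.c = n} => taylorCoeff (f.toSeries.coeff w) m) ∧
      ∃ ψ : ConvSeries q →L[ℂ] ℂ, ∀ f, ψ f = ConvSeries.φ m n f) ∧
    -- the closed ideal `I` is their common kernel
    ConvSeries.closedIdeal q = {f | ∀ m n, ConvSeries.φ m n f = 0} ∧
    -- the quotient seminorms are the seminorms `‖·‖'_{l,r}`
    (∀ (l r : ℝ≥0), 0 < l → 0 < r → ∀ f : ConvSeries q,
      ConvSeries.quotientNorm l r f = laurentNorm q l r fun m n => ConvSeries.φ m n f) ∧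
    -- `f ↦ (φ_{m,n}(f))` maps `A{x₁, x₂; β_q}` onto the space of Laurent series
    (∀ a : LaurentSpace q, ∃ f : ConvSeries q, ∀ m n, ConvSeries.φ m n f = a.coeff m n) ∧
    -- the topological Laurent tensor algebra of `A_{β_q}` exists
    (∃ (L : Type u) (_ : Ring L) (_ : Algebra ℂ L) (_ : UniformSpace L)
      (_ : ArensMichaelAlgebra L) (t : LaurentTriple (dilation q) L),
      IsTopLaurentAlgebra.{u} (dilation q) L t) ∧
    -- and it is isomorphic to the space of Laurent series, with `x = μ(1)` and `x⁻¹ = ν(1)`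
    (∀ (L : Type u) [Ring L] [Algebra ℂ L] [UniformSpace L] [ArensMichaelAlgebra L]
      (t : LaurentTriple (dilation q) L), IsTopLaurentAlgebra.{u} (dilation q) L t →
      ∃ Φ : L ≃L[ℂ] LaurentSpace q,
        (∀ (f : Entire) (k m : ℕ) (n : ℤ),
          (Φ (t.θ f * t.μ 1 ^ k)).coeff m n = if n = k then taylorCoeff f m else 0) ∧
        (∀ (f : Entire) (k m : ℕ) (n : ℤ),
          (Φ (t.θ f * t.ν 1 ^ k)).coeff m n = if n = -k then taylorCoeff f m else 0) ∧
        (∀ (a b : L) (m : ℕ) (n : ℤ),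
          HasSum (fun k : ℤ => ∑ ij ∈ Finset.HasAntidiagonal.antidiagonal m,
            (q : ℂ) ^ (k * ij.2) * (Φ a).coeff ij.1 k * (Φ b).coeff ij.2 (n - k))
            ((Φ (a * b)).coeff m n))) := by
  have : Fact (1 < ‖(q : ℂ)‖₊) := ⟨hq⟩
  refine ⟨fun m n => ⟨fun f => (ConvSeries.hasSum_φ m n f).summable, ConvSeries.φL q m n,
    fun _ => rfl⟩, ConvSeries.closedIdeal_eq, fun l r hl hr f => ConvSeries.quotientNorm_eq hl hr f,
    fun a => ?_, ⟨ULift.{u} (LaurentSpace q), inferInstance, inferInstance, inferInstance,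
    inferInstance, _, LaurentSpace.isTopLaurentAlgebra_ulift⟩, ?_⟩
  · obtain ⟨f, rfl⟩ := ConvSeries.toLaurent_surjective a
    exact ⟨f, fun _ _ => rfl⟩
  · intro L _ _ _ _ t ht
    -- Uniqueness of the universal object reduces all formulas to the space of series, where the
    -- images of θ, μ(1) and ν(1) are explicit.
    obtain ⟨e, g, he, hθ, hμ, hν⟩ :=
      ht.exists_equiv (LaurentSpace.isTopLaurentAlgebra_ulift (q := q))
    have hmul : ∀ a b, (e (a * b)).down = (e a).down * (e b).down := fun a b => by
      rw [he, he, he, map_mul]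
      rfl
    have hpow : ∀ (a : L) (k : ℕ), (e (a ^ k)).down = (e a).down ^ k := fun a k => by
      rw [he, he, map_pow]
      rfl
    have hθ' : ∀ f, (e (t.θ f)).down = LaurentSpace.θ q f := fun f => by
      rw [he, hθ]
      rfl
    have hμ' : (e (t.μ 1)).down = (LaurentSpace.triple q).μ 1 := by
      rw [he, hμ]
      rfl
    have hν' : (e (t.ν 1)).down = (LaurentSpace.triple q).ν 1 := by
      rw [he, hν]
      rfl
    refine ⟨e.trans ContinuousLinearEquiv.ulift, fun f k m n => ?_, fun f k m n => ?_,
      fun a b m n => ?_⟩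
    · change ((e (t.θ f * t.μ 1 ^ k)).down).coeff m n = _
      rw [hmul, hpow, hθ', hμ', ← LaurentTriple.val_unit, ← Units.val_pow_eq_pow_val,
        ← zpow_natCast]
      exact LaurentSpace.coeff_θ_mul_unit_zpow f k m n
    · change ((e (t.θ f * t.ν 1 ^ k)).down).coeff m n = _
      rw [hmul, hpow, hθ', hν', ← LaurentTriple.val_inv_unit, ← Units.val_pow_eq_pow_val,
        inv_pow, ← zpow_natCast, ← zpow_neg]
      exact LaurentSpace.coeff_θ_mul_unit_zpow f (-k) m n
    · change HasSum _ (((e (a * b)).down).coeff m n)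
      rw [hmul]
      exact LaurentSpace.hasSum_coeff_mul _ _ m n
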